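/- Let $M_1,M_2$ be finite-dimensional real smooth manifolds (without boundary, Hausdorff, second countable), $\mathbb{T}M=TM\oplus T^*M$, $\langle X+\alpha,Y+\beta\rangle=\frac12(\alpha(Y)+\beta(X))$, and $[X+\alpha,Y+\beta]=[X,Y]+\mathcal L_X\beta-\iota_Yd\alpha$ the Dorfman bracket, extended complex bilinearly. A split structure of rank $2k$ is a subbundle $E\subseteq\mathbb{T}M$ on which $\langle\,,\rangle$ is nondegenerate of signature $(k,k)$; $\mathrm{SGF}(E)$ is the set of bundle endomorphisms $J$ of $E$ that are skew-symmetric and orthogonal, $L_J\subseteq E\otimes\mathbb{C}$ is the $\sqrt{-1}$-eigenbundle, and $J\in\mathrm{CRF}(E)$ means that $\Gamma(L_J)$ is closed under the bracket. A generalized complex structure is an element of $\mathrm{CRF}(\mathbb{T}M)$. A framing of $E$ is a real subspace $V\subseteq\Gamma(E)$ with $\dim V=\operatorname{rank}E$ that generates $\Gamma(E)$ over $C^\infty(M)$. For $i=1,2$ let $J_i$ be a generalized almost contact structure on $M_i$: $E_i'\subseteq\mathbb{T}M_i$ is a split structure of rank $2$ that is a trivial bundle, $E_i=(E_i')^\perp$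 (so that $E_i'=E_i^\perp$), and $J_i\in\mathrm{SGF}(E_i)$. Let $V_i$ be a framing of $E_i'$. The pair $(J_i,V_i)$ is normal if $J_i\in\mathrm{CRF}(E_i)$ and $[v,\Gamma(L_{J_i})]\subseteq\Gamma(L_{J_i})$, $[v,\Gamma(E_i')]\subseteq\Gamma(E_i')$ for all $v\in V_i$. Let $\pi_i:M_1\times M_2\to M_i$ be the projections. For $\Psi\in\mathrm{SGF}(\pi_1^*E_1'\oplus\pi_2^*E_2')$, the triple $(V_1,V_2,\Psi)$ is admissible if there is an isomorphism of $C^\infty(M_1\times M_2,\mathbb{C})$-modules $\phi:\Gamma(\pi_1^*E_1'\otimes\mathbb{C})\to\Gamma(\pi_2^*E_2'\otimes\mathbb{C})$ with $\phi(\pi_1^*V_1\otimes\mathbb{C})=\pi_2^*V_2\otimes\mathbb{C}$ and such that $L_\Psi$ is the graph $\{e+\phi(e)\}$ of $\phi$. The Morimoto product is $J_1\boxplus_\Psi J_2=\pi_1^*J_1\oplus\pi_2^*J_2\oplus\Psi$, an endomorphism of $\mathbb{T}(M_1\times M_2)$. If $(V_1,V_2,\Psi)$ is admissible, then: (a) $J_1\boxplus_\Psi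 J_2$ is a generalized complex structure on $M_1\times M_2$ if and only if $(J_1,V_1)$ and $(J_2,V_2)$ are both normal pairs. (b) For each $i$, $V_i$ has a basis $e_1,e_2$ with $\langle e_1,e_1\rangle=\langle e_2,e_2\rangle=0$ and $2\langle e_1,e_2\rangle=1$. For every such basis, if $\Phi_i$ denotes the extension of $J_i$ to $\mathbb{T}M_i$ by zero on $E_i'$, then $(\Phi_i,e_1,e_2)$ is a generalized almost contact triple, that is, $\Phi_i$ is a smooth skew-symmetric endomorphism and $\Phi_i^2=-\mathrm{Id}+2\langle e_1,\cdot\rangle e_2+2\langle e_2,\cdot\rangle e_1$. Moreover $(J_i,V_i)$ is a normal pair if and only if this triple is normal, that is, both $L_{J_i}\oplus\mathbb{C}e_1$ and $L_{J_i}\oplus\mathbb{C}e_2$ are closed under the bracket and $[e_1,e_2]=0$. (c) In particular, for given $J_i$ and $V_i$, integrability does not depend on the choice of $\Psi$: if $(V_1,V_2,\Psi)$ and $(V_1,V_2,\Psi')$ are admissible, then $J_1\boxplus_\Psi J_2$ is a generalized complex structure if and only if $J_1\boxplus_{\Psi'}J_2$ is. -/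

import Mathlib

open scoped Manifold ContDiff
open Bundle

noncomputable section

/-! ### Complexification of a real vector space -/

/-- The complexification `V ⊗ ℂ = V ⊕ √-1 V` of a real vector space; `(x, y)` stands for
`x + √-1 y`. -/
def Cx (V : Type*) : Type _ := V × V

namespace Cx

variable {V : Type*}

/-- The real part. -/
def re (z : Cx V) : V := z.1

/-- The imaginary part. -/
def im (z : Cx V) : V := z.2

/-- The vector `x + √-1 y`. -/
def mk (x y : V) : Cx V := (x, y)

instance [AddCommGroup V] : AddCommGroup (Cx V) := inferInstanceAs (AddCommGroup (V × V))

instance [AddCommGroup V] [Module ℝ V] : SMul ℂ (Cx V) :=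
  ⟨fun c z => mk (c.re • z.re - c.im • z.im) (c.re • z.im + c.im • z.re)⟩

@[ext] theorem ext {z w : Cx V} (h₁ : z.re = w.re) (h₂ : z.im = w.im) : z = w :=
  Prod.ext h₁ h₂

@[simp] theorem re_mk (x y : V) : (mk x y).re = x := rfl
@[simp] theorem im_mk (x y : V) : (mk x y).im = y := rfl
@[simp] theorem re_add [AddCommGroup V] (z w : Cx V) : (z + w).re = z.re + w.re := rfl
@[simp] theorem im_add [AddCommGroup V] (z w : Cx V) : (z + w).im = z.im + w.im := rfl
@[simp] theorem re_zero [AddCommGroup V] : (0 : Cx V).re = 0 := rfl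
@[simp] theorem im_zero [AddCommGroup V] : (0 : Cx V).im = 0 := rfl
@[simp] theorem re_smul [AddCommGroup V] [Module ℝ V] (c : ℂ) (z : Cx V) :
    (c • z).re = c.re • z.re - c.im • z.im := rfl
@[simp] theorem im_smul [AddCommGroup V] [Module ℝ V] (c : ℂ) (z : Cx V) :
    (c • z).im = c.re • z.im + c.im • z.re := rfl

instance [AddCommGroup V] [Module ℝ V] : Module ℂ (Cx V) where
  one_smul z := by ext <;> simp
  mul_smul c d z := by ext <;> simp <;> module
  smul_zero c := by ext <;> simp
  smul_add c z w := by ext <;> simp <;> module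
  add_smul c d z := by ext <;> simp <;> module
  zero_smul z := by ext <;> simp

end Cx

namespace GenGeom

/-! ### The generalized tangent bundle and the Dorfman bracket -/

section Basic

variable {E : Type*} [NormedAddCommGroup E] [NormedSpace ℝ E]
  {H : Type*} [TopologicalSpace H] (I : ModelWithCorners ℝ E H)
  {M : Type*} [TopologicalSpace M] [ChartedSpace H M] [IsManifold I ∞ M]

/-- The fibre `T_p M ⊕ T_p^* M` of the generalized tangent bundle `𝕋M` at `p`. -/
abbrev GT (p : M) : Type _ := TangentSpace I p × (TangentSpace I p →L[ℝ] ℝ)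

/-- The tautological inner product `⟨X + α, Y + β⟩ = (α(Y) + β(X)) / 2`. -/
def pairing (p : M) (x y : GT I p) : ℝ := (1 / 2) * (x.2 y.1 + y.2 x.1)

/-- The orthogonal complement of a subspace of a fibre of `𝕋M`. -/
def orthFibre (p : M) (S : Submodule ℝ (GT I p)) : Submodule ℝ (GT I p) where
  carrier := {x | ∀ y ∈ S, pairing I p x y = 0}
  zero_mem' := by intro y _; simp [pairing]
  add_mem' := by
    intro a b ha hb y hy
    have h1 := ha y hy
    have h2 := hb y hy
    simp only [pairing, Prod.fst_add, Prod.snd_add, map_add, add_apply]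
      at h1 h2 ⊢
    linarith
  smul_mem' := by
    intro c a ha y hy
    have h1 := ha y hy
    simp only [pairing, Prod.smul_fst, Prod.smul_snd, map_smul, smul_apply,
      smul_eq_mul] at h1 ⊢
    linear_combination c * h1

/-- The orthogonal complement `F^⊥` of a family of subspaces `F_p ⊆ 𝕋_p M`. -/
def orth (F : ∀ p : M, Submodule ℝ (GT I p)) : ∀ p : M, Submodule ℝ (GT I p) :=
  fun p => orthFibre I p (F p)

/-- The coordinate expression of a one-form `α` in the preferred chart at `p`, as a function with
values in the dual of the model space (meaningful on the domain of that chart). -/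
def formInChart (α : ∀ p : M, TangentSpace I p →L[ℝ] ℝ) (p : M) : M → (E →L[ℝ] ℝ) :=
  fun q => (α q).comp ((trivializationAt E (TangentSpace I : M → Type _) p).symmL ℝ q)

/-- The contraction `ι_u dα` at `p` of the exterior derivative of a one-form `α` with a tangent
vector `u` at `p`. In coordinates, `dα(u, v) = (∂_u α)(v) - (∂_v α)(u)`; the preferred chart at `p`
induces the identity of `T_p M = E`. -/
def contrExtDeriv (α : ∀ p : M, TangentSpace I p →L[ℝ] ℝ) (p : M) (u : TangentSpace I p) :
    TangentSpace I p →L[ℝ] ℝ :=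
  let D : E →L[ℝ] (E →L[ℝ] ℝ) := mfderiv I 𝓘(ℝ, E →L[ℝ] ℝ) (formInChart I α p) p
  let u' : E := u
  let c : E →L[ℝ] ℝ := D u' - D.flip u'
  c

/-- The Lie derivative `ℒ_X β = ι_X dβ + d(β(X))` of a one-form. -/
def lieDerivForm (X : ∀ p : M, TangentSpace I p) (β : ∀ p : M, TangentSpace I p →L[ℝ] ℝ) (p : M) :
    TangentSpace I p →L[ℝ] ℝ :=
  let d : TangentSpace I p →L[ℝ] ℝ := mfderiv I 𝓘(ℝ, ℝ) (fun q => β q (X q)) p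
  contrExtDeriv I β p (X p) + d

/-- The Dorfman bracket `[X + α, Y + β] = [X, Y] + ℒ_X β - ι_Y dα`. -/
def dorfman (x y : ∀ p : M, GT I p) : ∀ p : M, GT I p := fun p =>
  (VectorField.mlieBracket I (fun q => (x q).1) (fun q => (y q).1) p,
    lieDerivForm I (fun q => (x q).1) (fun q => (y q).2) p -
      contrExtDeriv I (fun q => (x q).2) p (y p).1)

/-- The complex bilinear extension of the Dorfman bracket to sections of `𝕋M ⊗ ℂ`. -/
def cDorfman (z w : ∀ p : M, Cx (GT I p)) : ∀ p : M, Cx (GT I p) := fun p =>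
  Cx.mk
    (dorfman I (fun q => (z q).re) (fun q => (w q).re) p -
      dorfman I (fun q => (z q).im) (fun q => (w q).im) p)
    (dorfman I (fun q => (z q).re) (fun q => (w q).im) p +
      dorfman I (fun q => (z q).im) (fun q => (w q).re) p)

/-- A real section, regarded as a section of `𝕋M ⊗ ℂ`. -/
def toCx (x : ∀ p : M, GT I p) : ∀ p : M, Cx (GT I p) := fun p => Cx.mk (x p) 0

/-- The fibrewise complexification `F ⊗ ℂ` of a family of real subspaces. -/
def complexify (F : ∀ p : M, Submodule ℝ (GT I p)) : ∀ p : M, Set (Cx (GT I p)) :=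
  fun p => {z | z.re ∈ F p ∧ z.im ∈ F p}

/-- The `√-1`-eigenbundle of an endomorphism `Φ` of `𝕋M`: the vectors `x + √-1 y` such that
`Φ(x) + √-1 Φ(y) = √-1 (x + √-1 y)`. -/
def eigenbundle (Φ : ∀ p : M, GT I p →ₗ[ℝ] GT I p) : ∀ p : M, Set (Cx (GT I p)) :=
  fun p => {z | Cx.mk (Φ p z.re) (Φ p z.im) = Complex.I • z}

end Basic

/-! ### Smooth sections, split structures, generalized `F`-structures -/

section Smooth

variable {E : Type*} [NormedAddCommGroup E] [NormedSpace ℝ E]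
  {H : Type*} [TopologicalSpace H] (I : ModelWithCorners ℝ E H)
  {M : Type*} [TopologicalSpace M] [ChartedSpace H M] [IsManifold I ∞ M]

/-- Smooth sections of `𝕋M`: the vector field and the one-form are smooth. -/
def IsSmooth (x : ∀ p : M, GT I p) : Prop :=
  ContMDiff I (I.prod 𝓘(ℝ, E)) ∞
    (fun p => TotalSpace.mk' E (E := (TangentSpace I : M → Type _)) p (x p).1) ∧
  ContMDiff I (I.prod 𝓘(ℝ, E →L[ℝ] ℝ)) ∞
    (fun p => TotalSpace.mk' (E →L[ℝ] ℝ)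
      (E := fun p : M => TangentSpace I p →L[ℝ] Bundle.Trivial M ℝ p) p (x p).2)

/-- The space `Γ(F)` of smooth sections of a real subbundle `F` of `𝕋M`. -/
def sections (F : ∀ p : M, Submodule ℝ (GT I p)) : Set (∀ p : M, GT I p) :=
  {x | IsSmooth I x ∧ ∀ p, x p ∈ F p}

/-- The space `Γ(L)` of smooth sections of a (real or complex) subbundle `L` of `𝕋M ⊗ ℂ`. -/
def cSections (L : ∀ p : M, Set (Cx (GT I p))) : Set (∀ p : M, Cx (GT I p)) :=
  {z | IsSmooth I (fun p => (z p).re) ∧ IsSmooth I (fun p => (z p).im) ∧ ∀ p, z p ∈ L p}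

/-- `F` is a split structure of rank `2k`: a smooth subbundle of `𝕋M` on whose fibres the
tautological inner product is nondegenerate of signature `(k, k)`. Local frames are written as
restrictions of global smooth sections, which is no loss because of cut-off functions. -/
structure IsSplitStructure (k : ℕ) (F : ∀ p : M, Submodule ℝ (GT I p)) : Prop where
  localFrame : ∀ p : M, ∃ s : Fin (2 * k) → ∀ q : M, GT I q, (∀ i, IsSmooth I (s i)) ∧
    ∀ᶠ q in nhds p, LinearIndependent ℝ (fun i => s i q) ∧
      Submodule.span ℝ (Set.range fun i => s i q) = F q
  signature : ∀ p : M, ∃ e f : Fin k → GT I p,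
    (∀ i j, pairing I p (e i) (e j) = if i = j then 1 else 0) ∧
    (∀ i j, pairing I p (f i) (f j) = if i = j then -1 else 0) ∧
    (∀ i j, pairing I p (e i) (f j) = 0) ∧
    Submodule.span ℝ (Set.range e ∪ Set.range f) = F p

/-- `V` is a framing of the subbundle `F` of rank `r`: a real subspace of `Γ(F)` of dimension `r`
that generates `Γ(F)` as a `C^∞(M)`-module. -/
structure IsFraming (r : ℕ) (F : ∀ p : M, Submodule ℝ (GT I p))
    (V : Submodule ℝ (∀ p : M, GT I p)) : Prop where
  subset : ∀ v ∈ V, v ∈ sections I F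
  finite : Module.Finite ℝ V
  dim : Module.finrank ℝ V = r
  span : ∀ x ∈ sections I F, ∃ (n : ℕ) (f : Fin n → M → ℝ) (v : Fin n → ∀ p : M, GT I p),
    (∀ i, ContMDiff I 𝓘(ℝ, ℝ) ∞ (f i)) ∧ (∀ i, v i ∈ V) ∧ ∀ p, x p = ∑ i, f i p • v i p

/-- A split generalized `F`-structure `J ∈ SGF(F)`: a smooth endomorphism of the bundle `F` that is
skew-symmetric and orthogonal. It is represented by its extension by zero to
`𝕋M = F ⊕ F^⊥`, so that `Φ` maps `F` to `F`, restricts to `J` on `F`, and vanishes on `F^⊥`. -/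
structure IsSGF (F : ∀ p : M, Submodule ℝ (GT I p)) (Φ : ∀ p : M, GT I p →ₗ[ℝ] GT I p) :
    Prop where
  smooth : ∀ x : ∀ p : M, GT I p, IsSmooth I x → IsSmooth I (fun p => Φ p (x p))
  mapsTo : ∀ p, ∀ x ∈ F p, Φ p x ∈ F p
  zero_on_orth : ∀ p, ∀ x ∈ orth I F p, Φ p x = 0
  skew : ∀ p, ∀ x ∈ F p, ∀ y ∈ F p, pairing I p (Φ p x) y = -pairing I p x (Φ p y)
  orthogonal : ∀ p, ∀ x ∈ F p, ∀ y ∈ F p, pairing I p (Φ p x) (Φ p y) = pairing I p x y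

/-- A subbundle `L` of `𝕋M ⊗ ℂ` is closed under the Dorfman bracket. (The bracket of smooth
sections is smooth, so that only its values matter.) -/
def IsInvolutive (L : ∀ p : M, Set (Cx (GT I p))) : Prop :=
  ∀ z ∈ cSections I L, ∀ w ∈ cSections I L, ∀ p, cDorfman I z w p ∈ L p

/-- The section `z` of `𝕋M ⊗ ℂ` normalizes the subbundle `L`: `[z, Γ(L)] ⊆ Γ(L)`. -/
def Normalizes (z : ∀ p : M, Cx (GT I p)) (L : ∀ p : M, Set (Cx (GT I p))) : Prop :=
  ∀ w ∈ cSections I L, ∀ p, cDorfman I z w p ∈ L p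

/-- The real section `x` normalizes the real subbundle `F` of `𝕋M`: `[x, Γ(F)] ⊆ Γ(F)`. -/
def NormalizesReal (x : ∀ p : M, GT I p) (F : ∀ p : M, Submodule ℝ (GT I p)) : Prop :=
  ∀ y ∈ sections I F, ∀ p, dorfman I x y p ∈ F p

/-- Split generalized CRF-structures on `F`: the `√-1`-eigenbundle is closed under the Dorfman
bracket. -/
def IsCRF (F : ∀ p : M, Submodule ℝ (GT I p)) (Φ : ∀ p : M, GT I p →ₗ[ℝ] GT I p) : Prop :=
  IsSGF I F Φ ∧ IsInvolutive I (eigenbundle I Φ)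

/-- Generalized complex structures on `M` are the CRF-structures on the whole of `𝕋M`. -/
def IsGeneralizedComplex (Φ : ∀ p : M, GT I p →ₗ[ℝ] GT I p) : Prop :=
  IsCRF I (fun _ => ⊤) Φ

/-- A normal pair `(J, V)`, where `J` lives on `F` and `V` is a framing of `F' ⊆ F^⊥`:
`J` is a CRF-structure and every element of `V` normalizes `J` and `F'`. -/
def IsNormalPair (F F' : ∀ p : M, Submodule ℝ (GT I p)) (Φ : ∀ p : M, GT I p →ₗ[ℝ] GT I p)
    (V : Submodule ℝ (∀ p : M, GT I p)) : Prop :=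
  IsCRF I F Φ ∧ ∀ v ∈ V, Normalizes I (toCx I v) (eigenbundle I Φ) ∧ NormalizesReal I v F'

/-- A generalized almost contact structure: a split structure `F'` of rank `2` that is a trivial
bundle, and a split generalized `F`-structure on `F'^⊥`. -/
structure IsGenAlmostContact (F' : ∀ p : M, Submodule ℝ (GT I p))
    (Φ : ∀ p : M, GT I p →ₗ[ℝ] GT I p) : Prop where
  split : IsSplitStructure I 1 F'
  trivial : ∃ V, IsFraming I 2 F' V
  sgf : IsSGF I (orth I F') Φ

/-- A generalized almost contact triple `(Φ, e₁, e₂)`: a skew endomorphism and two isotropic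
sections with `2⟨e₁, e₂⟩ = 1` and `Φ² = -Id + 2⟨e₁, ·⟩ e₂ + 2⟨e₂, ·⟩ e₁`. -/
structure IsGenAlmostContactTriple (Φ : ∀ p : M, GT I p →ₗ[ℝ] GT I p)
    (e₁ e₂ : ∀ p : M, GT I p) : Prop where
  smooth : ∀ x : ∀ p : M, GT I p, IsSmooth I x → IsSmooth I (fun p => Φ p (x p))
  smooth₁ : IsSmooth I e₁
  smooth₂ : IsSmooth I e₂
  isotropic₁ : ∀ p, pairing I p (e₁ p) (e₁ p) = 0
  isotropic₂ : ∀ p, pairing I p (e₂ p) (e₂ p) = 0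
  dual : ∀ p, 2 * pairing I p (e₁ p) (e₂ p) = 1
  skew : ∀ p x y, pairing I p (Φ p x) y = -pairing I p x (Φ p y)
  square : ∀ p x, Φ p (Φ p x) =
    -x + (2 * pairing I p (e₁ p) x) • e₂ p + (2 * pairing I p (e₂ p) x) • e₁ p

/-- The complex subbundle `L ⊕ ℂ e` of `𝕋M ⊗ ℂ`. -/
def addLine (L : ∀ p : M, Set (Cx (GT I p))) (e : ∀ p : M, GT I p) :
    ∀ p : M, Set (Cx (GT I p)) :=
  fun p => {z | ∃ l ∈ L p, ∃ c : ℂ, z = l + c • toCx I e p}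

/-- A generalized almost contact triple is normal if it is strongly integrable, i.e. both
`L ⊕ ℂ e₁` and `L ⊕ ℂ e₂` are closed under the bracket, where `L` is the `√-1`-eigenbundle of `Φ`,
and moreover `[e₁, e₂] = 0`. -/
structure IsNormalTriple (Φ : ∀ p : M, GT I p →ₗ[ℝ] GT I p) (e₁ e₂ : ∀ p : M, GT I p) : Prop where
  triple : IsGenAlmostContactTriple I Φ e₁ e₂
  integrable₁ : IsInvolutive I (addLine I (eigenbundle I Φ) e₁)
  integrable₂ : IsInvolutive I (addLine I (eigenbundle I Φ) e₂)
  commute : ∀ p, dorfman I e₁ e₂ p = 0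

/-- `(e₁, e₂)` is an isotropic basis of the framing `V` with `2⟨e₁, e₂⟩ = 1`. -/
structure IsIsotropicBasis (V : Submodule ℝ (∀ p : M, GT I p)) (e₁ e₂ : ∀ p : M, GT I p) :
    Prop where
  span_eq : Submodule.span ℝ {e₁, e₂} = V
  isotropic₁ : ∀ p, pairing I p (e₁ p) (e₁ p) = 0
  isotropic₂ : ∀ p, pairing I p (e₂ p) (e₂ p) = 0
  dual : ∀ p, 2 * pairing I p (e₁ p) (e₂ p) = 1

/-- `φ` is an isomorphism `Γ(F₁ ⊗ ℂ) → Γ(F₂ ⊗ ℂ)` of `C^∞(M, ℂ)`-modules. -/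
structure IsSectionIso (F₁ F₂ : ∀ p : M, Submodule ℝ (GT I p))
    (φ : (∀ p : M, Cx (GT I p)) → ∀ p : M, Cx (GT I p)) : Prop where
  bijOn : Set.BijOn φ (cSections I (complexify I F₁)) (cSections I (complexify I F₂))
  map_add : ∀ z ∈ cSections I (complexify I F₁), ∀ w ∈ cSections I (complexify I F₁),
    φ (z + w) = φ z + φ w
  map_smul : ∀ f : M → ℂ, ContMDiff I 𝓘(ℝ, ℂ) ∞ f → ∀ z ∈ cSections I (complexify I F₁),
    φ (fun p => f p • z p) = fun p => f p • φ z p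

/-- The complexification `V ⊗ ℂ` of a space of real sections, inside the sections of `𝕋M ⊗ ℂ`. -/
def framingCx (V : Submodule ℝ (∀ p : M, GT I p)) : Set (∀ p : M, Cx (GT I p)) :=
  {z | (fun p => (z p).re) ∈ V ∧ (fun p => (z p).im) ∈ V}

/-- `φ` is an admissible isomorphism for `(V₁, V₂, Ψ)`: it maps `V₁ ⊗ ℂ` onto `V₂ ⊗ ℂ`, and the
`√-1`-eigenbundle of `Ψ` is the graph of `φ`. -/
structure IsAdmissibleIso (F₁ F₂ : ∀ p : M, Submodule ℝ (GT I p))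
    (V₁ V₂ : Submodule ℝ (∀ p : M, GT I p)) (Ψ : ∀ p : M, GT I p →ₗ[ℝ] GT I p)
    (φ : (∀ p : M, Cx (GT I p)) → ∀ p : M, Cx (GT I p)) : Prop where
  iso : IsSectionIso I F₁ F₂ φ
  framing : φ '' framingCx I V₁ = framingCx I V₂
  graph : cSections I (eigenbundle I Ψ) =
    {z | ∃ e ∈ cSections I (complexify I F₁), z = e + φ e}

/-- `(V₁, V₂, Ψ)` is an admissible triple, where `V₁`, `V₂` are framings of the mutually orthogonal
split structures `F₁`, `F₂` and `Ψ ∈ SGF(F₁ ⊕ F₂)`. -/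
def IsAdmissible (F₁ F₂ : ∀ p : M, Submodule ℝ (GT I p))
    (V₁ V₂ : Submodule ℝ (∀ p : M, GT I p)) (Ψ : ∀ p : M, GT I p →ₗ[ℝ] GT I p) : Prop :=
  IsSGF I (fun p => F₁ p ⊔ F₂ p) Ψ ∧ ∃ φ, IsAdmissibleIso I F₁ F₂ V₁ V₂ Ψ φ

end Smooth

/-! ### Products of two manifolds -/

section Product

variable {E₁ : Type*} [NormedAddCommGroup E₁] [NormedSpace ℝ E₁]
  {H₁ : Type*} [TopologicalSpace H₁] (I₁ : ModelWithCorners ℝ E₁ H₁)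
  {M₁ : Type*} [TopologicalSpace M₁] [ChartedSpace H₁ M₁]
  {E₂ : Type*} [NormedAddCommGroup E₂] [NormedSpace ℝ E₂]
  {H₂ : Type*} [TopologicalSpace H₂] (I₂ : ModelWithCorners ℝ E₂ H₂)
  {M₂ : Type*} [TopologicalSpace M₂] [ChartedSpace H₂ M₂]

/-- The inclusion `𝕋_{q₁} M₁ → 𝕋_q (M₁ × M₂)`: `X + α` goes to the horizontal lift of `X` plus the
pull-back of `α` along the first projection. -/
def inFst (q : M₁ × M₂) : GT I₁ q.1 →ₗ[ℝ] GT (I₁.prod I₂) q where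
  toFun x := (mfderiv I₁ (I₁.prod I₂) (fun p : M₁ => (p, q.2)) q.1 x.1,
    x.2.comp (mfderiv (I₁.prod I₂) I₁ (Prod.fst : M₁ × M₂ → M₁) q))
  map_add' x y := by
    refine Prod.ext ?_ ?_
    · exact map_add _ _ _
    · rfl
  map_smul' c x := by
    refine Prod.ext ?_ ?_
    · exact map_smul _ _ _
    · rfl

/-- The inclusion `𝕋_{q₂} M₂ → 𝕋_q (M₁ × M₂)`. -/
def inSnd (q : M₁ × M₂) : GT I₂ q.2 →ₗ[ℝ] GT (I₁.prod I₂) q where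
  toFun x := (mfderiv I₂ (I₁.prod I₂) (fun p : M₂ => (q.1, p)) q.2 x.1,
    x.2.comp (mfderiv (I₁.prod I₂) I₂ (Prod.snd : M₁ × M₂ → M₂) q))
  map_add' x y := by
    refine Prod.ext ?_ ?_
    · exact map_add _ _ _
    · rfl
  map_smul' c x := by
    refine Prod.ext ?_ ?_
    · exact map_smul _ _ _
    · rfl

/-- The projection `𝕋_q (M₁ × M₂) → 𝕋_{q₁} M₁`: push a vector forward along the first projection,
and restrict a covector to the first factor. -/
def outFst (q : M₁ × M₂) : GT (I₁.prod I₂) q →ₗ[ℝ] GT I₁ q.1 where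
  toFun x := (mfderiv (I₁.prod I₂) I₁ (Prod.fst : M₁ × M₂ → M₁) q x.1,
    x.2.comp (mfderiv I₁ (I₁.prod I₂) (fun p : M₁ => (p, q.2)) q.1))
  map_add' x y := by
    refine Prod.ext ?_ ?_
    · exact map_add _ _ _
    · rfl
  map_smul' c x := by
    refine Prod.ext ?_ ?_
    · exact map_smul _ _ _
    · rfl

/-- The projection `𝕋_q (M₁ × M₂) → 𝕋_{q₂} M₂`. -/
def outSnd (q : M₁ × M₂) : GT (I₁.prod I₂) q →ₗ[ℝ] GT I₂ q.2 where
  toFun x := (mfderiv (I₁.prod I₂) I₂ (Prod.snd : M₁ × M₂ → M₂) q x.1,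
    x.2.comp (mfderiv I₂ (I₁.prod I₂) (fun p : M₂ => (q.1, p)) q.2))
  map_add' x y := by
    refine Prod.ext ?_ ?_
    · exact map_add _ _ _
    · rfl
  map_smul' c x := by
    refine Prod.ext ?_ ?_
    · exact map_smul _ _ _
    · rfl

/-- The pull-back `π₁^* F` of a subbundle. -/
def pullFst (F : ∀ p : M₁, Submodule ℝ (GT I₁ p)) :
    ∀ q : M₁ × M₂, Submodule ℝ (GT (I₁.prod I₂) q) :=
  fun q => (F q.1).map (inFst I₁ I₂ q)

/-- The pull-back `π₂^* F` of a subbundle. -/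
def pullSnd (F : ∀ p : M₂, Submodule ℝ (GT I₂ p)) :
    ∀ q : M₁ × M₂, Submodule ℝ (GT (I₁.prod I₂) q) :=
  fun q => (F q.2).map (inSnd I₁ I₂ q)

/-- The pull-back `x ↦ π₁^* x` of sections. -/
def pullSecFst : (∀ p : M₁, GT I₁ p) →ₗ[ℝ] ∀ q : M₁ × M₂, GT (I₁.prod I₂) q where
  toFun x q := inFst I₁ I₂ q (x q.1)
  map_add' x y := by funext q; exact (inFst I₁ I₂ q).map_add _ _
  map_smul' c x := by funext q; exact (inFst I₁ I₂ q).map_smul _ _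

/-- The pull-back `x ↦ π₂^* x` of sections. -/
def pullSecSnd : (∀ p : M₂, GT I₂ p) →ₗ[ℝ] ∀ q : M₁ × M₂, GT (I₁.prod I₂) q where
  toFun x q := inSnd I₁ I₂ q (x q.2)
  map_add' x y := by funext q; exact (inSnd I₁ I₂ q).map_add _ _
  map_smul' c x := by funext q; exact (inSnd I₁ I₂ q).map_smul _ _

/-- `(V₁, V₂, Ψ)` is admissible on the product: `Ψ ∈ SGF(π₁^* F₁ ⊕ π₂^* F₂)` and
`(π₁^* V₁, π₂^* V₂, Ψ)` is an admissible triple on `M₁ × M₂`. -/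
def IsProductAdmissible [IsManifold I₁ ∞ M₁] [IsManifold I₂ ∞ M₂]
    (F₁ : ∀ p : M₁, Submodule ℝ (GT I₁ p)) (F₂ : ∀ p : M₂, Submodule ℝ (GT I₂ p))
    (V₁ : Submodule ℝ (∀ p : M₁, GT I₁ p)) (V₂ : Submodule ℝ (∀ p : M₂, GT I₂ p))
    (Ψ : ∀ q : M₁ × M₂, GT (I₁.prod I₂) q →ₗ[ℝ] GT (I₁.prod I₂) q) : Prop :=
  IsAdmissible (I₁.prod I₂) (pullFst I₁ I₂ F₁) (pullSnd I₁ I₂ F₂)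
    (V₁.map (pullSecFst I₁ I₂)) (V₂.map (pullSecSnd I₁ I₂)) Ψ

/-- The Morimoto product `J₁ ⊞_Ψ J₂ = π₁^* J₁ ⊕ π₂^* J₂ ⊕ Ψ`, each summand being extended by zero
to the orthogonal complement of the bundle on which it lives. -/
def morimotoProduct (Φ₁ : ∀ p : M₁, GT I₁ p →ₗ[ℝ] GT I₁ p) (Φ₂ : ∀ p : M₂, GT I₂ p →ₗ[ℝ] GT I₂ p)
    (Ψ : ∀ q : M₁ × M₂, GT (I₁.prod I₂) q →ₗ[ℝ] GT (I₁.prod I₂) q) :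
    ∀ q : M₁ × M₂, GT (I₁.prod I₂) q →ₗ[ℝ] GT (I₁.prod I₂) q :=
  fun q => inFst I₁ I₂ q ∘ₗ Φ₁ q.1 ∘ₗ outFst I₁ I₂ q + inSnd I₁ I₂ q ∘ₗ Φ₂ q.2 ∘ₗ outSnd I₁ I₂ q
    + Ψ q

end Product

end GenGeom

end

/-! Write `L₁`, `L₂`, `L_Ψ` for the `√-1`-eigenbundles of `J₁`, `J₂`, `Ψ`. The eigenbundle of the
product is `L = π₁^*L₁ ⊕ π₂^*L₂ ⊕ L_Ψ`, and `L_Ψ` is spanned by the graph sections `π₁^*v + π₂^*w`,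
where `v` and `w = φ(v)` are combinations of the framings with constant complex coefficients.

Two facts make brackets in `L` computable. The Dorfman bracket commutes with pull-back from a factor
and vanishes between pull-backs from different factors (`Leg.dorfman_pull`,
`Leg.IsComplement.dorfman_pull`). Moreover `L` is isotropic, so the term `2⟨x, y⟩ df` of the left
Leibniz rule disappears and closure under the bracket may be tested on local generators
(`LocGen.cDorfman_mem`, `IsLinked.locGen`). On generators there remain `π₁^*[l, l']`, which asks for
involutivity of `L₁`; the bracket of a graph section with `π₁^*l`, which is `π₁^*[v, l]` and asks
that `v` normalize `L₁`; the same two on the second factor; and the bracket of two graph sections,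
`π₁^*[v, v'] + π₂^*[w, w']`. The last one is zero: if `e₁` normalizes `L₁`, it preserves the
orthogonal complement of `E₁'`, hence `E₁'`, so `[e₁, e₂]` lies in `E₁'`; invariance of the pairing
makes it orthogonal to `e₁` and `e₂`, hence zero (`IsAdaptedFrame.dorfman_eq_zero`). Conversely, if
`π₁^*z` lies in `L` then `z` lies in `L₁` (`IsLinked.mem_left_of_mem`), so integrability of the
product descends to the factors.

The null basis of `V₁` comes from isotropy of the graph: `⟨v, v'⟩(p₁) + Re⟨φ v, φ v'⟩(p₂) = 0`, and
separation of variables forces both terms to be constant (`IsCorrespondence.pairing_const`).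
Signature `(1, 1)` then gives `e₁`, `e₂`.

Normal pairs and normal triples are both equivalent to three conditions: `L_J` is involutive, and
`e₁` and `e₂` normalize it (`isNormalPair_iff`, `isNormalTriple_iff`). Independence of `Ψ` follows
because normality does not mention `Ψ`. -/

namespace GenGeom

/-! ### Sections of `𝕋M` in the preferred chart. -/

section Coordinates

variable {E : Type*} [NormedAddCommGroup E] [NormedSpace ℝ E]
  {H : Type*} [TopologicalSpace H] (I : ModelWithCorners ℝ E H)
  {M : Type*} [TopologicalSpace M] [ChartedSpace H M] [IsManifold I ∞ M]

/-- The coordinate expression of a vector field in the preferred chart at `p`. -/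
noncomputable def vecInChart (X : ∀ p : M, TangentSpace I p) (p q : M) : E :=
  (trivializationAt E (TangentSpace I : M → Type _) p).continuousLinearMapAt ℝ q (X q)

/-- The coordinate expression of a section of `𝕋M` in the preferred chart at `p`. -/
noncomputable def inChart (x : ∀ p : M, GT I p) (p q : M) : E × (E →L[ℝ] ℝ) :=
  (vecInChart I (fun q => (x q).1) p q, formInChart I (fun q => (x q).2) p q)

/-- Smoothness of a section of `𝕋M` at a point. -/
def IsSmoothAt (x : ∀ p : M, GT I p) (p : M) : Prop :=
  ContMDiffAt I 𝓘(ℝ, E × (E →L[ℝ] ℝ)) ∞ (inChart I x p) p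

/-- The identification of a fibre of `𝕋M` with the model space. -/
def val (p : M) : GT I p ≃ₗ[ℝ] E × (E →L[ℝ] ℝ) where
  toFun x := x
  invFun x := x
  map_add' _ _ := rfl
  map_smul' _ _ := rfl
  left_inv _ := rfl
  right_inv _ := rfl

omit [IsManifold I ∞ M] in
theorem GT_ext {p : M} {x y : GT I p} (h₁ : (val I p x).1 = (val I p y).1)
    (h₂ : ∀ u, (val I p x).2 u = (val I p y).2 u) : x = y :=
  (val I p).injective (Prod.ext h₁ (ContinuousLinearMap.ext h₂))

/-- Smoothness of a section may be read in any trivialization over the point, and the trivialization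
of `T^*M` induced by that of `TM` is exactly `formInChart`. -/
theorem contMDiffAt_inChart_iff {x : ∀ p : M, GT I p} {p q : M}
    (hq : q ∈ (trivializationAt E (TangentSpace I : M → Type _) p).baseSet) :
    ContMDiffAt I 𝓘(ℝ, E × (E →L[ℝ] ℝ)) ∞ (inChart I x p) q ↔
    ContMDiffAt I (I.prod 𝓘(ℝ, E)) ∞
      (fun p => TotalSpace.mk' E (E := (TangentSpace I : M → Type _)) p (x p).1) q ∧
    ContMDiffAt I (I.prod 𝓘(ℝ, E →L[ℝ] ℝ)) ∞
      (fun p => TotalSpace.mk' (E →L[ℝ] ℝ)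
        (E := fun p : M => TangentSpace I p →L[ℝ] Bundle.Trivial M ℝ p) p (x p).2) q := by
  have h1 : ContMDiffAt I (I.prod 𝓘(ℝ, E)) ∞
      (fun p => TotalSpace.mk' E (E := (TangentSpace I : M → Type _)) p (x p).1) q ↔
      ContMDiffAt I 𝓘(ℝ, E) ∞ (vecInChart I (fun q => (x q).1) p) q := by
    rw [(trivializationAt E (TangentSpace I : M → Type _) p).contMDiffAt_section_iff hq]
    refine Filter.EventuallyEq.contMDiffAt_iff ?_
    filter_upwards [(trivializationAt E (TangentSpace I : M → Type _) p).open_baseSet.mem_nhds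
      hq] with q hq
    exact ((trivializationAt E (TangentSpace I : M → Type _) p).continuousLinearMapAt_apply_of_mem
      ℝ hq _).symm
  have h2 : ContMDiffAt I (I.prod 𝓘(ℝ, E →L[ℝ] ℝ)) ∞
      (fun p => TotalSpace.mk' (E →L[ℝ] ℝ)
      (E := fun p : M => TangentSpace I p →L[ℝ] Bundle.Trivial M ℝ p) p (x p).2) q ↔
      ContMDiffAt I 𝓘(ℝ, E →L[ℝ] ℝ) ∞ (formInChart I (fun q => (x q).2) p) q := by
    rw [(trivializationAt (E →L[ℝ] ℝ)
      (fun p : M => TangentSpace I p →L[ℝ] Bundle.Trivial M ℝ p) p).contMDiffAt_section_iff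
      (by rw [hom_trivializationAt_baseSet]; exact ⟨hq, trivial⟩)]
    refine Filter.EventuallyEq.contMDiffAt_iff (Filter.Eventually.of_forall fun q => ?_)
    ext u
    simp [formInChart, hom_trivializationAt_apply, ContinuousLinearMap.inCoordinates]
  rw [h1, h2]
  exact ⟨fun h =>
    ⟨(ContinuousLinearMap.fst ℝ E (E →L[ℝ] ℝ)).contMDiff.contMDiffAt.comp q h,
      (ContinuousLinearMap.snd ℝ E (E →L[ℝ] ℝ)).contMDiff.contMDiffAt.comp q h⟩,
    fun h => h.1.prodMk_space h.2⟩

/-- Allows the chart centred at a nearby point `p` in place of the one centred at `q`; this is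
needed for sections that are only described in one chart. -/
theorem isSmoothAt_iff_of_mem {x : ∀ p : M, GT I p} {p q : M}
    (hq : q ∈ (trivializationAt E (TangentSpace I : M → Type _) p).baseSet) :
    IsSmoothAt I x q ↔ ContMDiffAt I 𝓘(ℝ, E × (E →L[ℝ] ℝ)) ∞ (inChart I x p) q :=
  (contMDiffAt_inChart_iff I
    (mem_baseSet_trivializationAt E (TangentSpace I : M → Type _) q)).trans
    (contMDiffAt_inChart_iff I hq).symm

theorem isSmooth_iff {x : ∀ p : M, GT I p} : IsSmooth I x ↔ ∀ p, IsSmoothAt I x p := by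
  unfold IsSmooth IsSmoothAt ContMDiff
  rw [← forall_and]
  exact forall_congr' fun p => (contMDiffAt_inChart_iff I
    (mem_baseSet_trivializationAt E (TangentSpace I : M → Type _) p)).symm

/-- The preferred chart at `p` has the identity as its derivative at `p`, so coordinate values at
the centre are the intrinsic ones. -/
theorem vecInChart_self (X : ∀ p : M, TangentSpace I p) (p : M) : vecInChart I X p p = X p := by
  unfold vecInChart
  rw [TangentBundle.continuousLinearMapAt_trivializationAt (by simp), mfderiv_extChartAt_self]
  rfl

theorem formInChart_self (α : ∀ p : M, TangentSpace I p →L[ℝ] ℝ) (p : M) :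
    formInChart I α p p = α p := by
  unfold formInChart
  rw [TangentBundle.symmL_trivializationAt (by simp), mfderivWithin_range_extChartAt_symm]
  rfl

theorem inChart_self (x : ∀ p : M, GT I p) (p : M) : inChart I x p p = val I p (x p) :=
  Prod.ext (show vecInChart I (fun q => (x q).1) p p = (x p).1 from vecInChart_self I _ p)
    (show formInChart I (fun q => (x q).2) p p = (x p).2 from formInChart_self I _ p)

theorem eventually_mem_baseSet (p : M) :
    ∀ᶠ q in nhds p, q ∈ (trivializationAt E (TangentSpace I : M → Type _) p).baseSet :=
  (trivializationAt E (TangentSpace I : M → Type _) p).open_baseSet.mem_nhds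
      (mem_baseSet_trivializationAt E (TangentSpace I : M → Type _) p)

/-- The inner product of the model space `E ⊕ E^*`. -/
noncomputable def modelPairing (a b : E × (E →L[ℝ] ℝ)) : ℝ := (1 / 2) * (a.2 b.1 + b.2 a.1)

omit [IsManifold I ∞ M] in
theorem pairing_eq_val {p : M} (x y : GT I p) :
    pairing I p x y = modelPairing (val I p x) (val I p y) := rfl

theorem formInChart_vecInChart (α : ∀ p : M, TangentSpace I p →L[ℝ] ℝ)
    (X : ∀ p : M, TangentSpace I p) {p q : M}
    (hq : q ∈ (trivializationAt E (TangentSpace I : M → Type _) p).baseSet) :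
    formInChart I α p q (vecInChart I X p q) = α q (X q) := by
  unfold formInChart vecInChart
  rw [ContinuousLinearMap.comp_apply, Trivialization.symmL_continuousLinearMapAt _ hq]

/-- The derivative at `p` of the coordinate expression of a section of `𝕋M`. -/
noncomputable def jet (x : ∀ p : M, GT I p) (p : M) : E →L[ℝ] E × (E →L[ℝ] ℝ) :=
  fderiv ℝ (inChart I x p ∘ (extChartAt I p).symm) (extChartAt I p p)

/-- The derivative at `p` of a function, in the preferred chart. -/
noncomputable def dfun (f : M → ℝ) (p : M) : E →L[ℝ] ℝ :=
  fderiv ℝ (f ∘ (extChartAt I p).symm) (extChartAt I p p)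

theorem inChart_add (x y : ∀ p : M, GT I p) (p q : M) :
    inChart I (x + y) p q = inChart I x p q + inChart I y p q := by
  refine Prod.ext ?_ ?_
  · exact map_add _ _ _
  · exact ContinuousLinearMap.add_comp _ _ _

theorem inChart_smul (f : M → ℝ) (x : ∀ p : M, GT I p) (p q : M) :
    inChart I (fun q => f q • x q) p q = f q • inChart I x p q := by
  refine Prod.ext ?_ ?_
  · exact map_smul _ _ _
  · exact ContinuousLinearMap.smul_comp _ _ _

variable {I}

/-! ### The Dorfman bracket through first jets. -/

section Boundaryless

variable [I.Boundaryless]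

omit [IsManifold I ∞ M] in
theorem ContMDiffAt.differentiableAt_extChartAt {F : Type*} [NormedAddCommGroup F]
    [NormedSpace ℝ F] {f : M → F} {p : M} (hf : ContMDiffAt I 𝓘(ℝ, F) ∞ f p) :
    DifferentiableAt ℝ (f ∘ (extChartAt I p).symm) (extChartAt I p p) := by
  have h := (contMDiffAt_iff.1 hf).2
  rw [I.range_eq_univ, contDiffWithinAt_univ] at h
  exact h.differentiableAt (by simp)

omit [IsManifold I ∞ M] in
theorem mfderiv_eq_fderiv {F : Type*} [NormedAddCommGroup F]
    [NormedSpace ℝ F] {f : M → F} {p : M} (hf : ContMDiffAt I 𝓘(ℝ, F) ∞ f p) :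
    mfderiv I 𝓘(ℝ, F) f p = fderiv ℝ (f ∘ (extChartAt I p).symm) (extChartAt I p p) := by
  rw [MDifferentiableAt.mfderiv (hf.mdifferentiableAt (by simp)), I.range_eq_univ,
    fderivWithin_univ]
  rfl

omit [I.Boundaryless] in
theorem IsSmoothAt.vec {x : ∀ p : M, GT I p} {p : M} (hx : IsSmoothAt I x p) :
    ContMDiffAt I 𝓘(ℝ, E) ∞ (vecInChart I (fun q => (x q).1) p) p :=
  (ContinuousLinearMap.fst ℝ E (E →L[ℝ] ℝ)).contMDiff.contMDiffAt.comp p hx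

omit [I.Boundaryless] in
theorem IsSmoothAt.form {x : ∀ p : M, GT I p} {p : M} (hx : IsSmoothAt I x p) :
    ContMDiffAt I 𝓘(ℝ, E →L[ℝ] ℝ) ∞ (formInChart I (fun q => (x q).2) p) p :=
  (ContinuousLinearMap.snd ℝ E (E →L[ℝ] ℝ)).contMDiff.contMDiffAt.comp p hx

theorem IsSmoothAt.hasFDerivAt {x : ∀ p : M, GT I p} {p : M} (hx : IsSmoothAt I x p) :
    HasFDerivAt (inChart I x p ∘ (extChartAt I p).symm) (jet I x p) (extChartAt I p p) :=
  (ContMDiffAt.differentiableAt_extChartAt hx).hasFDerivAt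

omit [IsManifold I ∞ M] in
theorem hasFDerivAt_dfun {f : M → ℝ} {p : M} (hf : ContMDiffAt I 𝓘(ℝ, ℝ) ∞ f p) :
    HasFDerivAt (f ∘ (extChartAt I p).symm) (dfun I f p) (extChartAt I p p) :=
  (ContMDiffAt.differentiableAt_extChartAt hf).hasFDerivAt

theorem IsSmoothAt.hasFDerivAt_fst {x : ∀ p : M, GT I p} {p : M} (hx : IsSmoothAt I x p) :
    HasFDerivAt (vecInChart I (fun q => (x q).1) p ∘ (extChartAt I p).symm)
      ((ContinuousLinearMap.fst ℝ E (E →L[ℝ] ℝ)).comp (jet I x p)) (extChartAt I p p) :=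
  hx.hasFDerivAt.fst

theorem IsSmoothAt.hasFDerivAt_snd {x : ∀ p : M, GT I p} {p : M} (hx : IsSmoothAt I x p) :
    HasFDerivAt (formInChart I (fun q => (x q).2) p ∘ (extChartAt I p).symm)
      ((ContinuousLinearMap.snd ℝ E (E →L[ℝ] ℝ)).comp (jet I x p)) (extChartAt I p p) :=
  hx.hasFDerivAt.snd

theorem contrExtDeriv_eq {x : ∀ p : M, GT I p} {p : M} (hx : IsSmoothAt I x p)
    (u v : E) :
    (contrExtDeriv I (fun q => (x q).2) p u : E →L[ℝ] ℝ) v =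
      (jet I x p u).2 v - (jet I x p v).2 u := by
  have h : mfderiv I 𝓘(ℝ, E →L[ℝ] ℝ) (formInChart I (fun q => (x q).2) p) p =
      (ContinuousLinearMap.snd ℝ E (E →L[ℝ] ℝ)).comp (jet I x p) := by
    exact (mfderiv_eq_fderiv hx.form).trans hx.hasFDerivAt_snd.fderiv
  unfold contrExtDeriv
  rw [h]
  rfl

omit [TopologicalSpace H] in
theorem lieBracketWithin_univ_eq {V W V' W' : E → E} {z : E} {A B : E →L[ℝ] E}
    (hV : V =ᶠ[nhds z] V') (hW : W =ᶠ[nhds z] W') (hA : HasFDerivAt V' A z)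
    (hB : HasFDerivAt W' B z) :
    VectorField.lieBracketWithin ℝ V W Set.univ z = B (V' z) - A (W' z) := by
  rw [VectorField.lieBracketWithin_univ, Filter.EventuallyEq.lieBracket_vectorField_eq hV hW,
    VectorField.lieBracket, hA.fderiv, hB.fderiv]

/-- The bracket is defined by pulling the fields back along the inverse chart. Near the centre this
pull-back is the coordinate expression, and at the centre the chart has identity derivative, so the
usual formula `DY(X) - DX(Y)` remains. -/
theorem mlieBracket_eq [CompleteSpace E] {x y : ∀ p : M, GT I p} {p : M} (hx : IsSmoothAt I x p)
    (hy : IsSmoothAt I y p) :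
    (VectorField.mlieBracket I (fun q => (x q).1) (fun q => (y q).1) p : E) =
      (jet I y p (x p).1).1 - (jet I x p (y p).1).1 := by
  have key : ∀ X : ∀ p : M, TangentSpace I p,
      VectorField.mpullbackWithin 𝓘(ℝ, E) I (extChartAt I p).symm X (Set.range I)
      =ᶠ[nhds (extChartAt I p p)] vecInChart I X p ∘ (extChartAt I p).symm := by
    intro X
    filter_upwards [extChartAt_target_mem_nhds (I := I) p] with z hz
    have hz' : (extChartAt I p).symm z ∈ (chartAt H p).source := by
      rw [← extChartAt_source (I := I)]
      exact (extChartAt I p).map_target hz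
    unfold VectorField.mpullbackWithin vecInChart
    simp only [Function.comp]
    rw [TangentBundle.continuousLinearMapAt_trivializationAt hz',
      ContinuousLinearMap.inverse_eq (mfderivWithin_extChartAt_symm_comp_mfderiv_extChartAt hz)
        (mfderiv_extChartAt_comp_mfderivWithin_extChartAt_symm hz)]
    rfl
  have inv : ∀ w : E, ((mfderiv I 𝓘(ℝ, E) (extChartAt I p) p).inverse w : E) = w := by
    intro w
    rw [mfderiv_extChartAt_self]
    exact congrArg (fun f : E →L[ℝ] E => f w) ContinuousLinearMap.inverse_id
  unfold VectorField.mlieBracket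
  rw [VectorField.mlieBracketWithin_apply]
  refine (inv _).trans ?_
  have k1 := key (fun q => (x q).1)
  have k2 := key (fun q => (y q).1)
  rw [I.range_eq_univ] at k1 k2
  rw [Set.preimage_univ, I.range_eq_univ, Set.univ_inter]
  refine (lieBracketWithin_univ_eq k1 k2 hx.hasFDerivAt_fst hy.hasFDerivAt_fst).trans ?_
  simp only [Function.comp, extChartAt_to_inv, vecInChart_self]
  rfl

theorem dorfman_fst [CompleteSpace E] {x y : ∀ p : M, GT I p} {p : M} (hx : IsSmoothAt I x p)
    (hy : IsSmoothAt I y p) :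
    (val I p (dorfman I x y p)).1 =
      (jet I y p (val I p (x p)).1).1 - (jet I x p (val I p (y p)).1).1 :=
  mlieBracket_eq hx hy

theorem hasFDerivAt_form_vec {x y : ∀ p : M, GT I p} {p : M} (hx : IsSmoothAt I x p)
    (hy : IsSmoothAt I y p) :
    ∃ D : E →L[ℝ] ℝ, HasFDerivAt ((fun q => (x q).2 (y q).1) ∘ (extChartAt I p).symm) D
      (extChartAt I p p) ∧ ∀ u, D u = (jet I x p u).2 (val I p (y p)).1 +
        (val I p (x p)).2 (jet I y p u).1 := by
  refine ⟨_, ((hx.hasFDerivAt_snd).clm_apply hy.hasFDerivAt_fst).congr_of_eventuallyEq ?_, ?_⟩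
  · have h1 := (continuousAt_extChartAt_symm (I := I) p).eventually
      (by rw [extChartAt_to_inv]; exact eventually_mem_baseSet I p)
    filter_upwards [h1] with z hz
    exact (formInChart_vecInChart I (fun q => (x q).2) (fun q => (y q).1) hz).symm
  · intro u
    simp only [Function.comp, extChartAt_to_inv, vecInChart_self, formInChart_self]
    exact add_comm _ _

omit [I.Boundaryless] in
theorem contMDiffAt_form_vec {x y : ∀ p : M, GT I p} {p : M} (hx : IsSmoothAt I x p)
    (hy : IsSmoothAt I y p) : ContMDiffAt I 𝓘(ℝ, ℝ) ∞ (fun q => (x q).2 (y q).1) p := by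
  refine (hx.form.clm_apply hy.vec).congr_of_eventuallyEq ?_
  filter_upwards [eventually_mem_baseSet I p] with q hq
  exact (formInChart_vecInChart I (fun q => (x q).2) (fun q => (y q).1) hq).symm

omit [I.Boundaryless] in
theorem contMDiffAt_pairing {x y : ∀ p : M, GT I p} {p : M} (hx : IsSmoothAt I x p)
    (hy : IsSmoothAt I y p) :
    ContMDiffAt I 𝓘(ℝ, ℝ) ∞ (fun q => pairing I q (x q) (y q)) p :=
  contMDiffAt_const.mul ((contMDiffAt_form_vec hx hy).add (contMDiffAt_form_vec hy hx))

theorem dfun_pairing {x y : ∀ p : M, GT I p} {p : M} (hx : IsSmoothAt I x p)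
    (hy : IsSmoothAt I y p) (u : E) :
    dfun I (fun q => pairing I q (x q) (y q)) p u =
      modelPairing (jet I x p u) (val I p (y p)) + modelPairing (val I p (x p)) (jet I y p u) := by
  obtain ⟨D, hD, h⟩ := hasFDerivAt_form_vec hx hy
  obtain ⟨D', hD', h'⟩ := hasFDerivAt_form_vec hy hx
  have := ((hD.add hD').const_mul (1 / 2)).fderiv
  have e : dfun I (fun q => pairing I q (x q) (y q)) p = (1 / 2 : ℝ) • (D + D') := this
  rw [e]
  simp only [smul_apply, add_apply, h, h', modelPairing,
    smul_eq_mul]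
  ring

/-- In `ℒ_X β = ι_X dβ + d(β(X))` the term `(∂_u β)(X)` occurs once with each sign and cancels.
Together with `dorfman_fst` this makes the bracket at `p` a bilinear expression in values and first
derivatives, so the rules below reduce to algebra in jets. -/
theorem dorfman_snd {x y : ∀ p : M, GT I p} {p : M} (hx : IsSmoothAt I x p)
    (hy : IsSmoothAt I y p) (u : E) :
    (val I p (dorfman I x y p)).2 u =
      (jet I y p (val I p (x p)).1).2 u + (val I p (y p)).2 (jet I x p u).1 -
        (jet I x p (val I p (y p)).1).2 u + (jet I x p u).2 (val I p (y p)).1 := by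
  obtain ⟨D, hD, h⟩ := hasFDerivAt_form_vec hy hx
  let D' : E →L[ℝ] ℝ := mfderiv I 𝓘(ℝ, ℝ) (fun q => (y q).2 (x q).1) p
  have e1 : D' = D :=
    (mfderiv_eq_fderiv (contMDiffAt_form_vec hy hx)).trans hD.fderiv
  let A : E →L[ℝ] ℝ := contrExtDeriv I (fun q => (y q).2) p (x p).1
  let B : E →L[ℝ] ℝ := contrExtDeriv I (fun q => (x q).2) p (y p).1
  have hA : A u = (jet I y p (val I p (x p)).1).2 u - (jet I y p u).2 (val I p (x p)).1 :=
    contrExtDeriv_eq hy (x p).1 u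
  have hB : B u = (jet I x p (val I p (y p)).1).2 u - (jet I x p u).2 (val I p (y p)).1 :=
    contrExtDeriv_eq hx (y p).1 u
  have e2 : (val I p (dorfman I x y p)).2 u = A u + D' u - B u := rfl
  rw [e2, e1, hA, hB, h]
  ring

omit [I.Boundaryless] in
theorem inChart_eventuallyEq {x y : ∀ p : M, GT I p} {p : M} (h : ∀ᶠ q in nhds p, x q = y q) :
    inChart I x p =ᶠ[nhds p] inChart I y p := by
  filter_upwards [h] with q hq
  simp [inChart, vecInChart, formInChart, hq]

omit [I.Boundaryless] in
theorem IsSmoothAt.congr {x y : ∀ p : M, GT I p} {p : M} (hx : IsSmoothAt I x p)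
    (h : ∀ᶠ q in nhds p, y q = x q) : IsSmoothAt I y p :=
  ContMDiffAt.congr_of_eventuallyEq hx (inChart_eventuallyEq h)

omit [I.Boundaryless] in
theorem IsSmoothAt.add {x y : ∀ p : M, GT I p} {p : M} (hx : IsSmoothAt I x p)
    (hy : IsSmoothAt I y p) : IsSmoothAt I (x + y) p :=
  (ContMDiffAt.add hx hy).congr_of_eventuallyEq
    (Filter.Eventually.of_forall fun q => inChart_add I x y p q)

omit [I.Boundaryless] in
theorem IsSmoothAt.smul {f : M → ℝ} {x : ∀ p : M, GT I p} {p : M}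
    (hf : ContMDiffAt I 𝓘(ℝ, ℝ) ∞ f p) (hx : IsSmoothAt I x p) :
    IsSmoothAt I (fun q => f q • x q) p :=
  (ContMDiffAt.smul hf hx).congr_of_eventuallyEq
    (Filter.Eventually.of_forall fun q => inChart_smul I f x p q)

omit [I.Boundaryless] in
theorem jet_congr {x y : ∀ p : M, GT I p} {p : M} (h : ∀ᶠ q in nhds p, x q = y q) :
    jet I x p = jet I y p := by
  refine Filter.EventuallyEq.fderiv_eq ?_
  have := (continuousAt_extChartAt_symm (I := I) p).eventually
      (by rw [extChartAt_to_inv]; exact inChart_eventuallyEq h)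
  exact this

theorem jet_add {x y : ∀ p : M, GT I p} {p : M} (hx : IsSmoothAt I x p) (hy : IsSmoothAt I y p) :
    jet I (x + y) p = jet I x p + jet I y p := by
  have e : inChart I (x + y) p ∘ (extChartAt I p).symm =
      inChart I x p ∘ (extChartAt I p).symm + inChart I y p ∘ (extChartAt I p).symm :=
    funext fun z => inChart_add I x y p _
  rw [jet, e]
  exact (hx.hasFDerivAt.add hy.hasFDerivAt).fderiv

theorem jet_smul {f : M → ℝ} {x : ∀ p : M, GT I p} {p : M}
    (hf : ContMDiffAt I 𝓘(ℝ, ℝ) ∞ f p) (hx : IsSmoothAt I x p) (u : E) :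
    jet I (fun q => f q • x q) p u = f p • jet I x p u + dfun I f p u • val I p (x p) := by
  have e : inChart I (fun q => f q • x q) p ∘ (extChartAt I p).symm =
      (f ∘ (extChartAt I p).symm) • (inChart I x p ∘ (extChartAt I p).symm) :=
    funext fun z => inChart_smul I f x p _
  rw [jet, e, ((hasFDerivAt_dfun hf).smul hx.hasFDerivAt).fderiv]
  simp [inChart_self]

theorem dorfman_congr [CompleteSpace E] {x y x' y' : ∀ p : M, GT I p} {p : M}
    (hx : IsSmoothAt I x p) (hy : IsSmoothAt I y p) (hxx' : ∀ᶠ q in nhds p, x' q = x q)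
    (hyy' : ∀ᶠ q in nhds p, y' q = y q) :
    dorfman I x' y' p = dorfman I x y p := by
  have h1 := hx.congr hxx'
  have h2 := hy.congr hyy'
  refine GT_ext I ?_ fun u => ?_
  · rw [dorfman_fst h1 h2, dorfman_fst hx hy, jet_congr hxx', jet_congr hyy', hxx'.self_of_nhds,
      hyy'.self_of_nhds]
  · rw [dorfman_snd h1 h2, dorfman_snd hx hy, jet_congr hxx', jet_congr hyy', hxx'.self_of_nhds,
      hyy'.self_of_nhds]

theorem dorfman_add_left [CompleteSpace E] {x x' y : ∀ p : M, GT I p} {p : M}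
    (hx : IsSmoothAt I x p) (hx' : IsSmoothAt I x' p) (hy : IsSmoothAt I y p) :
    dorfman I (x + x') y p = dorfman I x y p + dorfman I x' y p := by
  refine GT_ext I ?_ fun u => ?_
  · simp only [map_add, Prod.fst_add]
    rw [dorfman_fst (hx.add hx') hy, dorfman_fst hx hy, dorfman_fst hx' hy, jet_add hx hx']
    simp
    abel
  · simp only [map_add, Prod.snd_add, add_apply]
    rw [dorfman_snd (hx.add hx') hy, dorfman_snd hx hy, dorfman_snd hx' hy, jet_add hx hx']
    simp
    ring

theorem dorfman_add_right [CompleteSpace E] {x y y' : ∀ p : M, GT I p} {p : M}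
    (hx : IsSmoothAt I x p) (hy : IsSmoothAt I y p) (hy' : IsSmoothAt I y' p) :
    dorfman I x (y + y') p = dorfman I x y p + dorfman I x y' p := by
  refine GT_ext I ?_ fun u => ?_
  · simp only [map_add, Prod.fst_add]
    rw [dorfman_fst hx (hy.add hy'), dorfman_fst hx hy, dorfman_fst hx hy', jet_add hy hy']
    simp
    abel
  · simp only [map_add, Prod.snd_add, add_apply]
    rw [dorfman_snd hx (hy.add hy'), dorfman_snd hx hy, dorfman_snd hx hy', jet_add hy hy']
    simp
    ring

/-- The differential of a function, as a section of `𝕋M`. -/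
noncomputable def dform (f : M → ℝ) (p : M) : GT I p := (val I p).symm (0, dfun I f p)

/-- The bracket is not skew, and differentiating `f` in the first slot leaves the anomalous term
`2⟨x, y⟩ df`. Its vanishing on isotropic subbundles is what later makes involutivity a condition on
generators. -/
theorem dorfman_smul_left [CompleteSpace E] {f : M → ℝ} {x y : ∀ p : M, GT I p} {p : M}
    (hf : ContMDiffAt I 𝓘(ℝ, ℝ) ∞ f p) (hx : IsSmoothAt I x p) (hy : IsSmoothAt I y p) :
    dorfman I (fun q => f q • x q) y p = f p • dorfman I x y p - dfun I f p (val I p (y p)).1 • x p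
      + (2 * pairing I p (x p) (y p)) • dform f p := by
  refine GT_ext I ?_ fun u => ?_
  · simp only [map_add, map_sub, map_smul, Prod.fst_add, Prod.fst_sub, Prod.smul_fst]
    rw [dorfman_fst (.smul hf hx) hy, dorfman_fst hx hy, jet_smul hf hx]
    simp [dform]
    module
  · simp only [map_add, map_sub, map_smul, Prod.snd_add, Prod.snd_sub, Prod.smul_snd, add_apply,
      sub_apply, smul_apply]
    rw [dorfman_snd (.smul hf hx) hy, dorfman_snd hx hy, jet_smul hf hx, jet_smul hf hx]
    simp [pairing_eq_val, modelPairing, dform]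
    ring

theorem dorfman_smul_right [CompleteSpace E] {f : M → ℝ} {x y : ∀ p : M, GT I p} {p : M}
    (hf : ContMDiffAt I 𝓘(ℝ, ℝ) ∞ f p) (hx : IsSmoothAt I x p) (hy : IsSmoothAt I y p) :
    dorfman I x (fun q => f q • y q) p = f p • dorfman I x y p + dfun I f p (val I p (x p)).1 • y p := by
  refine GT_ext I ?_ fun u => ?_
  · simp only [map_add, map_smul, Prod.fst_add, Prod.smul_fst]
    rw [dorfman_fst hx (.smul hf hy), dorfman_fst hx hy, jet_smul hf hy]
    simp
    module
  · simp only [map_add, map_smul, Prod.snd_add, Prod.smul_snd, add_apply, smul_apply]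
    rw [dorfman_snd hx (.smul hf hy), dorfman_snd hx hy, jet_smul hf hy]
    simp
    ring

/-- The Lie bracket and the `ι d` terms are skew; only the exact terms of the Lie derivatives
survive. Sections with constant pairing therefore anticommute. -/
theorem dorfman_add_dorfman_swap [CompleteSpace E] {x y : ∀ p : M, GT I p} {p : M}
    (hx : IsSmoothAt I x p) (hy : IsSmoothAt I y p) :
    dorfman I x y p + dorfman I y x p =
      (2 : ℝ) • dform (fun q => pairing I q (x q) (y q)) p := by
  refine GT_ext I ?_ fun u => ?_
  · simp only [map_add, map_smul, Prod.fst_add, Prod.smul_fst]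
    rw [dorfman_fst hx hy, dorfman_fst hy hx]
    simp [dform]
  · simp only [map_add, map_smul, Prod.snd_add, Prod.smul_snd, add_apply,
      smul_apply]
    rw [dorfman_snd hx hy, dorfman_snd hy hx, dform, LinearEquiv.apply_symm_apply,
      dfun_pairing hx hy, modelPairing, modelPairing, smul_eq_mul]
    ring

/-- Invariance of the pairing. With constant pairings it moves a bracket from one argument to the
other, which is how brackets with the frame are controlled. -/
theorem dfun_pairing_eq_dorfman [CompleteSpace E] {x y z : ∀ p : M, GT I p} {p : M}
    (hx : IsSmoothAt I x p) (hy : IsSmoothAt I y p) (hz : IsSmoothAt I z p) :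
    dfun I (fun q => pairing I q (y q) (z q)) p (val I p (x p)).1 =
      pairing I p (dorfman I x y p) (z p) + pairing I p (y p) (dorfman I x z p) := by
  rw [dfun_pairing hy hz, pairing_eq_val, pairing_eq_val]
  simp only [modelPairing, dorfman_fst hx hy, dorfman_fst hx hz, dorfman_snd hx hy,
    dorfman_snd hx hz, map_sub]
  ring

end Boundaryless
end Coordinates
end GenGeom

/-! ### Global smooth sections and local frames of `𝕋M`. -/

namespace GenGeom

section Frames

variable {E : Type*} [NormedAddCommGroup E] [NormedSpace ℝ E]
  {H : Type*} [TopologicalSpace H] {I : ModelWithCorners ℝ E H}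
  {M : Type*} [TopologicalSpace M] [ChartedSpace H M] [IsManifold I ∞ M]

theorem IsSmooth.at {x : ∀ p : M, GT I p} (hx : IsSmooth I x) (p : M) : IsSmoothAt I x p :=
  (isSmooth_iff I).1 hx p

theorem IsSmooth.of_locally {x : ∀ p : M, GT I p}
    (h : ∀ p, ∃ y, IsSmooth I y ∧ ∀ᶠ q in nhds p, x q = y q) : IsSmooth I x :=
  (isSmooth_iff I).2 fun p => by
    obtain ⟨y, hy, hxy⟩ := h p
    exact (hy.at p).congr hxy

theorem IsSmooth.add {x y : ∀ p : M, GT I p} (hx : IsSmooth I x) (hy : IsSmooth I y) :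
    IsSmooth I (x + y) :=
  (isSmooth_iff I).2 fun p => (hx.at p).add (hy.at p)

theorem IsSmooth.smul {f : M → ℝ} {x : ∀ p : M, GT I p} (hf : ContMDiff I 𝓘(ℝ, ℝ) ∞ f)
    (hx : IsSmooth I x) : IsSmooth I (fun q => f q • x q) :=
  (isSmooth_iff I).2 fun p => .smul (hf p) (hx.at p)

theorem IsSmooth.const_smul (c : ℝ) {x : ∀ p : M, GT I p} (hx : IsSmooth I x) :
    IsSmooth I (c • x) :=
  IsSmooth.smul (contMDiff_const (c := c)) hx

theorem IsSmooth.neg {x : ∀ p : M, GT I p} (hx : IsSmooth I x) : IsSmooth I (-x) := by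
  have e : -x = (-1 : ℝ) • x := funext fun p => (neg_one_smul ℝ (x p)).symm
  rw [e]
  exact hx.const_smul (-1)

theorem IsSmooth.sub {x y : ∀ p : M, GT I p} (hx : IsSmooth I x) (hy : IsSmooth I y) :
    IsSmooth I (x - y) := by
  simpa [sub_eq_add_neg] using hx.add hy.neg

theorem inChart_zero (p q : M) : inChart I (0 : ∀ p : M, GT I p) p q = 0 :=
  Prod.ext (map_zero _) (ContinuousLinearMap.zero_comp _)

theorem IsSmooth.zero : IsSmooth I (0 : ∀ p : M, GT I p) :=
  (isSmooth_iff I).2 fun p => (contMDiffAt_const (c := (0 : E × (E →L[ℝ] ℝ)))).congr_of_eventuallyEq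
    (Filter.Eventually.of_forall fun q => inChart_zero p q)

theorem IsSmooth.sum {ι : Type*} (s : Finset ι) {x : ι → ∀ p : M, GT I p}
    (hx : ∀ i ∈ s, IsSmooth I (x i)) : IsSmooth I (∑ i ∈ s, x i) :=
  Finset.sum_induction _ _ (fun _ _ => IsSmooth.add) IsSmooth.zero hx

theorem contMDiff_pairing {x y : ∀ p : M, GT I p} (hx : IsSmooth I x) (hy : IsSmooth I y) :
    ContMDiff I 𝓘(ℝ, ℝ) ∞ (fun q => pairing I q (x q) (y q)) := fun p =>
  contMDiffAt_pairing (hx.at p) (hy.at p)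

variable [I.Boundaryless] [FiniteDimensional ℝ E] [T2Space M]

omit [I.Boundaryless] [FiniteDimensional ℝ E] [T2Space M] in
theorem mem_baseSet_iff {p q : M} :
    q ∈ (trivializationAt E (TangentSpace I : M → Type _) p).baseSet ↔ q ∈ (chartAt H p).source := by
  rw [TangentBundle.trivializationAt_baseSet]

omit [I.Boundaryless] in
theorem isSmooth_bump_smul {p : M} (χ : SmoothBumpFunction I p) {x : ∀ p : M, GT I p} 
    (hx : ContMDiffOn I 𝓘(ℝ, E × (E →L[ℝ] ℝ)) ∞ (inChart I x p) (chartAt H p).source) :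
    IsSmooth I (fun q => χ q • x q) := by
  rw [isSmooth_iff]
  intro q
  by_cases hq : q ∈ tsupport χ
  · have hq' := χ.tsupport_subset_chartAt_source hq
    refine .smul χ.contMDiffAt ((isSmoothAt_iff_of_mem I (mem_baseSet_iff.2 hq')).2 ?_)
    exact (hx q hq').contMDiffAt ((chartAt H p).open_source.mem_nhds hq')
  · refine (IsSmooth.zero.at q).congr ?_
    filter_upwards [(isClosed_tsupport χ).isOpen_compl.mem_nhds hq] with r hr
    rw [image_eq_zero_of_notMem_tsupport hr, zero_smul]
    rfl

omit [I.Boundaryless] in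
/-- Near every point, `𝕋M` has a frame consisting of global smooth sections, together with the
dual frame. -/
theorem exists_frame (p : M) : ∃ (ι : Type) (_ : Fintype ι) (s t : ι → ∀ q : M, GT I q),
    (∀ i, IsSmooth I (s i)) ∧ (∀ i, IsSmooth I (t i)) ∧
    ∀ᶠ q in nhds p, ∀ x : GT I q, x = ∑ i, (2 * pairing I q x (t i q)) • s i q := by
  classical
  let b := Module.finBasis ℝ E
  let e := trivializationAt E (TangentSpace I : M → Type _) p
  let χ : SmoothBumpFunction I p := Classical.arbitrary _
  let X : Fin (Module.finrank ℝ E) → ∀ q : M, GT I q := fun i q => (e.symmL ℝ q (b i), 0)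
  let A : Fin (Module.finrank ℝ E) → ∀ q : M, GT I q := fun i q =>
    (0, (LinearMap.toContinuousLinearMap (b.coord i)).comp (e.continuousLinearMapAt ℝ q))
  have hX : ∀ i, IsSmooth I (fun q => χ q • X i q) := fun i => by
    refine isSmooth_bump_smul χ ?_
    refine (contMDiffOn_const (c := ((b i, 0) : E × (E →L[ℝ] ℝ)))).congr fun q hq => ?_
    refine Prod.ext ?_ ?_
    · exact e.continuousLinearMapAt_symmL (mem_baseSet_iff.2 hq) _
    · exact ContinuousLinearMap.zero_comp _
  have hA : ∀ i, IsSmooth I (fun q => χ q • A i q) := fun i => by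
    refine isSmooth_bump_smul χ ?_
    refine (contMDiffOn_const
      (c := ((0, LinearMap.toContinuousLinearMap (b.coord i)) : E × (E →L[ℝ] ℝ)))).congr
      fun q hq => ?_
    refine Prod.ext ?_ ?_
    · exact map_zero _
    · ext u
      exact congrArg (b.coord i) (e.continuousLinearMapAt_symmL (mem_baseSet_iff.2 hq) u)
  -- Coordinate fields and coordinate forms, cut off by `χ`. They are dual to each other under `2⟨ ,
  -- ⟩`, so the dual frame exchanges the two halves; the expansion holds where `χ = 1`.
  refine ⟨Fin (Module.finrank ℝ E) ⊕ Fin (Module.finrank ℝ E), inferInstance,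
    Sum.elim (fun i q => χ q • X i q) (fun i q => χ q • A i q),
    Sum.elim (fun i q => χ q • A i q) (fun i q => χ q • X i q), ?_, ?_, ?_⟩
  · rintro (i | i)
    exacts [hX i, hA i]
  · rintro (i | i)
    exacts [hA i, hX i]
  · filter_upwards [χ.eventuallyEq_one, eventually_mem_baseSet I p] with q hq hq' x
    have hq1 : χ q = 1 := hq
    simp only [Fintype.sum_sum_type, Sum.elim_inl, Sum.elim_inr, hq1, one_smul]
    have e1 : ∀ i, 2 * pairing I q x (A i q) = b.coord i (e.continuousLinearMapAt ℝ q x.1) := by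
      intro i
      simp [pairing, A]
    have e2 : ∀ i, 2 * pairing I q x (X i q) = x.2 (e.symmL ℝ q (b i)) := by
      intro i
      simp [pairing, X]
    simp only [e1, e2]
    refine Prod.ext ?_ ?_
    · have h1 : x.1 = e.symmL ℝ q (e.continuousLinearMapAt ℝ q x.1) :=
        (e.symmL_continuousLinearMapAt hq' _).symm
      have h2 : (∑ i, b.coord i (e.continuousLinearMapAt ℝ q x.1) • X i q +
          ∑ i, x.2 (e.symmL ℝ q (b i)) • A i q).1 =
          ∑ i, b.coord i (e.continuousLinearMapAt ℝ q x.1) • e.symmL ℝ q (b i) := by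
        simp [Prod.fst_sum, X, A]
      rw [h2]
      conv_lhs => rw [h1, ← b.sum_repr (e.continuousLinearMapAt ℝ q x.1), map_sum]
      exact Finset.sum_congr rfl fun i _ => map_smul _ _ _
    · ext u
      have h1 : u = e.symmL ℝ q (e.continuousLinearMapAt ℝ q u) :=
        (e.symmL_continuousLinearMapAt hq' _).symm
      have h2 : (∑ i, b.coord i (e.continuousLinearMapAt ℝ q x.1) • X i q +
          ∑ i, x.2 (e.symmL ℝ q (b i)) • A i q).2 u =
          ∑ i, x.2 (e.symmL ℝ q (b i)) * b.coord i (e.continuousLinearMapAt ℝ q u) := by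
        simp [Prod.snd_sum, X, A]
      rw [h2]
      conv_lhs => rw [h1, ← b.sum_repr (e.continuousLinearMapAt ℝ q u), map_sum, map_sum]
      refine Finset.sum_congr rfl fun i _ => ?_
      rw [map_smul, map_smul, smul_eq_mul, mul_comm]
      rfl

end Frames
end GenGeom

namespace GenGeom

section Complex

variable {E : Type*} [NormedAddCommGroup E] [NormedSpace ℝ E]
  {H : Type*} [TopologicalSpace H] {I : ModelWithCorners ℝ E H}
  {M : Type*} [TopologicalSpace M] [ChartedSpace H M] [IsManifold I ∞ M]

/-! ### The bracket of real sections at the level of global smooth sections -/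

section Real

variable [I.Boundaryless] [CompleteSpace E] {x x' y y' z : ∀ p : M, GT I p}

theorem dorfman_const_smul_left (c : ℝ) (hx : IsSmooth I x) (hy : IsSmooth I y) (p : M) :
    dorfman I (c • x) y p = c • dorfman I x y p := by
  have h := dorfman_smul_left (contMDiffAt_const (c := c) (x := p)) (hx.at p) (hy.at p)
  have e : dfun I (fun _ : M => c) p = 0 := by
    unfold dfun
    exact fderiv_const_apply c
  have e' : dform (I := I) (fun _ : M => c) p = 0 := by
    rw [dform, e]
    exact map_zero _
  rw [e, e'] at h
  refine h.trans ?_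
  simp

theorem dorfman_const_smul_right (c : ℝ) (hx : IsSmooth I x) (hy : IsSmooth I y) (p : M) :
    dorfman I x (c • y) p = c • dorfman I x y p := by
  have h := dorfman_smul_right (contMDiffAt_const (c := c) (x := p)) (hx.at p) (hy.at p)
  have e : dfun I (fun _ : M => c) p = 0 := by
    unfold dfun
    exact fderiv_const_apply c
  rw [e] at h
  refine h.trans ?_
  simp

theorem dorfman_neg_left (hx : IsSmooth I x) (hy : IsSmooth I y) (p : M) :
    dorfman I (-x) y p = -dorfman I x y p := by
  have e : -x = (-1 : ℝ) • x := funext fun p => (neg_one_smul ℝ (x p)).symm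
  rw [e, dorfman_const_smul_left _ hx hy]
  exact neg_one_smul ℝ (dorfman I x y p)

theorem dorfman_neg_right (hx : IsSmooth I x) (hy : IsSmooth I y) (p : M) :
    dorfman I x (-y) p = -dorfman I x y p := by
  have e : -y = (-1 : ℝ) • y := funext fun p => (neg_one_smul ℝ (y p)).symm
  rw [e, dorfman_const_smul_right _ hx hy]
  exact neg_one_smul ℝ (dorfman I x y p)

theorem dorfman_zero_left (hy : IsSmooth I y) (p : M) : dorfman I 0 y p = 0 := by
  have h := dorfman_const_smul_left 0 IsSmooth.zero hy p
  have e : (0 : ℝ) • (0 : ∀ p : M, GT I p) = 0 := funext fun p => zero_smul ℝ (0 : GT I p)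
  rw [e] at h
  exact h.trans (zero_smul ℝ _)

theorem dorfman_swap_of_const (hx : IsSmooth I x) (hy : IsSmooth I y) {c : ℝ}
    (h : ∀ p, pairing I p (x p) (y p) = c) (p : M) :
    dorfman I x y p = -dorfman I y x p := by
  have h' := dorfman_add_dorfman_swap (hx.at p) (hy.at p)
  have e : dfun I (fun q => pairing I q (x q) (y q)) p = 0 := by
    simp only [h]
    unfold dfun
    exact fderiv_const_apply c
  rw [dform, e] at h'
  rw [eq_neg_iff_add_eq_zero, h']
  exact (congrArg _ (map_zero _)).trans (smul_zero _)

theorem pairing_dorfman_of_const (hx : IsSmooth I x) (hy : IsSmooth I y) (hz : IsSmooth I z)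
    {c : ℝ} (h : ∀ p, pairing I p (y p) (z p) = c) (p : M) :
    pairing I p (dorfman I x y p) (z p) + pairing I p (y p) (dorfman I x z p) = 0 := by
  rw [← dfun_pairing_eq_dorfman (hx.at p) (hy.at p) (hz.at p)]
  simp only [h]
  have e : dfun I (fun _ : M => c) p = 0 := by
    unfold dfun
    exact fderiv_const_apply c
  rw [e]
  rfl

end Real

/-! ### The complexified pairing and bracket -/

/-- The complex bilinear extension of the pairing. -/
noncomputable def cPairing (p : M) (z w : Cx (GT I p)) : ℂ :=
  ⟨pairing I p z.re w.re - pairing I p z.im w.im, pairing I p z.re w.im + pairing I p z.im w.re⟩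

/-- Smoothness of sections of `𝕋M ⊗ ℂ`. -/
def IsCSmooth (z : ∀ p : M, Cx (GT I p)) : Prop :=
  IsSmooth I (fun p => (z p).re) ∧ IsSmooth I (fun p => (z p).im)

omit [IsManifold I ∞ M] in
@[simp] theorem pairing_add_left (p : M) (x y z : GT I p) :
    pairing I p (x + y) z = pairing I p x z + pairing I p y z := by
  simp [pairing]; ring

omit [IsManifold I ∞ M] in
@[simp] theorem pairing_add_right (p : M) (x y z : GT I p) :
    pairing I p x (y + z) = pairing I p x y + pairing I p x z := by
  simp [pairing]; ring

omit [IsManifold I ∞ M] in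
@[simp] theorem pairing_smul_left (p : M) (c : ℝ) (x y : GT I p) :
    pairing I p (c • x) y = c * pairing I p x y := by
  simp [pairing]; ring

omit [IsManifold I ∞ M] in
@[simp] theorem pairing_smul_right (p : M) (c : ℝ) (x y : GT I p) :
    pairing I p x (c • y) = c * pairing I p x y := by
  simp [pairing]; ring

omit [IsManifold I ∞ M] in
@[simp] theorem pairing_neg_left (p : M) (x y : GT I p) :
    pairing I p (-x) y = -pairing I p x y := by
  simp [pairing]; ring

omit [IsManifold I ∞ M] in
@[simp] theorem pairing_neg_right (p : M) (x y : GT I p) :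
    pairing I p x (-y) = -pairing I p x y := by
  simp [pairing]; ring

omit [IsManifold I ∞ M] in
@[simp] theorem pairing_sub_left (p : M) (x y z : GT I p) :
    pairing I p (x - y) z = pairing I p x z - pairing I p y z := by
  simp [sub_eq_add_neg]

omit [IsManifold I ∞ M] in
@[simp] theorem pairing_sub_right (p : M) (x y z : GT I p) :
    pairing I p x (y - z) = pairing I p x y - pairing I p x z := by
  simp [sub_eq_add_neg]

omit [IsManifold I ∞ M] in
@[simp] theorem pairing_zero_left (p : M) (x : GT I p) : pairing I p 0 x = 0 := by
  simp [pairing]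

omit [IsManifold I ∞ M] in
@[simp] theorem pairing_zero_right (p : M) (x : GT I p) : pairing I p x 0 = 0 := by
  simp [pairing]

omit [IsManifold I ∞ M] in
theorem pairing_comm (p : M) (x y : GT I p) : pairing I p x y = pairing I p y x := by
  simp [pairing, add_comm]

omit [IsManifold I ∞ M] in
theorem cPairing_comm (p : M) (z w : Cx (GT I p)) : cPairing p z w = cPairing p w z := by
  apply Complex.ext
  · simp [cPairing, pairing_comm p z.re, pairing_comm p z.im]
  · simp [cPairing, pairing_comm p z.re, pairing_comm p z.im, add_comm]

omit [IsManifold I ∞ M] in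
-- Covectors `(0, f)` detect the vector part, since the continuous dual separates points, and
-- vectors `(u, 0)` detect the form part.
theorem eq_zero_of_pairing_eq_zero {p : M} {x : GT I p} (h : ∀ y, pairing I p x y = 0) :
    x = 0 := by
  have h1 : ∀ b : E × (E →L[ℝ] ℝ), modelPairing (val I p x) b = 0 := fun b => by
    have := h ((val I p).symm b)
    rwa [pairing_eq_val, LinearEquiv.apply_symm_apply] at this
  refine GT_ext I ?_ fun u => ?_
  · rw [map_zero]
    by_contra hne
    obtain ⟨f, hf⟩ := SeparatingDual.exists_ne_zero (R := ℝ) hne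
    have := h1 (0, f)
    simp [modelPairing] at this
    exact hf this
  · have := h1 (u, 0)
    simpa [modelPairing] using this

variable {z z' w w' : ∀ p : M, Cx (GT I p)}

theorem IsCSmooth.add (hz : IsCSmooth z) (hw : IsCSmooth w) : IsCSmooth (z + w) :=
  ⟨hz.1.add hw.1, hz.2.add hw.2⟩

theorem IsCSmooth.zero : IsCSmooth (0 : ∀ p : M, Cx (GT I p)) := ⟨IsSmooth.zero, IsSmooth.zero⟩

theorem IsCSmooth.rsmul {f : M → ℝ} (hf : ContMDiff I 𝓘(ℝ, ℝ) ∞ f) (hz : IsCSmooth z) :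
    IsCSmooth (fun p => (f p : ℂ) • z p) := by
  constructor
  · simpa using hz.1.smul hf
  · simpa using hz.2.smul hf

theorem IsCSmooth.I_smul (hz : IsCSmooth z) : IsCSmooth (fun p => Complex.I • z p) := by
  constructor
  · have e : (fun q => (Complex.I • z q).re) = -fun q => (z q).im := by
      funext q; simp
    rw [e]
    exact hz.2.neg
  · simpa using hz.1

section Bracket

variable [I.Boundaryless] [CompleteSpace E]

theorem cDorfman_add_left (hz : IsCSmooth z) (hz' : IsCSmooth z') (hw : IsCSmooth w) (p : M) :
    cDorfman I (z + z') w p = cDorfman I z w p + cDorfman I z' w p := by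
  have h1 := dorfman_add_left (hz.1.at p) (hz'.1.at p) (hw.1.at p)
  have h2 := dorfman_add_left (hz.2.at p) (hz'.2.at p) (hw.2.at p)
  have h3 := dorfman_add_left (hz.1.at p) (hz'.1.at p) (hw.2.at p)
  have h4 := dorfman_add_left (hz.2.at p) (hz'.2.at p) (hw.1.at p)
  apply Cx.ext
  · refine (congrArg₂ (· - ·) h1 h2).trans ?_
    simp [cDorfman]; abel
  · refine (congrArg₂ (· + ·) h3 h4).trans ?_
    simp [cDorfman]; abel

theorem cDorfman_add_right (hz : IsCSmooth z) (hw : IsCSmooth w) (hw' : IsCSmooth w') (p : M) :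
    cDorfman I z (w + w') p = cDorfman I z w p + cDorfman I z w' p := by
  have h1 := dorfman_add_right (hz.1.at p) (hw.1.at p) (hw'.1.at p)
  have h2 := dorfman_add_right (hz.2.at p) (hw.2.at p) (hw'.2.at p)
  have h3 := dorfman_add_right (hz.1.at p) (hw.2.at p) (hw'.2.at p)
  have h4 := dorfman_add_right (hz.2.at p) (hw.1.at p) (hw'.1.at p)
  apply Cx.ext
  · refine (congrArg₂ (· - ·) h1 h2).trans ?_
    simp [cDorfman]; abel
  · refine (congrArg₂ (· + ·) h3 h4).trans ?_
    simp [cDorfman]; abel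

theorem cDorfman_I_smul_left (hz : IsCSmooth z) (hw : IsCSmooth w) (p : M) :
    cDorfman I (fun p => Complex.I • z p) w p = Complex.I • cDorfman I z w p := by
  have h1 := dorfman_neg_left hz.2 hw.1 p
  have h2 := dorfman_neg_left hz.2 hw.2 p
  have e1 : (fun q => (Complex.I • z q).re) = -fun q => (z q).im := by
    funext q; simp
  have e2 : (fun q => (Complex.I • z q).im) = fun q => (z q).re := by
    funext q; simp
  apply Cx.ext
  · simp only [cDorfman, e1, e2, h1]
    simp only [Cx.re_mk, Cx.re_smul, Cx.im_mk, Complex.I_re, Complex.I_im]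
    module
  · simp only [cDorfman, e1, e2, h2]
    simp only [Cx.re_mk, Cx.im_smul, Cx.im_mk, Complex.I_re, Complex.I_im]
    module

theorem cDorfman_I_smul_right (hz : IsCSmooth z) (hw : IsCSmooth w) (p : M) :
    cDorfman I z (fun p => Complex.I • w p) p = Complex.I • cDorfman I z w p := by
  have h1 := dorfman_neg_right hz.1 hw.2 p
  have h2 := dorfman_neg_right hz.2 hw.2 p
  have e1 : (fun q => (Complex.I • w q).re) = -fun q => (w q).im := by
    funext q; simp
  have e2 : (fun q => (Complex.I • w q).im) = fun q => (w q).re := by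
    funext q; simp
  apply Cx.ext
  · simp only [cDorfman, e1, e2, h1]
    simp only [Cx.re_mk, Cx.re_smul, Cx.im_mk, Complex.I_re, Complex.I_im]
    module
  · simp only [cDorfman, e1, e2, h2]
    simp only [Cx.re_mk, Cx.im_smul, Cx.im_mk, Complex.I_re, Complex.I_im]
    module

/-- The real and imaginary parts of `h0` are exactly the relations that cancel the `df` terms, and
they are needed only at the point `p`. The value of `c` is irrelevant, because the result is used
modulo a subspace containing `z p`. -/
theorem cDorfman_rsmul_left {f : M → ℝ} (hf : ContMDiff I 𝓘(ℝ, ℝ) ∞ f) (hz : IsCSmooth z)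
    (hw : IsCSmooth w) (p : M) (h0 : cPairing p (z p) (w p) = 0) :
    ∃ c : ℂ, cDorfman I (fun p => (f p : ℂ) • z p) w p = (f p : ℂ) • cDorfman I z w p
      + c • z p := by
  have h1 := dorfman_smul_left (hf p) (hz.1.at p) (hw.1.at p)
  have h2 := dorfman_smul_left (hf p) (hz.2.at p) (hw.2.at p)
  have h3 := dorfman_smul_left (hf p) (hz.1.at p) (hw.2.at p)
  have h4 := dorfman_smul_left (hf p) (hz.2.at p) (hw.1.at p)
  have e1 : (fun q => ((f q : ℂ) • z q).re) = fun q => f q • (z q).re := by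
    funext q; simp
  have e2 : (fun q => ((f q : ℂ) • z q).im) = fun q => f q • (z q).im := by
    funext q; simp
  have p1 : pairing I p (z p).re (w p).re = pairing I p (z p).im (w p).im :=
    sub_eq_zero.1 (congrArg Complex.re h0)
  have p2 : pairing I p (z p).re (w p).im = -pairing I p (z p).im (w p).re :=
    eq_neg_of_add_eq_zero_left (congrArg Complex.im h0)
  refine ⟨-⟨dfun I f p (val I p (w p).re).1, dfun I f p (val I p (w p).im).1⟩, ?_⟩
  apply Cx.ext
  · simp only [cDorfman, e1, e2, h1, h2]
    simp only [Cx.re_mk, Cx.re_smul, Cx.re_add, Cx.im_mk, p1,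
      Complex.ofReal_re, Complex.ofReal_im, Complex.neg_re, Complex.neg_im]
    module
  · simp only [cDorfman, e1, e2, h3, h4]
    simp only [Cx.re_mk, Cx.im_smul, Cx.im_add, Cx.im_mk, p2,
      Complex.ofReal_re, Complex.ofReal_im, Complex.neg_re, Complex.neg_im]
    module

theorem cDorfman_rsmul_right {f : M → ℝ} (hf : ContMDiff I 𝓘(ℝ, ℝ) ∞ f) (hz : IsCSmooth z)
    (hw : IsCSmooth w) (p : M) :
    ∃ c : ℂ, cDorfman I z (fun p => (f p : ℂ) • w p) p = (f p : ℂ) • cDorfman I z w p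
      + c • w p := by
  have h1 := dorfman_smul_right (hf p) (hz.1.at p) (hw.1.at p)
  have h2 := dorfman_smul_right (hf p) (hz.2.at p) (hw.2.at p)
  have h3 := dorfman_smul_right (hf p) (hz.1.at p) (hw.2.at p)
  have h4 := dorfman_smul_right (hf p) (hz.2.at p) (hw.1.at p)
  have e1 : (fun q => ((f q : ℂ) • w q).re) = fun q => f q • (w q).re := by
    funext q; simp
  have e2 : (fun q => ((f q : ℂ) • w q).im) = fun q => f q • (w q).im := by
    funext q; simp
  refine ⟨⟨dfun I f p (val I p (z p).re).1, dfun I f p (val I p (z p).im).1⟩, ?_⟩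
  apply Cx.ext
  · simp only [cDorfman, e1, e2, h1, h2]
    simp only [Cx.re_mk, Cx.re_smul, Cx.re_add, Cx.im_mk,
      Complex.ofReal_re, Complex.ofReal_im]
    module
  · simp only [cDorfman, e1, e2, h3, h4]
    simp only [Cx.re_mk, Cx.im_smul, Cx.im_add, Cx.im_mk,
      Complex.ofReal_re, Complex.ofReal_im]
    module

theorem cDorfman_congr {p : M} (hz : IsCSmooth z) (hw : IsCSmooth w)
    (hzz' : ∀ᶠ q in nhds p, z' q = z q) (hww' : ∀ᶠ q in nhds p, w' q = w q) :
    cDorfman I z' w' p = cDorfman I z w p := by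
  have a1 := hzz'.mono fun q h => congrArg Cx.re h
  have a2 := hzz'.mono fun q h => congrArg Cx.im h
  have b1 := hww'.mono fun q h => congrArg Cx.re h
  have b2 := hww'.mono fun q h => congrArg Cx.im h
  unfold cDorfman
  rw [dorfman_congr (hz.1.at p) (hw.1.at p) a1 b1, dorfman_congr (hz.1.at p) (hw.2.at p) a1 b2,
    dorfman_congr (hz.2.at p) (hw.1.at p) a2 b1, dorfman_congr (hz.2.at p) (hw.2.at p) a2 b2]

end Bracket

end Complex
end GenGeom

/-! ### Testing involutivity on local generators. -/

namespace GenGeom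

section Generation

variable {E : Type*} [NormedAddCommGroup E] [NormedSpace ℝ E]
  {H : Type*} [TopologicalSpace H] {I : ModelWithCorners ℝ E H}
  {M : Type*} [TopologicalSpace M] [ChartedSpace H M] [IsManifold I ∞ M]

/-- The smooth sections of `𝕋M ⊗ ℂ` that near `p₀` are combinations, with smooth coefficients,
of elements of `G`. -/
inductive LocGen (G : Set (∀ p : M, Cx (GT I p))) (p₀ : M) : (∀ p : M, Cx (GT I p)) → Prop
  | base {z} (hz : z ∈ G) : LocGen G p₀ z
  | zero : LocGen G p₀ 0
  | add {z w} (hz : LocGen G p₀ z) (hw : LocGen G p₀ w) : LocGen G p₀ (z + w)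
  | rsmul {f : M → ℝ} (hf : ContMDiff I 𝓘(ℝ, ℝ) ∞ f) {z} (hz : LocGen G p₀ z) :
      LocGen G p₀ (fun p => (f p : ℂ) • z p)
  | I_smul {z} (hz : LocGen G p₀ z) : LocGen G p₀ (fun p => Complex.I • z p)
  | congr {z w} (hz : LocGen G p₀ z) (hw : IsCSmooth w) (h : ∀ᶠ q in nhds p₀, w q = z q) :
      LocGen G p₀ w

namespace LocGen

variable {G G' : Set (∀ p : M, Cx (GT I p))} {p₀ : M} {z w : ∀ p : M, Cx (GT I p)}

theorem isCSmooth (hG : ∀ z ∈ G, IsCSmooth z) (h : LocGen G p₀ z) : IsCSmooth z := by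
  induction h with
  | base hz => exact hG _ hz
  | zero => exact .zero
  | add _ _ h1 h2 => exact h1.add h2
  | rsmul hf _ h => exact h.rsmul hf
  | I_smul _ h => exact h.I_smul
  | congr _ hw _ _ => exact hw

theorem mono (h : LocGen G p₀ z) (hG : G ⊆ G') : LocGen G' p₀ z := by
  induction h with
  | base hz => exact .base (hG hz)
  | zero => exact .zero
  | add _ _ h1 h2 => exact h1.add h2
  | rsmul hf _ h => exact h.rsmul hf
  | I_smul _ h => exact h.I_smul
  | congr _ hw h' h => exact h.congr hw h'

theorem mem (L : ∀ p : M, Submodule ℂ (Cx (GT I p))) (hG : ∀ z ∈ G, z p₀ ∈ L p₀)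
    (h : LocGen G p₀ z) : z p₀ ∈ L p₀ := by
  induction h with
  | base hz => exact hG _ hz
  | zero => exact (L p₀).zero_mem
  | add _ _ h1 h2 => exact (L p₀).add_mem h1 h2
  | rsmul _ _ h => exact (L p₀).smul_mem _ h
  | I_smul _ h => exact (L p₀).smul_mem _ h
  | congr _ _ h' h => rwa [h'.self_of_nhds]

theorem csmul {c : M → ℂ} (hre : ContMDiff I 𝓘(ℝ, ℝ) ∞ fun p => (c p).re)
    (him : ContMDiff I 𝓘(ℝ, ℝ) ∞ fun p => (c p).im) (h : LocGen G p₀ z) :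
    LocGen G p₀ (fun p => c p • z p) := by
  have e : (fun p => c p • z p) =
      (fun p => ((c p).re : ℂ) • z p) + fun p => ((c p).im : ℂ) • Complex.I • z p := by
    funext p
    change c p • z p = ((c p).re : ℂ) • z p + ((c p).im : ℂ) • Complex.I • z p
    rw [smul_smul]
    exact (congrArg (· • z p) (Complex.re_add_im (c p)).symm).trans (add_smul _ _ (z p))
  rw [e]
  exact (h.rsmul hre).add (h.I_smul.rsmul him)

theorem sum {ι : Type*} (s : Finset ι) {z : ι → ∀ p : M, Cx (GT I p)}
    (h : ∀ i ∈ s, LocGen G p₀ (z i)) : LocGen G p₀ (∑ i ∈ s, z i) :=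
  Finset.sum_induction _ _ (fun _ _ => LocGen.add) .zero h

variable [I.Boundaryless] [CompleteSpace E]

/-- Each Leibniz rule changes the bracket by a multiple of a section with values in `L`. The rule in
the left slot needs isotropy of `L`; the one in the right slot does not. -/
theorem cDorfman_mem {L : ∀ p : M, Submodule ℂ (Cx (GT I p))}
    (hL : ∀ z ∈ L p₀, ∀ w ∈ L p₀, cPairing p₀ z w = 0)
    (hG : ∀ z ∈ G, IsCSmooth z ∧ z p₀ ∈ L p₀)
    (h : ∀ z ∈ G, ∀ w ∈ G, cDorfman I z w p₀ ∈ L p₀)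
    (hz : LocGen G p₀ z) (hw : LocGen G p₀ w) : cDorfman I z w p₀ ∈ L p₀ := by
  have smooth : ∀ {z}, LocGen G p₀ z → IsCSmooth z := fun h => h.isCSmooth fun z hz => (hG z hz).1
  have mem : ∀ {z}, LocGen G p₀ z → z p₀ ∈ L p₀ := fun h => h.mem L fun z hz => (hG z hz).2
  -- The left slot is enlarged first, with the right slot still in `G`; the induction on the right
  -- slot then starts from this.
  have step : ∀ {z}, LocGen G p₀ z → ∀ w ∈ G, cDorfman I z w p₀ ∈ L p₀ := by
    intro z hz w hw
    have ws := (hG w hw).1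
    induction hz with
    | base hz => exact h _ hz _ hw
    | zero =>
      have e : cDorfman I 0 w p₀ = 0 := by
        have h1 := dorfman_zero_left ws.1 p₀
        have h2 := dorfman_zero_left ws.2 p₀
        apply Cx.ext
        · exact (congrArg₂ (· - ·) h1 h2).trans (sub_zero _)
        · exact (congrArg₂ (· + ·) h2 h1).trans (add_zero _)
      rw [e]
      exact (L p₀).zero_mem
    | add h1 h2 ih1 ih2 =>
      rw [cDorfman_add_left (smooth h1) (smooth h2) ws]
      exact (L p₀).add_mem ih1 ih2
    | rsmul hf h1 ih =>
      obtain ⟨c, hc⟩ := cDorfman_rsmul_left hf (smooth h1) ws p₀ (hL _ (mem h1) _ (hG w hw).2)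
      rw [hc]
      exact (L p₀).add_mem ((L p₀).smul_mem _ ih) ((L p₀).smul_mem _ (mem h1))
    | I_smul h1 ih =>
      rw [cDorfman_I_smul_left (smooth h1) ws]
      exact (L p₀).smul_mem _ ih
    | congr h1 _ h' ih =>
      rw [cDorfman_congr (smooth h1) ws h' (Filter.Eventually.of_forall fun _ => rfl)]
      exact ih
  have zs := smooth hz
  induction hw with
  | base hw => exact step hz _ hw
  | zero =>
    have e : cDorfman I z 0 p₀ = 0 := by
      have := cDorfman_add_right zs (IsCSmooth.zero (I := I)) (IsCSmooth.zero (I := I)) p₀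
      rw [add_zero] at this
      simpa using this
    rw [e]
    exact (L p₀).zero_mem
  | add h1 h2 ih1 ih2 =>
    rw [cDorfman_add_right zs (smooth h1) (smooth h2)]
    exact (L p₀).add_mem ih1 ih2
  | rsmul hf h1 ih =>
    obtain ⟨c, hc⟩ := cDorfman_rsmul_right hf zs (smooth h1) p₀
    rw [hc]
    exact (L p₀).add_mem ((L p₀).smul_mem _ ih) ((L p₀).smul_mem _ (mem h1))
  | I_smul h1 ih =>
    rw [cDorfman_I_smul_right zs (smooth h1)]
    exact (L p₀).smul_mem _ ih
  | congr h1 _ h' ih =>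
    rw [cDorfman_congr zs (smooth h1) (Filter.Eventually.of_forall fun _ => rfl) h']
    exact ih

end LocGen

end Generation

/-! ### The eigenbundle as an isotropic complex subspace. -/

section Eigen

variable {E : Type*} [NormedAddCommGroup E] [NormedSpace ℝ E]
  {H : Type*} [TopologicalSpace H] {I : ModelWithCorners ℝ E H}
  {M : Type*} [TopologicalSpace M] [ChartedSpace H M]

theorem mem_eigenbundle {Φ : ∀ p : M, GT I p →ₗ[ℝ] GT I p} {p : M} {z : Cx (GT I p)} :
    z ∈ eigenbundle I Φ p ↔ Φ p z.re = -z.im ∧ Φ p z.im = z.re := by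
  constructor
  · intro h
    have h1 := congrArg Cx.re (show Cx.mk (Φ p z.re) (Φ p z.im) = Complex.I • z from h)
    have h2 := congrArg Cx.im (show Cx.mk (Φ p z.re) (Φ p z.im) = Complex.I • z from h)
    simp at h1 h2
    exact ⟨h1, h2⟩
  · rintro ⟨h1, h2⟩
    change Cx.mk (Φ p z.re) (Φ p z.im) = Complex.I • z
    ext1 <;> simp [h1, h2]

/-- The `√-1`-eigenbundle as a family of complex subspaces. -/
def eigenSubmodule (Φ : ∀ p : M, GT I p →ₗ[ℝ] GT I p) (p : M) : Submodule ℂ (Cx (GT I p)) where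
  carrier := eigenbundle I Φ p
  zero_mem' := by rw [mem_eigenbundle]; simp
  add_mem' {z w} hz hw := by
    rw [mem_eigenbundle] at *
    simp [hz.1, hz.2, hw.1, hw.2, add_comm]
  smul_mem' c z hz := by
    rw [mem_eigenbundle] at *
    constructor
    · simp only [Cx.re_smul, Cx.im_smul, map_sub, map_smul, hz.1, hz.2]
      module
    · simp only [Cx.re_smul, Cx.im_smul, map_add, map_smul, hz.1, hz.2]
      module

/-- `√-1⟨z, w⟩ = ⟨Φz, w⟩ = -⟨z, Φw⟩ = -√-1⟨z, w⟩`, in real and imaginary parts. -/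
theorem cPairing_eq_zero_of_mem_eigenbundle {Φ : ∀ p : M, GT I p →ₗ[ℝ] GT I p} {p : M}
    (hΦ : ∀ x y, pairing I p (Φ p x) y = -pairing I p x (Φ p y)) {z w : Cx (GT I p)}
    (hz : z ∈ eigenbundle I Φ p) (hw : w ∈ eigenbundle I Φ p) : cPairing p z w = 0 := by
  rw [mem_eigenbundle] at hz hw
  have h1 := hΦ z.im w.re
  have h2 := hΦ z.im w.im
  rw [hz.2, hw.1] at h1
  rw [hz.2, hw.2] at h2
  apply Complex.ext
  · simp [cPairing, h1]
  · simp [cPairing, h2]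

end Eigen
end GenGeom

namespace GenGeom

section Contact

variable {E : Type*} [NormedAddCommGroup E] [NormedSpace ℝ E]
  {H : Type*} [TopologicalSpace H] {I : ModelWithCorners ℝ E H}
  {M : Type*} [TopologicalSpace M] [ChartedSpace H M]

/-! ### Linear algebra of split generalized `F`-structures -/

theorem mem_orth {F : ∀ p : M, Submodule ℝ (GT I p)} {p : M} {x : GT I p} :
    x ∈ orth I F p ↔ ∀ y ∈ F p, pairing I p x y = 0 := Iff.rfl

/-- `P` is the orthogonal projection onto the fibre `F p`. -/
structure IsOrthProj (F : ∀ p : M, Submodule ℝ (GT I p)) (p : M) (P : GT I p → GT I p) : Prop where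
  mem : ∀ x, P x ∈ F p
  sub_mem : ∀ x, x - P x ∈ orth I F p

/-- The endomorphism `x ↦ 2⟨a, x⟩ b + 2⟨b, x⟩ a`, the orthogonal projection onto the hyperbolic
plane spanned by `a` and `b`. -/
noncomputable def planeProj {p : M} (a b x : GT I p) : GT I p :=
  (2 * pairing I p a x) • b + (2 * pairing I p b x) • a

theorem planeProj_isOrthProj {F : ∀ p : M, Submodule ℝ (GT I p)} {p : M} {a b : GT I p}
    (hF : F p = Submodule.span ℝ {a, b}) (ha : pairing I p a a = 0) (hb : pairing I p b b = 0)
    (hab : 2 * pairing I p a b = 1) : IsOrthProj F p (planeProj a b) where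
  mem x := by
    rw [hF]
    exact add_mem (Submodule.smul_mem _ _ (Submodule.subset_span (by simp)))
      (Submodule.smul_mem _ _ (Submodule.subset_span (by simp)))
  sub_mem x := by
    rw [mem_orth, hF]
    intro y hy
    obtain ⟨c, d, rfl⟩ := Submodule.mem_span_pair.1 hy
    simp only [planeProj, pairing_sub_left, pairing_add_left, pairing_add_right,
      pairing_smul_left, pairing_smul_right, ha, hb, pairing_comm p x, pairing_comm p b a]
    linear_combination (-d * pairing I p b x - c * pairing I p a x) * hab

/-- The complementary remainder is `P x`, which lies in `F ⊆ F^⊥⊥`; this inclusion needs no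
dimension count. -/
theorem IsOrthProj.orth {F : ∀ p : M, Submodule ℝ (GT I p)} {p : M} {P : GT I p → GT I p}
    (h : IsOrthProj F p P) : IsOrthProj (orth I F) p (fun x => x - P x) where
  mem := h.sub_mem
  sub_mem x := by
    rw [sub_sub_cancel]
    intro y hy
    rw [pairing_comm]
    exact hy _ (h.mem x)

theorem IsOrthProj.pairing_left {F : ∀ p : M, Submodule ℝ (GT I p)} {p : M} {P : GT I p → GT I p}
    (h : IsOrthProj F p P) (x : GT I p) {y : GT I p} (hy : y ∈ F p) :
    pairing I p (P x) y = pairing I p x y := by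
  have := h.sub_mem x y hy
  rw [pairing_sub_left] at this
  linarith

section SGF

variable [IsManifold I ∞ M] {F : ∀ p : M, Submodule ℝ (GT I p)}
  {Φ : ∀ p : M, GT I p →ₗ[ℝ] GT I p} {p : M} {P : GT I p → GT I p}

theorem IsSGF.apply_proj (h : IsSGF I F Φ) (hP : IsOrthProj F p P) (x : GT I p) :
    Φ p (P x) = Φ p x := by
  have := h.zero_on_orth p _ (hP.sub_mem x)
  rw [map_sub, sub_eq_zero] at this
  exact this.symm

theorem IsSGF.apply_mem (h : IsSGF I F Φ) (hP : IsOrthProj F p P) (x : GT I p) :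
    Φ p x ∈ F p := by
  rw [← h.apply_proj hP]
  exact h.mapsTo p _ (hP.mem x)

theorem IsSGF.skew_all (h : IsSGF I F Φ) (hP : IsOrthProj F p P) (x y : GT I p) :
    pairing I p (Φ p x) y = -pairing I p x (Φ p y) := by
  rw [pairing_comm, ← hP.pairing_left y (h.apply_mem hP x), pairing_comm, ← h.apply_proj hP x,
    h.skew p _ (hP.mem x) _ (hP.mem y), h.apply_proj hP y,
    hP.pairing_left x (h.apply_mem hP y)]

/-- Skewness and orthogonality give `⟨Φ²x, y⟩ = -⟨Φx, Φy⟩ = -⟨Px, Py⟩ = -⟨Px, y⟩`; nondegeneracy of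
the pairing on `𝕋M` concludes. -/
theorem IsSGF.apply_apply (h : IsSGF I F Φ) (hP : IsOrthProj F p P) (x : GT I p) :
    Φ p (Φ p x) = -P x := by
  rw [← add_eq_zero_iff_eq_neg]
  refine eq_zero_of_pairing_eq_zero fun y => ?_
  rw [pairing_add_left, h.skew_all hP, ← h.apply_proj hP x, ← h.apply_proj hP y,
    h.orthogonal p _ (hP.mem x) _ (hP.mem y), pairing_comm p (P x) (P y),
    hP.pairing_left y (hP.mem x), pairing_comm p y]
  ring

end SGF

/-! ### Adapted frames -/

variable [IsManifold I ∞ M]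

/-- `Φ` is an endomorphism of `𝕋M` with `Φ² = -1` on the orthogonal complement of the hyperbolic
plane bundle `F'` with isotropic frame `(e₁, e₂)`, and `Φ` vanishes on `F'`. -/
structure IsAdaptedFrame (F' : ∀ p : M, Submodule ℝ (GT I p)) (Φ : ∀ p : M, GT I p →ₗ[ℝ] GT I p)
    (e₁ e₂ : ∀ p : M, GT I p) : Prop where
  smooth : ∀ x : ∀ p : M, GT I p, IsSmooth I x → IsSmooth I (fun p => Φ p (x p))
  smooth₁ : IsSmooth I e₁
  smooth₂ : IsSmooth I e₂
  isotropic₁ : ∀ p, pairing I p (e₁ p) (e₁ p) = 0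
  isotropic₂ : ∀ p, pairing I p (e₂ p) (e₂ p) = 0
  dual : ∀ p, pairing I p (e₁ p) (e₂ p) = 1 / 2
  skew : ∀ p x y, pairing I p (Φ p x) y = -pairing I p x (Φ p y)
  square : ∀ p x, Φ p (Φ p x) = -(x - planeProj (e₁ p) (e₂ p) x)
  kill₁ : ∀ p, Φ p (e₁ p) = 0
  kill₂ : ∀ p, Φ p (e₂ p) = 0
  span : ∀ p, F' p = Submodule.span ℝ {e₁ p, e₂ p}

theorem IsSGF.isAdaptedFrame {F' : ∀ p : M, Submodule ℝ (GT I p)}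
    {Φ : ∀ p : M, GT I p →ₗ[ℝ] GT I p} {e₁ e₂ : ∀ p : M, GT I p} (h : IsSGF I (orth I F') Φ)
    (h₁ : IsSmooth I e₁) (h₂ : IsSmooth I e₂) (hi₁ : ∀ p, pairing I p (e₁ p) (e₁ p) = 0)
    (hi₂ : ∀ p, pairing I p (e₂ p) (e₂ p) = 0) (hd : ∀ p, 2 * pairing I p (e₁ p) (e₂ p) = 1)
    (hF : ∀ p, F' p = Submodule.span ℝ {e₁ p, e₂ p}) : IsAdaptedFrame F' Φ e₁ e₂ := by
  have hP := fun p => (planeProj_isOrthProj (hF p) (hi₁ p) (hi₂ p) (hd p)).orth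
  -- `Φ` vanishes on the orthogonal complement of its own bundle `F'^⊥`, which contains `F'`.
  have kill : ∀ p, ∀ x ∈ F' p, Φ p x = 0 := fun p x hx => h.zero_on_orth p x fun y hy => by
    rw [pairing_comm]
    exact hy x hx
  exact
  { smooth := h.smooth
    smooth₁ := h₁
    smooth₂ := h₂
    isotropic₁ := hi₁
    isotropic₂ := hi₂
    dual := fun p => by linarith [hd p]
    skew := fun p => h.skew_all (hP p)
    square := fun p => h.apply_apply (hP p)
    kill₁ := fun p => kill p _ (by rw [hF]; exact Submodule.subset_span (by simp))
    kill₂ := fun p => kill p _ (by rw [hF]; exact Submodule.subset_span (by simp))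
    span := hF }

theorem contMDiff_const_mul_pairing {x y : ∀ p : M, GT I p} (hx : IsSmooth I x)
    (hy : IsSmooth I y) (c : ℝ) :
    ContMDiff I 𝓘(ℝ, ℝ) ∞ (fun q => c * pairing I q (x q) (y q)) :=
  contMDiff_const.mul (contMDiff_pairing hx hy)

theorem exists_smooth_extension [I.Boundaryless] [FiniteDimensional ℝ E] [T2Space M] (p : M)
    (x : GT I p) : ∃ s : ∀ q : M, GT I q, IsSmooth I s ∧ s p = x := by
  obtain ⟨ι, _, s, t, hs, -, h⟩ := exists_frame (I := I) p
  refine ⟨∑ i, (2 * pairing I p x (t i p)) • s i, .sum _ fun i _ => (hs i).const_smul _, ?_⟩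
  rw [Finset.sum_apply]
  exact (h.self_of_nhds x).symm

theorem dorfman_self_eq_zero [I.Boundaryless] [CompleteSpace E] {x : ∀ p : M, GT I p}
    (hx : IsSmooth I x) (h : ∀ p, pairing I p (x p) (x p) = 0) (p : M) :
    dorfman I x x p = 0 := by
  have c := dorfman_swap_of_const hx hx h p
  refine eq_zero_of_pairing_eq_zero fun y => ?_
  have := congrArg (fun z => pairing I p z y) c
  simp only [pairing_neg_left] at this
  linarith

namespace IsAdaptedFrame

variable {F' : ∀ p : M, Submodule ℝ (GT I p)} {Φ : ∀ p : M, GT I p →ₗ[ℝ] GT I p}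
  {e₁ e₂ : ∀ p : M, GT I p}

/-- Statements proved for `e₁` alone pass to `e₂` by this exchange. -/
theorem symm (h : IsAdaptedFrame F' Φ e₁ e₂) : IsAdaptedFrame F' Φ e₂ e₁ where
  smooth := h.smooth
  smooth₁ := h.smooth₂
  smooth₂ := h.smooth₁
  isotropic₁ := h.isotropic₂
  isotropic₂ := h.isotropic₁
  dual p := by rw [pairing_comm, h.dual]
  skew := h.skew
  square p x := by rw [h.square, planeProj, planeProj, add_comm]
  kill₁ := h.kill₂
  kill₂ := h.kill₁
  span p := by rw [h.span, Set.pair_comm]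

theorem isOrthProj (h : IsAdaptedFrame F' Φ e₁ e₂) (p : M) :
    IsOrthProj F' p (planeProj (e₁ p) (e₂ p)) :=
  planeProj_isOrthProj (h.span p) (h.isotropic₁ p) (h.isotropic₂ p) (by rw [h.dual]; norm_num)

theorem smooth_planeProj (h : IsAdaptedFrame F' Φ e₁ e₂) {s : ∀ p : M, GT I p}
    (hs : IsSmooth I s) : IsSmooth I (fun p => planeProj (e₁ p) (e₂ p) (s p)) :=
  (h.smooth₂.smul (contMDiff_const_mul_pairing h.smooth₁ hs 2)).add
    (h.smooth₁.smul (contMDiff_const_mul_pairing h.smooth₂ hs 2))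

theorem pairing_apply_left (h : IsAdaptedFrame F' Φ e₁ e₂) (p : M) (x : GT I p) :
    pairing I p (Φ p x) (e₁ p) = 0 := by
  rw [h.skew, h.kill₁, pairing_zero_right, neg_zero]

omit [IsManifold I ∞ M] in
theorem planeProj_eq_zero {p : M} {x : GT I p} (h1 : pairing I p (e₁ p) x = 0)
    (h2 : pairing I p (e₂ p) x = 0) : planeProj (e₁ p) (e₂ p) x = 0 := by
  simp [planeProj, h1, h2]

theorem apply_planeProj (h : IsAdaptedFrame F' Φ e₁ e₂) (p : M) (x : GT I p) :
    Φ p (planeProj (e₁ p) (e₂ p) x) = 0 := by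
  simp [planeProj, h.kill₁, h.kill₂]

/-- Elements of the eigenbundle are orthogonal to the frame. -/
theorem pairing_eq_zero_of_mem (h : IsAdaptedFrame F' Φ e₁ e₂) {p : M} {z : Cx (GT I p)}
    (hz : z ∈ eigenbundle I Φ p) :
    pairing I p z.re (e₁ p) = 0 ∧ pairing I p z.im (e₁ p) = 0 := by
  rw [mem_eigenbundle] at hz
  constructor
  · rw [← hz.2, h.pairing_apply_left]
  · rw [← neg_eq_iff_eq_neg.2 hz.1, pairing_neg_left, h.pairing_apply_left, neg_zero]

/-- The section `s - √-1 Φ s` of the eigenbundle, for `s` orthogonal to the frame. -/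
theorem mk_mem_cSections (h : IsAdaptedFrame F' Φ e₁ e₂) {s : ∀ p : M, GT I p}
    (hs : IsSmooth I s) (h1 : ∀ p, pairing I p (e₁ p) (s p) = 0)
    (h2 : ∀ p, pairing I p (e₂ p) (s p) = 0) :
    (fun p => Cx.mk (s p) (-Φ p (s p))) ∈ cSections I (eigenbundle I Φ) := by
  refine ⟨hs, (h.smooth s hs).neg, fun p => ?_⟩
  rw [mem_eigenbundle]
  simp [h.square, planeProj_eq_zero (h1 p) (h2 p)]

theorem pairing_planeProj_left (h : IsAdaptedFrame F' Φ e₁ e₂) (p : M) (x : GT I p) :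
    pairing I p (e₁ p) (x - planeProj (e₁ p) (e₂ p) x) = 0 := by
  simp only [planeProj, pairing_sub_right, pairing_add_right, pairing_smul_right, h.dual,
    h.isotropic₁]
  ring

theorem pairing_planeProj_right (h : IsAdaptedFrame F' Φ e₁ e₂) (p : M) (x : GT I p) :
    pairing I p (e₂ p) (x - planeProj (e₁ p) (e₂ p) x) = 0 := by
  have := h.symm.pairing_planeProj_left p x
  rwa [planeProj, add_comm] at this

/-! ### Brackets with sections that normalize the eigenbundle. -/

section Bracket

variable [I.Boundaryless] [FiniteDimensional ℝ E]

/-- A real section that normalizes the eigenbundle preserves orthogonality to the frame. -/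
theorem pairing_dorfman_of_normalizes (h : IsAdaptedFrame F' Φ e₁ e₂) {v : ∀ p : M, GT I p}
    (hn : Normalizes I (toCx I v) (eigenbundle I Φ)) {s : ∀ p : M, GT I p}
    (hs : IsSmooth I s) (h1 : ∀ p, pairing I p (e₁ p) (s p) = 0)
    (h2 : ∀ p, pairing I p (e₂ p) (s p) = 0) (p : M) :
    pairing I p (dorfman I v s p) (e₁ p) = 0 := by
  -- `s` is the real part of the section `s - √-1 Φ s` of the eigenbundle. Bracketing with the real
  -- section `v` respects real parts, and elements of the eigenbundle are orthogonal to `e₁`.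
  have hm := h.pairing_eq_zero_of_mem (hn _ (h.mk_mem_cSections hs h1 h2) p)
  have e : (cDorfman I (toCx I v) (fun p => Cx.mk (s p) (-Φ p (s p))) p).re = dorfman I v s p := by
    have := dorfman_zero_left (h.smooth s hs).neg p
    exact (congrArg (dorfman I v s p - ·) this).trans (sub_zero _)
  rw [e] at hm
  exact hm.1

variable [T2Space M]

/-- By the previous lemma `v` preserves `Γ(F'^⊥)`. For `w` in `F'` and `s` in `F'^⊥`, invariance of
the pairing gives `⟨[v, w], s⟩ = -⟨w, [v, s]⟩ = 0`, so `v` preserves `Γ(F')` as well. -/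
theorem dorfman_eq_planeProj (h : IsAdaptedFrame F' Φ e₁ e₂) {v w : ∀ p : M, GT I p}
    (hv : IsSmooth I v) (hn : Normalizes I (toCx I v) (eigenbundle I Φ)) (hw : IsSmooth I w)
    (hwF : ∀ p, w p ∈ F' p) (p : M) :
    dorfman I v w p = planeProj (e₁ p) (e₂ p) (dorfman I v w p) := by
  rw [← sub_eq_zero]
  refine eq_zero_of_pairing_eq_zero fun y => ?_
  obtain ⟨s, hs, rfl⟩ := exists_smooth_extension p y
  have hs' := hs.sub (h.smooth_planeProj hs)
  have h1 : ∀ q, pairing I q (e₁ q) ((s - fun p => planeProj (e₁ p) (e₂ p) (s p)) q) = 0 :=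
    fun q => h.pairing_planeProj_left q (s q)
  have h2 : ∀ q, pairing I q (e₂ q) ((s - fun p => planeProj (e₁ p) (e₂ p) (s p)) q) = 0 :=
    fun q => h.pairing_planeProj_right q (s q)
  have a1 := h.pairing_dorfman_of_normalizes hn hs' h1 h2 p
  have a2 := h.symm.pairing_dorfman_of_normalizes hn hs' h2 h1 p
  have hw0 : ∀ x : ∀ q, GT I q, (∀ q, pairing I q (e₁ q) (x q) = 0) →
      (∀ q, pairing I q (e₂ q) (x q) = 0) → ∀ q, pairing I q (w q) (x q) = 0 := by
    intro x hx1 hx2 q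
    obtain ⟨c, d, hcd⟩ := Submodule.mem_span_pair.1 (h.span q ▸ hwF q)
    rw [← hcd]
    simp [hx1, hx2]
  have key := pairing_dorfman_of_const hv hw hs' (hw0 _ h1 h2) p
  obtain ⟨c, d, hcd⟩ := Submodule.mem_span_pair.1 (h.span p ▸ hwF p)
  rw [← hcd, pairing_add_left, pairing_smul_left, pairing_smul_left, pairing_comm p (e₁ p),
    pairing_comm p (e₂ p), a1, a2] at key
  have hP := h.isOrthProj p
  -- The projection `P` is self-adjoint, so pairing `[v, w] - P[v, w]` with `s` amounts to pairing
  -- `[v, w]` with `s - P s`, where `key` applies.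
  have b1 := hP.sub_mem (dorfman I v w p) _ (hP.mem (s p))
  have b2 := hP.sub_mem (s p) _ (hP.mem (dorfman I v w p))
  have key' : pairing I p (dorfman I v w p) (s p - planeProj (e₁ p) (e₂ p) (s p)) = 0 := by
    have : (s - fun p => planeProj (e₁ p) (e₂ p) (s p)) p =
      s p - planeProj (e₁ p) (e₂ p) (s p) := rfl
    rw [this] at key
    linarith
  rw [pairing_comm] at b2
  simp only [pairing_sub_left, pairing_sub_right] at *
  linarith

/-- If the frame normalizes the eigenbundle, then its elements commute. -/
theorem dorfman_eq_zero (h : IsAdaptedFrame F' Φ e₁ e₂)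
    (hn : Normalizes I (toCx I e₁) (eigenbundle I Φ)) (p : M) : dorfman I e₁ e₂ p = 0 := by
  rw [h.dorfman_eq_planeProj h.smooth₁ hn h.smooth₂
    (fun p => by rw [h.span]; exact Submodule.subset_span (by simp))]
  -- The bracket lies in the plane, so two pairings decide it. Constancy of `⟨e₂, e₂⟩` gives `⟨[e₁,
  -- e₂], e₂⟩ = 0`; constancy of `⟨e₂, e₁⟩` together with `[e₁, e₁] = 0` gives `⟨[e₁, e₂], e₁⟩ = 0`.
  have a := pairing_dorfman_of_const h.smooth₁ h.smooth₂ h.smooth₂ h.isotropic₂ p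
  have b := pairing_dorfman_of_const h.smooth₁ h.smooth₂ h.smooth₁
    (fun q => by rw [pairing_comm]; exact h.dual q) p
  rw [dorfman_self_eq_zero h.smooth₁ h.isotropic₁, pairing_zero_right, add_zero] at b
  refine planeProj_eq_zero ?_ ?_
  · rw [pairing_comm, b]
  · rw [pairing_comm p (e₂ p)] at a ⊢
    linarith

end Bracket

end IsAdaptedFrame
end Contact
end GenGeom

/-! ### Framings and their isotropic bases. -/

namespace GenGeom

section Framing

variable {E : Type*} [NormedAddCommGroup E] [NormedSpace ℝ E]
  {H : Type*} [TopologicalSpace H] {I : ModelWithCorners ℝ E H}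
  {M : Type*} [TopologicalSpace M] [ChartedSpace H M] [IsManifold I ∞ M]
  {F' : ∀ p : M, Submodule ℝ (GT I p)} {V : Submodule ℝ (∀ p : M, GT I p)}
  {Φ : ∀ p : M, GT I p →ₗ[ℝ] GT I p} {e₁ e₂ : ∀ p : M, GT I p}

/-- A local frame and a bump function extend `x` to a global section of `F'`. Expanding it in the
framing and freezing the coefficients at `p` gives an element of `V` with the same value there. -/
theorem IsFraming.exists_apply_eq [I.Boundaryless] [FiniteDimensional ℝ E] [T2Space M] {k r : ℕ}
    (hF : IsSplitStructure I k F') (hV : IsFraming I r F' V) {p : M} {x : GT I p}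
    (hx : x ∈ F' p) : ∃ v ∈ V, v p = x := by
  obtain ⟨s, hs, hsp⟩ := hF.localFrame p
  obtain ⟨χ, -, hχ⟩ := (SmoothBumpFunction.nhds_basis_tsupport (I := I) p).mem_iff.1 hsp
  have hp := hsp.self_of_nhds.2
  rw [← hp, Submodule.mem_span_range_iff_exists_fun] at hx
  obtain ⟨c, hc⟩ := hx
  have hy : (fun q => χ q • (∑ i, c i • s i) q) ∈ sections I F' := by
    refine ⟨.smul χ.contMDiff (.sum _ fun i _ => (hs i).const_smul _), fun q => ?_⟩
    by_cases hq : q ∈ tsupport χ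
    · rw [← (hχ hq).2]
      change χ q • (∑ i, c i • s i) q ∈ _
      rw [Finset.sum_apply]
      exact Submodule.smul_mem _ _ (Submodule.sum_mem _ fun i _ => Submodule.smul_mem _ _
        (Submodule.subset_span ⟨i, rfl⟩))
    · simp only [image_eq_zero_of_notMem_tsupport hq, zero_smul]
      exact (F' q).zero_mem
  obtain ⟨n, f, v, -, hv, h⟩ := hV.span _ hy
  refine ⟨∑ i, f i p • v i, Submodule.sum_mem _ fun i _ => V.smul_mem _ (hv i), ?_⟩
  have h' := h p
  rw [χ.eq_one, one_smul, Finset.sum_apply] at h'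
  rw [Finset.sum_apply]
  exact h'.symm.trans hc

omit [IsManifold I ∞ M] in
theorem IsIsotropicBasis.mem_left (h : IsIsotropicBasis I V e₁ e₂) : e₁ ∈ V := by
  rw [← h.span_eq]
  exact Submodule.subset_span (by simp)

omit [IsManifold I ∞ M] in
theorem IsIsotropicBasis.mem_right (h : IsIsotropicBasis I V e₁ e₂) : e₂ ∈ V := by
  rw [← h.span_eq]
  exact Submodule.subset_span (by simp)

theorem IsIsotropicBasis.fibre_eq [I.Boundaryless] [FiniteDimensional ℝ E] [T2Space M] {k r : ℕ}
    (hF : IsSplitStructure I k F') (hV : IsFraming I r F' V) (h : IsIsotropicBasis I V e₁ e₂)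
    (p : M) : F' p = Submodule.span ℝ {e₁ p, e₂ p} := by
  apply le_antisymm
  · intro x hx
    obtain ⟨v, hv, rfl⟩ := hV.exists_apply_eq hF hx
    rw [← h.span_eq] at hv
    obtain ⟨a, b, rfl⟩ := Submodule.mem_span_pair.1 hv
    exact Submodule.mem_span_pair.2 ⟨a, b, rfl⟩
  · rw [Submodule.span_le]
    rintro x (rfl | rfl)
    · exact (hV.subset _ h.mem_left).2 p
    · exact (hV.subset _ h.mem_right).2 p

theorem IsGenAlmostContact.isAdaptedFrame [I.Boundaryless] [FiniteDimensional ℝ E] [T2Space M]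
    {r : ℕ} (hΦ : IsGenAlmostContact I F' Φ) (hV : IsFraming I r F' V)
    (h : IsIsotropicBasis I V e₁ e₂) : IsAdaptedFrame F' Φ e₁ e₂ :=
  hΦ.sgf.isAdaptedFrame (hV.subset _ h.mem_left).1 (hV.subset _ h.mem_right).1 h.isotropic₁
    h.isotropic₂ h.dual (h.fibre_eq hΦ.split hV)

theorem IsAdaptedFrame.isGenAlmostContactTriple (h : IsAdaptedFrame F' Φ e₁ e₂) :
    IsGenAlmostContactTriple I Φ e₁ e₂ where
  smooth := h.smooth
  smooth₁ := h.smooth₁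
  smooth₂ := h.smooth₂
  isotropic₁ := h.isotropic₁
  isotropic₂ := h.isotropic₂
  dual p := by rw [h.dual]; norm_num
  skew := h.skew
  square p x := by
    rw [h.square, planeProj]
    abel

omit [IsManifold I ∞ M] in
theorem finrank_span_pair_of_isotropic {p : M} (h₁ : pairing I p (e₁ p) (e₁ p) = 0)
    (h₂ : pairing I p (e₂ p) (e₂ p) = 0) (hd : 2 * pairing I p (e₁ p) (e₂ p) = 1) :
    Module.finrank ℝ (Submodule.span ℝ {e₁, e₂}) = 2 := by
  have li : LinearIndependent ℝ ![e₁, e₂] := by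
    rw [LinearIndependent.pair_iff]
    intro s t hst
    have h0 : s • e₁ p + t • e₂ p = 0 := congrFun hst p
    have a1 := congrArg (pairing I p · (e₂ p)) h0
    have a2 := congrArg (pairing I p (e₁ p)) h0
    simp only [pairing_add_left, pairing_add_right, pairing_smul_left, pairing_smul_right, h₁, h₂,
      pairing_zero_left, pairing_zero_right] at a1 a2
    constructor
    · linear_combination 2 * a1 - s * hd
    · linear_combination 2 * a2 - t * hd
  have e : Set.range ![e₁, e₂] = {e₁, e₂} := by
    ext x
    simp only [Set.mem_range, Fin.exists_fin_two, Set.mem_insert_iff, Set.mem_singleton_iff,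
      Matrix.cons_val_zero, Matrix.cons_val_one, eq_comm (a := x)]
  have := finrank_span_eq_card li
  rwa [e, Fintype.card_fin] at this

/-- A framing of a split structure of rank two on which the inner product is constant has an
isotropic basis. -/
theorem IsFraming.exists_isotropicBasis [I.Boundaryless] [FiniteDimensional ℝ E] [T2Space M]
    [Nonempty M] (hF : IsSplitStructure I 1 F') (hV : IsFraming I 2 F' V)
    (hc : ∀ v ∈ V, ∀ w ∈ V, ∀ p q, pairing I p (v p) (w p) = pairing I q (v q) (w q)) :
    ∃ e₁ e₂, IsIsotropicBasis I V e₁ e₂ := by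
  obtain ⟨p⟩ := ‹Nonempty M›
  obtain ⟨e, f, he, hf, hef, hspan⟩ := hF.signature p
  have ee := he 0 0
  have ff := hf 0 0
  have ef := hef 0 0
  simp only [if_true] at ee ff
  obtain ⟨v, hv, hve⟩ := hV.exists_apply_eq hF
    (show e 0 ∈ F' p from hspan ▸ Submodule.subset_span (Or.inl ⟨0, rfl⟩))
  obtain ⟨w, hw, hwf⟩ := hV.exists_apply_eq hF
    (show f 0 ∈ F' p from hspan ▸ Submodule.subset_span (Or.inr ⟨0, rfl⟩))
  -- Constancy of the pairing on `V` carries the values at `p`, read from the signature, to all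
  -- points.
  have vv : ∀ q, pairing I q (v q) (v q) = 1 := fun q => by rw [hc v hv v hv q p, hve, ee]
  have ww : ∀ q, pairing I q (w q) (w q) = -1 := fun q => by rw [hc w hw w hw q p, hwf, ff]
  have vw : ∀ q, pairing I q (v q) (w q) = 0 := fun q => by rw [hc v hv w hw q p, hve, hwf, ef]
  have wv : ∀ q, pairing I q (w q) (v q) = 0 := fun q => by rw [pairing_comm, vw]
  -- The null directions of a plane of signature `(1, 1)` are spanned by `v ± w`; the factor `1 / 2`
  -- on each yields `⟨e₁, e₂⟩ = (1 + 1) / 4 = 1 / 2`.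
  have a : ∀ q, ((1 / 2 : ℝ) • (v + w)) q = (1 / 2 : ℝ) • (v q + w q) := fun _ => rfl
  have b : ∀ q, ((1 / 2 : ℝ) • (v - w)) q = (1 / 2 : ℝ) • (v q - w q) := fun _ => rfl
  have i₁ : ∀ q, pairing I q (((1 / 2 : ℝ) • (v + w)) q) (((1 / 2 : ℝ) • (v + w)) q) = 0 := by
    intro q; rw [a]; simp [vv, ww, vw, wv]
  have i₂ : ∀ q, pairing I q (((1 / 2 : ℝ) • (v - w)) q) (((1 / 2 : ℝ) • (v - w)) q) = 0 := by
    intro q; rw [b]; simp [vv, ww, vw, wv]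
  have d : ∀ q, 2 * pairing I q (((1 / 2 : ℝ) • (v + w)) q) (((1 / 2 : ℝ) • (v - w)) q) = 1 := by
    intro q; rw [a, b]; simp [vv, ww, vw, wv]; norm_num
  have hm₁ : (1 / 2 : ℝ) • (v + w) ∈ V := V.smul_mem _ (V.add_mem hv hw)
  have hm₂ : (1 / 2 : ℝ) • (v - w) ∈ V := V.smul_mem _ (V.sub_mem hv hw)
  refine ⟨_, _, ?_, i₁, i₂, d⟩
  have := hV.finite
  refine Submodule.eq_of_le_of_finrank_eq (Submodule.span_le.2 ?_) ?_
  · rintro x (rfl | rfl)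
    exacts [hm₁, hm₂]
  · rw [hV.dim]
    exact finrank_span_pair_of_isotropic (i₁ p) (i₂ p) (d p)

/-! ### Normal pairs and normal triples -/

variable [I.Boundaryless] [FiniteDimensional ℝ E]

omit [I.Boundaryless] [FiniteDimensional ℝ E] in
theorem IsCSmooth.toCx {x : ∀ p : M, GT I p} (hx : IsSmooth I x) :
    IsCSmooth (GenGeom.toCx I x) := ⟨hx, IsSmooth.zero⟩

theorem cDorfman_toCx_left {x : ∀ p : M, GT I p} {z : ∀ p : M, Cx (GT I p)} (hz : IsCSmooth z)
    (p : M) : cDorfman I (toCx I x) z p =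
      Cx.mk (dorfman I x (fun q => (z q).re) p) (dorfman I x (fun q => (z q).im) p) := by
  have h1 := dorfman_zero_left hz.1 p
  have h2 := dorfman_zero_left hz.2 p
  apply Cx.ext
  · exact (congrArg (dorfman I x (fun q => (z q).re) p - ·) h2).trans (sub_zero _)
  · exact (congrArg (dorfman I x (fun q => (z q).im) p + ·) h1).trans (add_zero _)

/-- The symmetric part of the bracket is the differential of the complex pairing. Here vanishing at
a single point would not suffice: the pairing has to vanish identically for its differential to drop
out. -/
theorem cDorfman_swap_of_eq_zero {z w : ∀ p : M, Cx (GT I p)} (hz : IsCSmooth z)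
    (hw : IsCSmooth w) (h : ∀ p, cPairing p (z p) (w p) = 0) (p : M) :
    cDorfman I z w p = -cDorfman I w z p := by
  have h1 := dorfman_add_dorfman_swap (hz.1.at p) (hw.1.at p)
  have h2 := dorfman_add_dorfman_swap (hz.2.at p) (hw.2.at p)
  have h3 := dorfman_add_dorfman_swap (hz.1.at p) (hw.2.at p)
  have h4 := dorfman_add_dorfman_swap (hz.2.at p) (hw.1.at p)
  have e1 : (fun q => pairing I q (z q).re (w q).re) = fun q => pairing I q (z q).im (w q).im :=
    funext fun q => sub_eq_zero.1 (congrArg Complex.re (h q))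
  have e2 : (fun q => pairing I q (z q).re (w q).im) =
      fun q => (-1) * pairing I q (z q).im (w q).re :=
    funext fun q => by
      rw [neg_one_mul]
      exact eq_neg_of_add_eq_zero_left (congrArg Complex.im (h q))
  have e3 : dform (I := I) (fun q => (-1) * pairing I q (z q).im (w q).re) p =
      -dform (fun q => pairing I q (z q).im (w q).re) p := by
    have hf := contMDiff_pairing hz.2 hw.1
    have := ((hasFDerivAt_dfun (hf p)).const_mul (-1)).fderiv
    unfold dform
    rw [← map_neg]
    congr 1
    refine Prod.ext ?_ ?_
    · simp
    · exact this.trans (neg_one_smul ℝ _)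
  rw [e1] at h1
  rw [e2, e3] at h3
  apply Cx.ext
  · change (cDorfman I z w p).re = -(cDorfman I w z p).re
    simp only [cDorfman, Cx.re_mk]
    rw [eq_sub_of_add_eq h1, eq_sub_of_add_eq h2]
    abel
  · change (cDorfman I z w p).im = -(cDorfman I w z p).im
    simp only [cDorfman, Cx.im_mk]
    rw [eq_sub_of_add_eq h3, eq_sub_of_add_eq h4, smul_neg]
    abel

end Framing
end GenGeom

namespace GenGeom

theorem cx_zero_smul {V : Type*} [AddCommGroup V] [Module ℝ V] (z : Cx V) : (0 : ℂ) • z = 0 := by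
  ext <;> simp

/-! ### Normality as three conditions on the eigenbundle. -/

section Normal

variable {E : Type*} [NormedAddCommGroup E] [NormedSpace ℝ E]
  {H : Type*} [TopologicalSpace H] {I : ModelWithCorners ℝ E H}
  {M : Type*} [TopologicalSpace M] [ChartedSpace H M] [IsManifold I ∞ M]
  {F' : ∀ p : M, Submodule ℝ (GT I p)} {V : Submodule ℝ (∀ p : M, GT I p)}
  {Φ : ∀ p : M, GT I p →ₗ[ℝ] GT I p} {e₁ e₂ : ∀ p : M, GT I p}

omit [IsManifold I ∞ M] in
theorem mem_addLine_iff {e : ∀ p : M, GT I p} {p : M} {z : Cx (GT I p)} :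
    z ∈ addLine I (eigenbundle I Φ) e p ↔
      z ∈ eigenSubmodule Φ p ⊔ Submodule.span ℂ {toCx I e p} := by
  rw [Submodule.mem_sup]
  constructor
  · rintro ⟨l, hl, c, rfl⟩
    exact ⟨l, hl, _, Submodule.smul_mem _ c (Submodule.mem_span_singleton_self _), rfl⟩
  · rintro ⟨l, hl, y, hy, rfl⟩
    obtain ⟨c, rfl⟩ := Submodule.mem_span_singleton.1 hy
    exact ⟨l, hl, c, rfl⟩

/-- The coefficient of an element of `L ⊕ ℂ e₁` along `e₁`. -/
theorem IsAdaptedFrame.coeff_addLine (h : IsAdaptedFrame F' Φ e₁ e₂) {p : M} {l : Cx (GT I p)}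
    (hl : l ∈ eigenbundle I Φ p) (c : ℂ) :
    2 * pairing I p (l + c • toCx I e₁ p).re (e₂ p) = c.re ∧
    2 * pairing I p (l + c • toCx I e₁ p).im (e₂ p) = c.im := by
  have := h.symm.pairing_eq_zero_of_mem hl
  simp only [toCx, Cx.re_add, Cx.im_add, Cx.re_smul, Cx.im_smul, Cx.re_mk, Cx.im_mk, smul_zero,
    sub_zero, zero_add, pairing_add_left, pairing_smul_left, this.1, this.2, h.dual]
  constructor <;> ring

/-- Pairing with `e₂` reads off the coefficient of `e₁`, because `L ⊥ e₂` and `2⟨e₁, e₂⟩ = 1`. -/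
theorem IsAdaptedFrame.mem_of_mem_addLine (h : IsAdaptedFrame F' Φ e₁ e₂) {p : M}
    {z : Cx (GT I p)} (hz : z ∈ addLine I (eigenbundle I Φ) e₁ p)
    (h1 : pairing I p z.re (e₂ p) = 0) (h2 : pairing I p z.im (e₂ p) = 0) :
    z ∈ eigenbundle I Φ p := by
  obtain ⟨l, hl, c, rfl⟩ := hz
  obtain ⟨a, b⟩ := h.coeff_addLine hl c
  rw [h1, mul_zero] at a
  rw [h2, mul_zero] at b
  have : c = 0 := Complex.ext a.symm b.symm
  rw [this, cx_zero_smul, add_zero]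
  exact hl

variable [I.Boundaryless] [FiniteDimensional ℝ E]

/-- `L ⊕ ℂ e₁` is isotropic and generated by `Γ(L)` and `e₁`, so only generators matter: `[L, L]`
and `[e₁, L]` lie in `L` by hypothesis, `[L, e₁] = -[e₁, L]` by orthogonality, and `[e₁, e₁] = 0`.
-/
theorem IsAdaptedFrame.isInvolutive_addLine (h : IsAdaptedFrame F' Φ e₁ e₂)
    (hL : IsInvolutive I (eigenbundle I Φ))
    (hn : Normalizes I (toCx I e₁) (eigenbundle I Φ)) :
    IsInvolutive I (addLine I (eigenbundle I Φ) e₁) := by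
  have hs : IsCSmooth (toCx I e₁) := .toCx h.smooth₁
  let G : Set (∀ p : M, Cx (GT I p)) := cSections I (eigenbundle I Φ) ∪ {toCx I e₁}
  have gen : ∀ z ∈ cSections I (addLine I (eigenbundle I Φ) e₁), ∀ p, LocGen G p z := by
    intro z hz p
    -- The coefficient along `e₁`, written as a pairing with `e₂` so that its smoothness is visible.
    let c : M → ℂ := fun q => ⟨2 * pairing I q (z q).re (e₂ q), 2 * pairing I q (z q).im (e₂ q)⟩
    have hre : ContMDiff I 𝓘(ℝ, ℝ) ∞ fun q => (c q).re :=
      contMDiff_const_mul_pairing hz.1 h.smooth₂ 2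
    have him : ContMDiff I 𝓘(ℝ, ℝ) ∞ fun q => (c q).im :=
      contMDiff_const_mul_pairing hz.2.1 h.smooth₂ 2
    have gens : LocGen G p (fun q => c q • toCx I e₁ q) :=
      LocGen.csmul hre him (.base (Or.inr rfl))
    have l : (z - fun q => c q • toCx I e₁ q) ∈ cSections I (eigenbundle I Φ) := by
      refine ⟨?_, ?_, fun q => ?_⟩
      · have e : (fun q => ((z - fun q => c q • toCx I e₁ q) q).re) =
            (fun q => (z q).re) - fun q => (c q).re • e₁ q := by
          funext q
          change (z q).re - (c q • toCx I e₁ q).re = (z q).re - (c q).re • e₁ q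
          simp [toCx]
        rw [e]
        exact hz.1.sub (h.smooth₁.smul hre)
      · have e : (fun q => ((z - fun q => c q • toCx I e₁ q) q).im) =
            (fun q => (z q).im) - fun q => (c q).im • e₁ q := by
          funext q
          change (z q).im - (c q • toCx I e₁ q).im = (z q).im - (c q).im • e₁ q
          simp [toCx]
        rw [e]
        exact hz.2.1.sub (h.smooth₁.smul him)
      · obtain ⟨l, hl, d, hd⟩ := hz.2.2 q
        obtain ⟨a, b⟩ := h.coeff_addLine hl d
        rw [← hd] at a b
        have hcd : c q = d := Complex.ext a b
        change z q - c q • toCx I e₁ q ∈ _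
        rw [hcd, hd, add_sub_cancel_right]
        exact hl
    have e : z = (z - fun q => c q • toCx I e₁ q) + fun q => c q • toCx I e₁ q :=
      (sub_add_cancel z _).symm
    rw [e]
    exact .add (.base (Or.inl l)) gens
  have iso : ∀ p, ∀ z ∈ addLine I (eigenbundle I Φ) e₁ p, ∀ w ∈ addLine I (eigenbundle I Φ) e₁ p,
      cPairing p z w = 0 := by
    rintro p _ ⟨l, hl, c, rfl⟩ _ ⟨m, hm, d, rfl⟩
    have h0 := cPairing_eq_zero_of_mem_eigenbundle (h.skew p) hl hm
    obtain ⟨l1, l2⟩ := h.pairing_eq_zero_of_mem hl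
    obtain ⟨m1, m2⟩ := h.pairing_eq_zero_of_mem hm
    have h1 := congrArg Complex.re h0
    have h2 := congrArg Complex.im h0
    rw [pairing_comm] at m1 m2
    simp only [cPairing, Complex.zero_re, Complex.zero_im] at h1 h2
    apply Complex.ext
    · simp [cPairing, toCx, l1, l2, m1, m2, h.isotropic₁, h1]
    · simp [cPairing, toCx, l1, l2, m1, m2, h.isotropic₁, h2]
  have sub : ∀ p, eigenbundle I Φ p ⊆ addLine I (eigenbundle I Φ) e₁ p := fun p l hl =>
    ⟨l, hl, 0, by simp [cx_zero_smul]⟩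
  have norm : ∀ z ∈ cSections I (eigenbundle I Φ), ∀ p,
      cDorfman I z (toCx I e₁) p ∈ eigenbundle I Φ p := by
    intro z hz p
    rw [cDorfman_swap_of_eq_zero ⟨hz.1, hz.2.1⟩ hs fun q => ?_]
    · exact (eigenSubmodule Φ p).neg_mem (hn z hz p)
    · obtain ⟨a, b⟩ := h.pairing_eq_zero_of_mem (hz.2.2 q)
      apply Complex.ext <;> simp [cPairing, toCx, a, b]
  intro z hz w hw p
  rw [mem_addLine_iff]
  refine LocGen.cDorfman_mem
    (L := fun p => eigenSubmodule Φ p ⊔ Submodule.span ℂ {toCx I e₁ p})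
    (fun z hz w hw => iso p z (mem_addLine_iff.2 hz) w (mem_addLine_iff.2 hw)) ?_ ?_
    (gen z hz p) (gen w hw p)
  · rintro z (hz | rfl)
    · exact ⟨⟨hz.1, hz.2.1⟩, mem_addLine_iff.1 (sub p (hz.2.2 p))⟩
    · exact ⟨hs, Submodule.mem_sup_right (Submodule.mem_span_singleton_self _)⟩
  · rintro z (hz | rfl) w (hw | rfl)
    · exact mem_addLine_iff.1 (sub p (hL z hz w hw p))
    · exact mem_addLine_iff.1 (sub p (norm z hz p))
    · exact mem_addLine_iff.1 (sub p (hn w hw p))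
    · rw [cDorfman_toCx_left hs]
      have a := dorfman_self_eq_zero h.smooth₁ h.isotropic₁ p
      have b := dorfman_const_smul_right 0 h.smooth₁ h.smooth₁ p
      have c : (0 : ℝ) • e₁ = 0 := funext fun q => zero_smul ℝ (e₁ q)
      have e : Cx.mk (dorfman I e₁ (fun q => (toCx I e₁ q).re) p)
          (dorfman I e₁ (fun q => (toCx I e₁ q).im) p) = 0 := by
        apply Cx.ext
        · exact a
        · rw [c] at b
          exact b.trans (zero_smul ℝ _)
      rw [e]
      exact Submodule.zero_mem _

/-- `[e₁, z]` lies in `L ⊕ ℂ e₁`, and its `e₁`-coefficient is `2⟨[e₁, z], e₂⟩ = -2⟨z, [e₁, e₂]⟩ =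
0`. -/
theorem IsAdaptedFrame.normalizes_of_isInvolutive (h : IsAdaptedFrame F' Φ e₁ e₂)
    (h1 : IsInvolutive I (addLine I (eigenbundle I Φ) e₁))
    (hc : ∀ p, dorfman I e₁ e₂ p = 0) : Normalizes I (toCx I e₁) (eigenbundle I Φ) := by
  intro z hz p
  have hm := h1 (toCx I e₁) ⟨h.smooth₁, IsSmooth.zero, fun q =>
    ⟨0, (eigenSubmodule Φ q).zero_mem, 1, by simp⟩⟩ z
    ⟨hz.1, hz.2.1, fun q => ⟨z q, hz.2.2 q, 0, by simp [cx_zero_smul]⟩⟩ p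
  rw [cDorfman_toCx_left ⟨hz.1, hz.2.1⟩] at hm ⊢
  refine h.mem_of_mem_addLine hm ?_ ?_
  · have := pairing_dorfman_of_const h.smooth₁ hz.1 h.smooth₂
      (fun q => (h.symm.pairing_eq_zero_of_mem (hz.2.2 q)).1) p
    rw [hc, pairing_zero_right, add_zero] at this
    exact this
  · have := pairing_dorfman_of_const h.smooth₁ hz.2.1 h.smooth₂
      (fun q => (h.symm.pairing_eq_zero_of_mem (hz.2.2 q)).2) p
    rw [hc, pairing_zero_right, add_zero] at this
    exact this

/-- Involutivity of `L` comes from `L = (L ⊕ ℂ e₁) ∩ (L ⊕ ℂ e₂)`: elements of the second space are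
orthogonal to `e₂`, hence have no `e₁`-component. In the other direction `[e₁, e₂] = 0` is automatic
by `dorfman_eq_zero`. -/
theorem IsAdaptedFrame.isNormalTriple_iff [T2Space M] (h : IsAdaptedFrame F' Φ e₁ e₂) :
    IsNormalTriple I Φ e₁ e₂ ↔ IsInvolutive I (eigenbundle I Φ) ∧
      Normalizes I (toCx I e₁) (eigenbundle I Φ) ∧
      Normalizes I (toCx I e₂) (eigenbundle I Φ) := by
  constructor
  · intro hN
    have hc' : ∀ p, dorfman I e₂ e₁ p = 0 := fun p => by
      rw [dorfman_swap_of_const h.smooth₂ h.smooth₁ h.symm.dual, hN.commute, neg_zero]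
    refine ⟨fun z hz w hw p => ?_, h.normalizes_of_isInvolutive hN.integrable₁ hN.commute,
      h.symm.normalizes_of_isInvolutive hN.integrable₂ hc'⟩
    have up : ∀ e : ∀ p : M, GT I p, ∀ z ∈ cSections I (eigenbundle I Φ),
        z ∈ cSections I (addLine I (eigenbundle I Φ) e) := fun e z hz =>
      ⟨hz.1, hz.2.1, fun q => ⟨z q, hz.2.2 q, 0, by simp [cx_zero_smul]⟩⟩
    have a := hN.integrable₁ z (up _ z hz) w (up _ w hw) p
    obtain ⟨l, hl, c, hc⟩ := hN.integrable₂ z (up _ z hz) w (up _ w hw) p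
    obtain ⟨l1, l2⟩ := h.symm.pairing_eq_zero_of_mem hl
    refine h.mem_of_mem_addLine a ?_ ?_ <;> rw [hc] <;> simp [toCx, l1, l2, h.isotropic₂]
  · rintro ⟨hL, h1, h2⟩
    exact ⟨h.isGenAlmostContactTriple, h.isInvolutive_addLine hL h1,
      h.symm.isInvolutive_addLine hL h2, h.dorfman_eq_zero h1⟩

/-- Sections commuting with the frame preserve `F'`. -/
theorem IsAdaptedFrame.normalizesReal (h : IsAdaptedFrame F' Φ e₁ e₂) {v : ∀ p : M, GT I p}
    (hv : IsSmooth I v) (h1 : ∀ p, dorfman I v e₁ p = 0) (h2 : ∀ p, dorfman I v e₂ p = 0) :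
    NormalizesReal I v F' := by
  intro y hy p
  have e : y = (fun q => (2 * pairing I q (e₁ q) (y q)) • e₂ q) +
      fun q => (2 * pairing I q (e₂ q) (y q)) • e₁ q := by
    funext q
    change y q = planeProj (e₁ q) (e₂ q) (y q)
    obtain ⟨c, d, hcd⟩ := Submodule.mem_span_pair.1 (h.span q ▸ hy.2 q)
    rw [← hcd]
    simp only [planeProj, pairing_add_right, pairing_smul_right, h.isotropic₁, h.isotropic₂,
      h.dual, pairing_comm q (e₂ q) (e₁ q)]
    module
  have f1 := contMDiff_const_mul_pairing h.smooth₁ hy.1 2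
  have f2 := contMDiff_const_mul_pairing h.smooth₂ hy.1 2
  rw [e, dorfman_add_right (hv.at p) ((h.smooth₂.smul f1).at p) ((h.smooth₁.smul f2).at p),
    dorfman_smul_right (f1 p) (hv.at p) (h.smooth₂.at p),
    dorfman_smul_right (f2 p) (hv.at p) (h.smooth₁.at p), h1, h2, h.span]
  simp only [smul_zero, zero_add]
  exact add_mem (Submodule.smul_mem _ _ (Submodule.subset_span (by simp)))
      (Submodule.smul_mem _ _ (Submodule.subset_span (by simp)))

/-- Constant coefficients produce no derivative terms, so normalizing passes from the basis to the
whole framing. -/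
theorem normalizes_combination (h₁ : IsSmooth I e₁) (h₂ : IsSmooth I e₂) (a b : ℝ)
    (hn₁ : Normalizes I (toCx I e₁) (eigenbundle I Φ))
    (hn₂ : Normalizes I (toCx I e₂) (eigenbundle I Φ)) :
    Normalizes I (toCx I (a • e₁ + b • e₂)) (eigenbundle I Φ) := by
  intro z hz p
  have m₁ := hn₁ z hz p
  have m₂ := hn₂ z hz p
  have hzs : IsCSmooth z := ⟨hz.1, hz.2.1⟩
  rw [cDorfman_toCx_left hzs] at m₁ m₂ ⊢
  have key : ∀ y : ∀ p : M, GT I p, IsSmooth I y → dorfman I (a • e₁ + b • e₂) y p =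
      a • dorfman I e₁ y p + b • dorfman I e₂ y p := fun y hy => by
    rw [dorfman_add_left ((h₁.const_smul a).at p) ((h₂.const_smul b).at p) (hy.at p),
      dorfman_const_smul_left a h₁ hy, dorfman_const_smul_left b h₂ hy]
  rw [key _ hz.1, key _ hz.2.1]
  have := (eigenSubmodule Φ p).add_mem ((eigenSubmodule Φ p).smul_mem (a : ℂ) m₁)
    ((eigenSubmodule Φ p).smul_mem (b : ℂ) m₂)
  convert! this using 1
  apply Cx.ext
  · simp only [Cx.re_mk, Cx.re_add, Cx.re_smul, Complex.ofReal_re, Complex.ofReal_im]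
    module
  · simp only [Cx.im_mk, Cx.im_add, Cx.im_smul, Complex.ofReal_re, Complex.ofReal_im]
    module

/-- The condition `[v, Γ(F')] ⊆ Γ(F')` is a consequence of the others: a frame that normalizes the
eigenbundle commutes, and a section commuting with the frame preserves `F'`. -/
theorem IsAdaptedFrame.isNormalPair_iff [T2Space M] (h : IsAdaptedFrame F' Φ e₁ e₂)
    (hΦ : IsSGF I (orth I F') Φ) (hV : Submodule.span ℝ {e₁, e₂} = V) :
    IsNormalPair I (orth I F') F' Φ V ↔ IsInvolutive I (eigenbundle I Φ) ∧
      Normalizes I (toCx I e₁) (eigenbundle I Φ) ∧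
      Normalizes I (toCx I e₂) (eigenbundle I Φ) := by
  constructor
  · rintro ⟨⟨-, hL⟩, hn⟩
    exact ⟨hL, (hn e₁ (hV ▸ Submodule.subset_span (by simp))).1,
      (hn e₂ (hV ▸ Submodule.subset_span (by simp))).1⟩
  · rintro ⟨hL, h1, h2⟩
    refine ⟨⟨hΦ, hL⟩, fun v hv => ?_⟩
    rw [← hV] at hv
    obtain ⟨a, b, rfl⟩ := Submodule.mem_span_pair.1 hv
    refine ⟨normalizes_combination h.smooth₁ h.smooth₂ a b h1 h2,
      h.normalizesReal ((h.smooth₁.const_smul a).add (h.smooth₂.const_smul b)) ?_ ?_⟩ <;> intro p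
    · rw [dorfman_add_left ((h.smooth₁.const_smul a).at p) ((h.smooth₂.const_smul b).at p)
        (h.smooth₁.at p), dorfman_const_smul_left a h.smooth₁ h.smooth₁,
        dorfman_const_smul_left b h.smooth₂ h.smooth₁, dorfman_self_eq_zero h.smooth₁ h.isotropic₁,
        h.symm.dorfman_eq_zero h2, smul_zero, smul_zero, add_zero]
    · rw [dorfman_add_left ((h.smooth₁.const_smul a).at p) ((h.smooth₂.const_smul b).at p)
        (h.smooth₂.at p), dorfman_const_smul_left a h.smooth₁ h.smooth₂,
        dorfman_const_smul_left b h.smooth₂ h.smooth₂, dorfman_self_eq_zero h.smooth₂ h.isotropic₂,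
        h.dorfman_eq_zero h1, smul_zero, smul_zero, add_zero]

end Normal
end GenGeom

/-! ### Projections of a product and pull-back of sections. -/

namespace GenGeom

section ModelInc

variable {E : Type*} [NormedAddCommGroup E] [NormedSpace ℝ E]
  {E₁ : Type*} [NormedAddCommGroup E₁] [NormedSpace ℝ E₁]

/-- The map `(X, α) ↦ (j X, α ∘ r)` between model spaces. -/
noncomputable def modelInc (j : E₁ →L[ℝ] E) (r : E →L[ℝ] E₁) :
    E₁ × (E₁ →L[ℝ] ℝ) →L[ℝ] E × (E →L[ℝ] ℝ) :=
  j.prodMap ((ContinuousLinearMap.compL ℝ E E₁ ℝ).flip r)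

theorem modelInc_fst (j : E₁ →L[ℝ] E) (r : E →L[ℝ] E₁) (a : E₁ × (E₁ →L[ℝ] ℝ)) :
    (modelInc j r a).1 = j a.1 := rfl

theorem modelInc_snd (j : E₁ →L[ℝ] E) (r : E →L[ℝ] E₁) (a : E₁ × (E₁ →L[ℝ] ℝ)) (u : E) :
    (modelInc j r a).2 u = a.2 (r u) := rfl

end ModelInc

section Leg

variable {E : Type*} [NormedAddCommGroup E] [NormedSpace ℝ E]
  {H : Type*} [TopologicalSpace H] (I : ModelWithCorners ℝ E H)
  (N : Type*) [TopologicalSpace N] [ChartedSpace H N] [IsManifold I ∞ N]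
  {E₁ : Type*} [NormedAddCommGroup E₁] [NormedSpace ℝ E₁]
  {H₁ : Type*} [TopologicalSpace H₁] (I₁ : ModelWithCorners ℝ E₁ H₁)
  (M₁ : Type*) [TopologicalSpace M₁] [ChartedSpace H₁ M₁] [IsManifold I₁ ∞ M₁]

/-- A projection `N → M₁` which is a linear retraction `ret` in the preferred charts, together
with a constant horizontal distribution given by a linear section `emb` of `ret`; the two
projections of a product of manifolds are the examples. -/
structure Leg where
  proj : N → M₁
  emb : E₁ →L[ℝ] E
  ret : E →L[ℝ] E₁
  smooth : ContMDiff I I₁ ∞ proj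
  ret_emb : ∀ a, ret (emb a) = a
  mem_baseSet : ∀ p q, q ∈ (trivializationAt E (TangentSpace I : N → Type _) p).baseSet →
    proj q ∈ (trivializationAt E₁ (TangentSpace I₁ : M₁ → Type _) (proj p)).baseSet
  proj_extChartAt_symm : ∀ p z,
    proj ((extChartAt I p).symm z) = (extChartAt I₁ (proj p)).symm (ret z)
  extChartAt_proj : ∀ p, extChartAt I₁ (proj p) (proj p) = ret (extChartAt I p p)
  coord_ret : ∀ p q, q ∈ (trivializationAt E (TangentSpace I : N → Type _) p).baseSet →
    ∀ w : E, ret ((trivializationAt E (TangentSpace I : N → Type _) p).continuousLinearMapAt ℝ q w)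
      = (trivializationAt E₁ (TangentSpace I₁ : M₁ → Type _) (proj p)).continuousLinearMapAt ℝ
        (proj q) (ret w : E₁)
  coord_emb : ∀ p q, q ∈ (trivializationAt E (TangentSpace I : N → Type _) p).baseSet →
    ∀ w : E₁, (trivializationAt E (TangentSpace I : N → Type _) p).continuousLinearMapAt ℝ q
      (emb w : E) = emb ((trivializationAt E₁ (TangentSpace I₁ : M₁ → Type _)
        (proj p)).continuousLinearMapAt ℝ (proj q) w)

namespace Leg

variable {I N I₁ M₁} (l : Leg I N I₁ M₁)

/-- The inclusion of a fibre of `𝕋M₁`. -/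
noncomputable def inc (q : N) : GT I₁ (l.proj q) →ₗ[ℝ] GT I q :=
  (val I q).symm.toLinearMap ∘ₗ (modelInc l.emb l.ret).toLinearMap ∘ₗ
    (val I₁ (l.proj q)).toLinearMap

/-- The projection to a fibre of `𝕋M₁`. -/
noncomputable def out (q : N) : GT I q →ₗ[ℝ] GT I₁ (l.proj q) :=
  (val I₁ (l.proj q)).symm.toLinearMap ∘ₗ (modelInc l.ret l.emb).toLinearMap ∘ₗ
    (val I q).toLinearMap

/-- The pull-back of a section. -/
noncomputable def pull (x : ∀ p : M₁, GT I₁ p) (q : N) : GT I q := l.inc q (x (l.proj q))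

theorem val_inc (q : N) (x : GT I₁ (l.proj q)) :
    val I q (l.inc q x) = modelInc l.emb l.ret (val I₁ (l.proj q) x) := rfl

theorem out_inc (q : N) (x : GT I₁ (l.proj q)) : l.out q (l.inc q x) = x :=
  GT_ext I₁ (l.ret_emb _) fun u => congrArg (val I₁ (l.proj q) x).2 (l.ret_emb u)

/-- `inc` and `out` are adjoint by definition, since they use `emb` and `ret` in exchanged roles. -/
theorem pairing_inc_left (q : N) (x : GT I₁ (l.proj q)) (y : GT I q) :
    pairing I q (l.inc q x) y = pairing I₁ (l.proj q) x (l.out q y) := rfl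

theorem pairing_inc_right (q : N) (x : GT I₁ (l.proj q)) (y : GT I q) :
    pairing I q y (l.inc q x) = pairing I₁ (l.proj q) (l.out q y) x := rfl

theorem pairing_inc_inc (q : N) (x y : GT I₁ (l.proj q)) :
    pairing I q (l.inc q x) (l.inc q y) = pairing I₁ (l.proj q) x y := by
  rw [l.pairing_inc_left, l.out_inc]

theorem inChart_pull (x : ∀ p : M₁, GT I₁ p) {p q : N}
    (hq : q ∈ (trivializationAt E (TangentSpace I : N → Type _) p).baseSet) :
    inChart I (l.pull x) p q = modelInc l.emb l.ret (inChart I₁ x (l.proj p) (l.proj q)) := by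
  refine Prod.ext (l.coord_emb p q hq _) (ContinuousLinearMap.ext fun u => ?_)
  have h := l.coord_ret p q hq
    ((trivializationAt E (TangentSpace I : N → Type _) p).symmL ℝ q u)
  rw [Trivialization.continuousLinearMapAt_symmL _ hq] at h
  -- `coord_ret` inverted: the retraction also intertwines the inverse trivializations, which is
  -- what the pull-back of a form sees.
  have h2 : (l.ret ((trivializationAt E (TangentSpace I : N → Type _) p).symmL ℝ q u : E) : E₁) =
      (trivializationAt E₁ (TangentSpace I₁ : M₁ → Type _) (l.proj p)).symmL ℝ (l.proj q)
        (l.ret u) := by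
    exact (Trivialization.symmL_continuousLinearMapAt (R := ℝ) _ (l.mem_baseSet p q hq)
      (_ : TangentSpace I₁ (l.proj q))).symm.trans (congrArg
        ((trivializationAt E₁ (TangentSpace I₁ : M₁ → Type _) (l.proj p)).symmL ℝ (l.proj q))
        h.symm)
  exact congrArg (fun w : E₁ => (val I₁ (l.proj q) (x (l.proj q))).2 w) h2

theorem isSmoothAt_pull {x : ∀ p : M₁, GT I₁ p} {q : N} (hx : IsSmoothAt I₁ x (l.proj q)) :
    IsSmoothAt I (l.pull x) q := by
  refine ContMDiffAt.congr_of_eventuallyEq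
    ((modelInc l.emb l.ret).contMDiff.contMDiffAt.comp q (hx.comp q (l.smooth q))) ?_
  filter_upwards [eventually_mem_baseSet I q] with p hp
  exact l.inChart_pull x hp

theorem isSmooth_pull {x : ∀ p : M₁, GT I₁ p} (hx : IsSmooth I₁ x) : IsSmooth I (l.pull x) :=
  (isSmooth_iff I).2 fun q => l.isSmoothAt_pull (hx.at (l.proj q))

variable [I.Boundaryless] [I₁.Boundaryless]

omit [I.Boundaryless] in
theorem jet_pull {x : ∀ p : M₁, GT I₁ p} {q : N} (hx : IsSmoothAt I₁ x (l.proj q)) (u : E) :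
    jet I (l.pull x) q u = modelInc l.emb l.ret (jet I₁ x (l.proj q) (l.ret u)) := by
  have h1 := hx.hasFDerivAt
  rw [l.extChartAt_proj] at h1
  have h2 := (modelInc l.emb l.ret).hasFDerivAt.comp _
    (h1.comp (extChartAt I q q) l.ret.hasFDerivAt)
  have h3 : inChart I (l.pull x) q ∘ (extChartAt I q).symm =ᶠ[nhds (extChartAt I q q)]
      modelInc l.emb l.ret ∘ (inChart I₁ x (l.proj q) ∘ (extChartAt I₁ (l.proj q)).symm) ∘
        l.ret := by
    have h4 := (continuousAt_extChartAt_symm (I := I) q).eventually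
      (by rw [extChartAt_to_inv]; exact eventually_mem_baseSet I q)
    filter_upwards [h4] with z hz
    simp only [Function.comp]
    rw [l.inChart_pull x hz, l.proj_extChartAt_symm]
  exact congrArg (fun f : E →L[ℝ] _ => f u) (h2.congr_of_eventuallyEq h3).fderiv

/-- In the preferred charts the pull-back is composition with constant linear maps, so jets pull
back by the same maps, and `ret ∘ emb = id` collapses the coordinate formula to the one on the base.
-/
theorem dorfman_pull [CompleteSpace E] [CompleteSpace E₁] {x y : ∀ p : M₁, GT I₁ p}
    (hx : IsSmooth I₁ x) (hy : IsSmooth I₁ y) (q : N) :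
    dorfman I (l.pull x) (l.pull y) q = l.inc q (dorfman I₁ x y (l.proj q)) := by
  have hx' := l.isSmooth_pull hx
  have hy' := l.isSmooth_pull hy
  have e : ∀ x : ∀ p : M₁, GT I₁ p, val I q (l.pull x q) =
    modelInc l.emb l.ret (val I₁ (l.proj q) (x (l.proj q))) := fun x => rfl
  refine GT_ext I ?_ fun u => ?_
  · rw [dorfman_fst (hx'.at q) (hy'.at q), l.val_inc, modelInc_fst,
      dorfman_fst (hx.at _) (hy.at _), l.jet_pull (hx.at _), l.jet_pull (hy.at _), e, e]
    simp only [modelInc_fst, l.ret_emb, map_sub]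
  · rw [dorfman_snd (hx'.at q) (hy'.at q), l.val_inc, modelInc_snd,
      dorfman_snd (hx.at _) (hy.at _), l.jet_pull (hx.at _), l.jet_pull (hy.at _),
      l.jet_pull (hx.at _), e, e]
    simp only [modelInc_fst, modelInc_snd, l.ret_emb]

end Leg

end Leg

/-! ### Two complementary projections. -/

section Pair

variable {E : Type*} [NormedAddCommGroup E] [NormedSpace ℝ E]
  {H : Type*} [TopologicalSpace H] {I : ModelWithCorners ℝ E H}
  {N : Type*} [TopologicalSpace N] [ChartedSpace H N] [IsManifold I ∞ N]
  {E₁ : Type*} [NormedAddCommGroup E₁] [NormedSpace ℝ E₁]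
  {H₁ : Type*} [TopologicalSpace H₁] {I₁ : ModelWithCorners ℝ E₁ H₁}
  {M₁ : Type*} [TopologicalSpace M₁] [ChartedSpace H₁ M₁] [IsManifold I₁ ∞ M₁]
  {E₂ : Type*} [NormedAddCommGroup E₂] [NormedSpace ℝ E₂]
  {H₂ : Type*} [TopologicalSpace H₂] {I₂ : ModelWithCorners ℝ E₂ H₂}
  {M₂ : Type*} [TopologicalSpace M₂] [ChartedSpace H₂ M₂] [IsManifold I₂ ∞ M₂]

/-- Two projections which exhibit `N` as a product. -/
structure Leg.IsComplement (l₁ : Leg I N I₁ M₁) (l₂ : Leg I N I₂ M₂) : Prop where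
  ret_emb : ∀ a, l₁.ret (l₂.emb a) = 0
  ret_emb' : ∀ a, l₂.ret (l₁.emb a) = 0
  sum : ∀ a, l₁.emb (l₁.ret a) + l₂.emb (l₂.ret a) = a
  surjective : Function.Surjective l₁.proj
  surjective' : Function.Surjective l₂.proj

namespace Leg.IsComplement

variable {l₁ : Leg I N I₁ M₁} {l₂ : Leg I N I₂ M₂} (h : l₁.IsComplement l₂)

include h

theorem symm : l₂.IsComplement l₁ :=
  ⟨h.ret_emb', h.ret_emb, fun a => (add_comm _ _).trans (h.sum a), h.surjective', h.surjective⟩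

theorem out_inc (q : N) (x : GT I₂ (l₂.proj q)) : l₁.out q (l₂.inc q x) = 0 :=
  GT_ext I₁ (h.ret_emb _) fun u =>
    (congrArg (val I₂ (l₂.proj q) x).2 (h.ret_emb' u)).trans (map_zero _)

theorem inc_out_add (q : N) (x : GT I q) :
    l₁.inc q (l₁.out q x) + l₂.inc q (l₂.out q x) = x :=
  GT_ext I (h.sum _) fun u =>
    (map_add (val I q x).2 _ _).symm.trans (congrArg (val I q x).2 (h.sum u))

theorem pairing_inc_inc (q : N) (x : GT I₁ (l₁.proj q)) (y : GT I₂ (l₂.proj q)) :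
    pairing I q (l₁.inc q x) (l₂.inc q y) = 0 := by
  rw [l₁.pairing_inc_left, h.out_inc, pairing_zero_right]

/-- Every term of the coordinate formula either differentiates a pull-back along the other factor or
pairs a form from one factor with a vector from the other; both contain a composite `ret ∘ emb` of
different legs, which is zero. -/
theorem dorfman_pull [I.Boundaryless] [I₁.Boundaryless] [I₂.Boundaryless] [CompleteSpace E]
    {x : ∀ p : M₁, GT I₁ p} {y : ∀ p : M₂, GT I₂ p}
    (hx : IsSmooth I₁ x) (hy : IsSmooth I₂ y) (q : N) :
    dorfman I (l₁.pull x) (l₂.pull y) q = 0 := by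
  have hx' := l₁.isSmooth_pull hx
  have hy' := l₂.isSmooth_pull hy
  have e : val I q (l₁.pull x q) =
    modelInc l₁.emb l₁.ret (val I₁ (l₁.proj q) (x (l₁.proj q))) := rfl
  have e' : val I q (l₂.pull y q) =
    modelInc l₂.emb l₂.ret (val I₂ (l₂.proj q) (y (l₂.proj q))) := rfl
  refine GT_ext I ?_ fun u => ?_
  · rw [dorfman_fst (hx'.at q) (hy'.at q), l₁.jet_pull (hx.at _), l₂.jet_pull (hy.at _), e, e']
    simp only [modelInc_fst, h.ret_emb, h.ret_emb', map_zero, Prod.fst_zero, sub_zero]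
  · rw [dorfman_snd (hx'.at q) (hy'.at q), l₁.jet_pull (hx.at _), l₂.jet_pull (hy.at _),
      l₁.jet_pull (hx.at _), e, e']
    simp [modelInc_fst, modelInc_snd, h.ret_emb, h.ret_emb']

end Leg.IsComplement

end Pair

/-! ### The two factors of a product manifold. -/

section Product

variable {E₁ : Type*} [NormedAddCommGroup E₁] [NormedSpace ℝ E₁]
  {H₁ : Type*} [TopologicalSpace H₁] (I₁ : ModelWithCorners ℝ E₁ H₁)
  {M₁ : Type*} [TopologicalSpace M₁] [ChartedSpace H₁ M₁] [IsManifold I₁ ∞ M₁]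
  {E₂ : Type*} [NormedAddCommGroup E₂] [NormedSpace ℝ E₂]
  {H₂ : Type*} [TopologicalSpace H₂] (I₂ : ModelWithCorners ℝ E₂ H₂)
  {M₂ : Type*} [TopologicalSpace M₂] [ChartedSpace H₂ M₂] [IsManifold I₂ ∞ M₂]

theorem mem_source_of_mem_baseSet_prod {p q : M₁ × M₂}
    (hq : q ∈ (trivializationAt (E₁ × E₂) (TangentSpace (I₁.prod I₂) : M₁ × M₂ → Type _)
      p).baseSet) :
    q.1 ∈ (chartAt H₁ p.1).source ∧ q.2 ∈ (chartAt H₂ p.2).source := by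
  have : q ∈ (chartAt (ModelProd H₁ H₂) p).source := hq
  rw [prodChartedSpace_chartAt] at this
  exact this

/-- Each component of the product chart is a chart of a factor composed with a projection;
differentiating in the two ways and using uniqueness of the derivative compares the trivializations.
-/
theorem continuousLinearMapAt_prod {p q : M₁ × M₂}
    (hq : q ∈ (trivializationAt (E₁ × E₂) (TangentSpace (I₁.prod I₂) : M₁ × M₂ → Type _)
      p).baseSet) (w : E₁ × E₂) :
    ((trivializationAt (E₁ × E₂) (TangentSpace (I₁.prod I₂) : M₁ × M₂ → Type _)
      p).continuousLinearMapAt ℝ q w : E₁ × E₂) =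
    ((trivializationAt E₁ (TangentSpace I₁ : M₁ → Type _) p.1).continuousLinearMapAt ℝ q.1 w.1,
     (trivializationAt E₂ (TangentSpace I₂ : M₂ → Type _) p.2).continuousLinearMapAt ℝ q.2 w.2) := by
  obtain ⟨h1, h2⟩ := mem_source_of_mem_baseSet_prod I₁ I₂ hq
  have h0 : q ∈ (chartAt (ModelProd H₁ H₂) p).source := hq
  rw [TangentBundle.continuousLinearMapAt_trivializationAt h0,
    TangentBundle.continuousLinearMapAt_trivializationAt h1,
    TangentBundle.continuousLinearMapAt_trivializationAt h2]
  have d := mdifferentiableAt_extChartAt (I := I₁.prod I₂) h0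
  have d1 := mdifferentiableAt_extChartAt (I := I₁) h1
  have d2 := mdifferentiableAt_extChartAt (I := I₂) h2
  have a1 := (ContinuousLinearMap.fst ℝ E₁ E₂).hasMFDerivAt.comp q d.hasMFDerivAt
  have a2 := (ContinuousLinearMap.snd ℝ E₁ E₂).hasMFDerivAt.comp q d.hasMFDerivAt
  have b1 := d1.hasMFDerivAt.comp q (hasMFDerivAt_fst (I := I₁) (I' := I₂) q)
  have b2 := d2.hasMFDerivAt.comp q (hasMFDerivAt_snd (I := I₁) (I' := I₂) q)
  have f1 : (ContinuousLinearMap.fst ℝ E₁ E₂) ∘ (extChartAt (I₁.prod I₂) p) =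
    (extChartAt I₁ p.1) ∘ Prod.fst := by rw [extChartAt_prod]; rfl
  have f2 : (ContinuousLinearMap.snd ℝ E₁ E₂) ∘ (extChartAt (I₁.prod I₂) p) =
    (extChartAt I₂ p.2) ∘ Prod.snd := by rw [extChartAt_prod]; rfl
  rw [f1] at a1
  rw [f2] at a2
  refine Prod.ext ?_ ?_
  · exact congrArg (fun f : E₁ × E₂ →L[ℝ] E₁ => f w) (hasMFDerivAt_unique a1 b1)
  · exact congrArg (fun f : E₁ × E₂ →L[ℝ] E₂ => f w) (hasMFDerivAt_unique a2 b2)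

variable (M₁ M₂)

/-- The first projection of a product. -/
noncomputable def fstLeg : Leg (I₁.prod I₂) (M₁ × M₂) I₁ M₁ where
  proj := Prod.fst
  emb := ContinuousLinearMap.inl ℝ E₁ E₂
  ret := ContinuousLinearMap.fst ℝ E₁ E₂
  smooth := contMDiff_fst
  ret_emb _ := rfl
  mem_baseSet _ _ hq := (mem_source_of_mem_baseSet_prod I₁ I₂ hq).1
  proj_extChartAt_symm p z := by rw [extChartAt_prod]; rfl
  extChartAt_proj p := by rw [extChartAt_prod]; rfl
  coord_ret p q hq w := congrArg Prod.fst (continuousLinearMapAt_prod I₁ I₂ hq w)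
  coord_emb p q hq w := (continuousLinearMapAt_prod I₁ I₂ hq (w, 0)).trans
    (Prod.ext rfl (map_zero _))

/-- The second projection of a product. -/
noncomputable def sndLeg : Leg (I₁.prod I₂) (M₁ × M₂) I₂ M₂ where
  proj := Prod.snd
  emb := ContinuousLinearMap.inr ℝ E₁ E₂
  ret := ContinuousLinearMap.snd ℝ E₁ E₂
  smooth := contMDiff_snd
  ret_emb _ := rfl
  mem_baseSet _ _ hq := (mem_source_of_mem_baseSet_prod I₁ I₂ hq).2
  proj_extChartAt_symm p z := by rw [extChartAt_prod]; rfl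
  extChartAt_proj p := by rw [extChartAt_prod]; rfl
  coord_ret p q hq w := congrArg Prod.snd (continuousLinearMapAt_prod I₁ I₂ hq w)
  coord_emb p q hq w := (continuousLinearMapAt_prod I₁ I₂ hq (0, w)).trans
    (Prod.ext (map_zero _) rfl)

theorem fstLeg_isComplement [Nonempty M₁] [Nonempty M₂] :
    (fstLeg I₁ M₁ I₂ M₂).IsComplement (sndLeg I₁ M₁ I₂ M₂) where
  ret_emb _ := rfl
  ret_emb' _ := rfl
  sum _ := Prod.ext (add_zero _) (zero_add _)
  surjective := Prod.fst_surjective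
  surjective' := Prod.snd_surjective

variable {M₁ M₂}

/-- This and the next three results connect the legs with the maps in the definition of the Morimoto
product: slice inclusions and projections have the linear inclusions and projections as derivatives.
-/
theorem fstLeg_inc (q : M₁ × M₂) : (fstLeg I₁ M₁ I₂ M₂).inc q = inFst I₁ I₂ q := by
  refine LinearMap.ext fun x => GT_ext _ ?_ fun u => ?_
  · exact congrArg (fun f : E₁ →L[ℝ] E₁ × E₂ => f (val I₁ q.1 x).1)
      (mfderiv_prod_left (I := I₁) (I' := I₂) (x₀ := q.1) (y₀ := q.2)).symm
  · exact congrArg (fun f : E₁ × E₂ →L[ℝ] E₁ => (val I₁ q.1 x).2 (f u))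
      (mfderiv_fst (I := I₁) (I' := I₂) (x := q)).symm

theorem sndLeg_inc (q : M₁ × M₂) : (sndLeg I₁ M₁ I₂ M₂).inc q = inSnd I₁ I₂ q := by
  refine LinearMap.ext fun x => GT_ext _ ?_ fun u => ?_
  · exact congrArg (fun f : E₂ →L[ℝ] E₁ × E₂ => f (val I₂ q.2 x).1)
      (mfderiv_prod_right (I := I₁) (I' := I₂) (x₀ := q.1) (y₀ := q.2)).symm
  · exact congrArg (fun f : E₁ × E₂ →L[ℝ] E₂ => (val I₂ q.2 x).2 (f u))
      (mfderiv_snd (I := I₁) (I' := I₂) (x := q)).symm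

theorem fstLeg_out (q : M₁ × M₂) : (fstLeg I₁ M₁ I₂ M₂).out q = outFst I₁ I₂ q := by
  refine LinearMap.ext fun x => GT_ext _ ?_ fun u => ?_
  · exact congrArg (fun f : E₁ × E₂ →L[ℝ] E₁ => f (val (I₁.prod I₂) q x).1)
      (mfderiv_fst (I := I₁) (I' := I₂) (x := q)).symm
  · exact congrArg (fun f : E₁ →L[ℝ] E₁ × E₂ => (val (I₁.prod I₂) q x).2 (f u))
      (mfderiv_prod_left (I := I₁) (I' := I₂) (x₀ := q.1) (y₀ := q.2)).symm

theorem sndLeg_out (q : M₁ × M₂) : (sndLeg I₁ M₁ I₂ M₂).out q = outSnd I₁ I₂ q := by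
  refine LinearMap.ext fun x => GT_ext _ ?_ fun u => ?_
  · exact congrArg (fun f : E₁ × E₂ →L[ℝ] E₂ => f (val (I₁.prod I₂) q x).1)
      (mfderiv_snd (I := I₁) (I' := I₂) (x := q)).symm
  · exact congrArg (fun f : E₂ →L[ℝ] E₁ × E₂ => (val (I₁.prod I₂) q x).2 (f u))
      (mfderiv_prod_right (I := I₁) (I' := I₂) (x₀ := q.1) (y₀ := q.2)).symm

theorem pullSecFst_eq (x : ∀ p : M₁, GT I₁ p) :
    pullSecFst I₁ I₂ x = (fstLeg I₁ M₁ I₂ M₂).pull x :=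
  funext fun q => (congrArg (fun f : GT I₁ q.1 →ₗ[ℝ] GT (I₁.prod I₂) q => f (x q.1))
    (fstLeg_inc I₁ I₂ q)).symm

theorem pullSecSnd_eq (x : ∀ p : M₂, GT I₂ p) :
    pullSecSnd I₁ I₂ x = (sndLeg I₁ M₁ I₂ M₂).pull x :=
  funext fun q => (congrArg (fun f : GT I₂ q.2 →ₗ[ℝ] GT (I₁.prod I₂) q => f (x q.2))
    (sndLeg_inc I₁ I₂ q)).symm

end Product

end GenGeom

/-! ### Pull-back of complex sections and local generation. -/

namespace GenGeom

section Leg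

variable {E : Type*} [NormedAddCommGroup E] [NormedSpace ℝ E]
  {H : Type*} [TopologicalSpace H] {I : ModelWithCorners ℝ E H}
  {N : Type*} [TopologicalSpace N] [ChartedSpace H N] [IsManifold I ∞ N]
  {E₁ : Type*} [NormedAddCommGroup E₁] [NormedSpace ℝ E₁]
  {H₁ : Type*} [TopologicalSpace H₁] {I₁ : ModelWithCorners ℝ E₁ H₁}
  {M₁ : Type*} [TopologicalSpace M₁] [ChartedSpace H₁ M₁] [IsManifold I₁ ∞ M₁]

/-- Complex-linear extension of a real linear map. -/
def cMap {V W : Type*} [AddCommGroup V] [Module ℝ V] [AddCommGroup W] [Module ℝ W]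
    (f : V →ₗ[ℝ] W) : Cx V →ₗ[ℂ] Cx W where
  toFun z := Cx.mk (f z.re) (f z.im)
  map_add' z w := by ext <;> simp
  map_smul' c z := by ext <;> simp

theorem re_cMap {V W : Type*} [AddCommGroup V] [Module ℝ V] [AddCommGroup W] [Module ℝ W]
    (f : V →ₗ[ℝ] W) (z : Cx V) : (cMap f z).re = f z.re := rfl

theorem im_cMap {V W : Type*} [AddCommGroup V] [Module ℝ V] [AddCommGroup W] [Module ℝ W]
    (f : V →ₗ[ℝ] W) (z : Cx V) : (cMap f z).im = f z.im := rfl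

namespace Leg

variable (l : Leg I N I₁ M₁)

/-- The pull-back of a complex section. -/
noncomputable def cPull (z : ∀ p : M₁, Cx (GT I₁ p)) (q : N) : Cx (GT I q) :=
  cMap (l.inc q) (z (l.proj q))

theorem isCSmooth_cPull {z : ∀ p : M₁, Cx (GT I₁ p)} (hz : IsCSmooth z) : IsCSmooth (l.cPull z) :=
  ⟨l.isSmooth_pull hz.1, l.isSmooth_pull hz.2⟩

theorem cDorfman_cPull [I.Boundaryless] [I₁.Boundaryless] [CompleteSpace E] [CompleteSpace E₁]
    {z w : ∀ p : M₁, Cx (GT I₁ p)} (hz : IsCSmooth z) (hw : IsCSmooth w) (q : N) :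
    cDorfman I (l.cPull z) (l.cPull w) q = cMap (l.inc q) (cDorfman I₁ z w (l.proj q)) := by
  apply Cx.ext
  · exact (congrArg₂ (· - ·) (l.dorfman_pull hz.1 hw.1 q) (l.dorfman_pull hz.2 hw.2 q)).trans
      (map_sub (l.inc q) _ _).symm
  · exact (congrArg₂ (· + ·) (l.dorfman_pull hz.1 hw.2 q) (l.dorfman_pull hz.2 hw.1 q)).trans
      (map_add (l.inc q) _ _).symm

theorem cMap_out_inc (q : N) (x : Cx (GT I₁ (l.proj q))) :
    cMap (l.out q) (cMap (l.inc q) x) = x :=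
  Cx.ext (l.out_inc q _) (l.out_inc q _)

section Frame

variable [FiniteDimensional ℝ E₁] [T2Space M₁]

/-- The horizontal part of a section of `𝕋N` is a combination of pull-backs. -/
theorem exists_frame_out (q : N) : ∃ (ι : Type) (_ : Fintype ι) (s t : ι → ∀ p : M₁, GT I₁ p),
    (∀ i, IsSmooth I₁ (s i)) ∧ (∀ i, IsSmooth I₁ (t i)) ∧
    ∀ᶠ q' in nhds q, ∀ x : GT I q',
      l.out q' x = ∑ i, (2 * pairing I q' x (l.pull (t i) q')) • s i (l.proj q') := by
  obtain ⟨ι, hι, s, t, hs, ht, h⟩ := exists_frame (I := I₁) (l.proj q)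
  exact ⟨ι, hι, s, t, hs, ht, (l.smooth.continuous.continuousAt.eventually h).mono
    fun q' hq' x => hq' (l.out q' x)⟩

/-- Locally the component along the leg is a combination, with smooth coefficients on `N`, of
pulled-back frame sections, on which `A` acts downstairs. -/
theorem isSmooth_inc_out {A : ∀ p : M₁, GT I₁ p →ₗ[ℝ] GT I₁ p}
    (hA : ∀ x : ∀ p : M₁, GT I₁ p, IsSmooth I₁ x → IsSmooth I₁ (fun p => A p (x p)))
    {x : ∀ q : N, GT I q} (hx : IsSmooth I x) :
    IsSmooth I (fun q => l.inc q (A (l.proj q) (l.out q (x q)))) := by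
  refine IsSmooth.of_locally fun q => ?_
  obtain ⟨ι, hι, s, t, hs, ht, h⟩ := l.exists_frame_out q
  refine ⟨∑ i, fun q' => (2 * pairing I q' (x q') (l.pull (t i) q')) •
    l.pull (fun p => A p (s i p)) q', .sum _ fun i _ => (l.isSmooth_pull (hA _ (hs i))).smul
      (contMDiff_const_mul_pairing hx (l.isSmooth_pull (ht i)) 2), h.mono fun q' hq' => ?_⟩
  rw [hq' (x q'), map_sum, map_sum, Finset.sum_apply]
  refine Finset.sum_congr rfl fun i _ => ?_
  rw [map_smul, map_smul]
  rfl

/-- Expand the component in a frame of the base and project the frame sections to `L₁`. A component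
already in `L₁` is unchanged, so it becomes a combination of pulled-back sections of `L₁`. -/
theorem locGen_inc_out {F₁ : ∀ p : M₁, Submodule ℝ (GT I₁ p)}
    {Φ₁ : ∀ p : M₁, GT I₁ p →ₗ[ℝ] GT I₁ p} {e₁ e₂ : ∀ p : M₁, GT I₁ p}
    (h₁ : IsAdaptedFrame F₁ Φ₁ e₁ e₂) {z : ∀ q : N, Cx (GT I q)} (hz : IsCSmooth z)
    (hL : ∀ q, cMap (l.out q) (z q) ∈ eigenbundle I₁ Φ₁ (l.proj q)) (q : N) :
    LocGen (l.cPull '' cSections I₁ (eigenbundle I₁ Φ₁)) q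
      (fun q => cMap (l.inc q) (cMap (l.out q) (z q))) := by
  obtain ⟨ι, hι, s, t, hs, ht, h⟩ := l.exists_frame_out q
  have cube : ∀ p x, Φ₁ p (Φ₁ p (Φ₁ p x)) = -Φ₁ p x := fun p x => by
    rw [h₁.square p x, map_neg, map_sub, h₁.apply_planeProj, sub_zero]
  -- Since `Φ₁³ = -Φ₁`, the operator `-Φ₁² - √-1 Φ₁` is twice the projection onto the
  -- `√-1`-eigenspace. The coefficients `c` below omit the factor `2` of the frame expansion to
  -- compensate.
  let w : ι → ∀ p : M₁, Cx (GT I₁ p) := fun i p =>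
    Cx.mk (-Φ₁ p (Φ₁ p (s i p))) (-Φ₁ p (s i p))
  have hw : ∀ i, w i ∈ cSections I₁ (eigenbundle I₁ Φ₁) := fun i => by
    refine ⟨(h₁.smooth _ (h₁.smooth _ (hs i))).neg, (h₁.smooth _ (hs i)).neg, fun p => ?_⟩
    rw [mem_eigenbundle]
    simp [w, cube]
  let c : ι → N → ℂ := fun i q' => ⟨pairing I q' (z q').re (l.pull (t i) q'),
    pairing I q' (z q').im (l.pull (t i) q')⟩
  have hg : LocGen (l.cPull '' cSections I₁ (eigenbundle I₁ Φ₁)) q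
      (∑ i, fun q' => c i q' • l.cPull (w i) q') :=
    LocGen.sum _ fun i _ => LocGen.csmul (contMDiff_pairing hz.1 (l.isSmooth_pull (ht i)))
      (contMDiff_pairing hz.2 (l.isSmooth_pull (ht i))) (.base ⟨_, hw i, rfl⟩)
  refine hg.congr ⟨l.isSmooth_inc_out (A := fun _ => LinearMap.id) (fun x hx => hx) hz.1,
    l.isSmooth_inc_out (A := fun _ => LinearMap.id) (fun x hx => hx) hz.2⟩ (h.mono fun q' hq' => ?_)
  have key : cMap (l.out q') (z q') = ∑ i, c i q' • w i (l.proj q') := by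
    obtain ⟨a, b⟩ := mem_eigenbundle.1 (hL q')
    simp only [re_cMap, im_cMap] at a b
    have a' := congrArg (Φ₁ (l.proj q')) a
    have b' := congrArg (Φ₁ (l.proj q')) b
    rw [map_neg, b] at a'
    rw [a] at b'
    have reS : ∀ f : ι → Cx (GT I₁ (l.proj q')), (∑ i, f i).re = ∑ i, (f i).re := fun f =>
      map_sum (⟨⟨Cx.re, rfl⟩, fun _ _ => rfl⟩ : Cx (GT I₁ (l.proj q')) →+ _) f _
    have imS : ∀ f : ι → Cx (GT I₁ (l.proj q')), (∑ i, f i).im = ∑ i, (f i).im := fun f =>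
      map_sum (⟨⟨Cx.im, rfl⟩, fun _ _ => rfl⟩ : Cx (GT I₁ (l.proj q')) →+ _) f _
    have p1 : ∀ x, Φ₁ (l.proj q') (l.out q' x) =
        ∑ i, (2 * pairing I q' x (l.pull (t i) q')) • Φ₁ (l.proj q') (s i (l.proj q')) :=
      fun x => by
        rw [hq' x, map_sum]
        exact Finset.sum_congr rfl fun i _ => map_smul _ _ _
    have p2 : ∀ x, Φ₁ (l.proj q') (Φ₁ (l.proj q') (l.out q' x)) =
        ∑ i, (2 * pairing I q' x (l.pull (t i) q')) •
          Φ₁ (l.proj q') (Φ₁ (l.proj q') (s i (l.proj q'))) := fun x => by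
        rw [p1 x, map_sum]
        exact Finset.sum_congr rfl fun i _ => map_smul _ _ _
    have h2 : ∀ x y : GT I₁ (l.proj q'), (2 : ℝ) • x = (2 : ℝ) • y → x = y := fun x y h =>
      smul_right_injective _ (two_ne_zero (α := ℝ)) h
    apply Cx.ext
    · apply h2
      rw [reS, re_cMap]
      -- Real part of the statement that the doubled projection acts as `2` on the eigenbundle; in
      -- this form the frame expansions `p1` and `p2` apply.
      have e : (2 : ℝ) • l.out q' (z q').re =
          Φ₁ (l.proj q') (l.out q' (z q').im) -
            Φ₁ (l.proj q') (Φ₁ (l.proj q') (l.out q' (z q').re)) := by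
        rw [a, b, map_neg, b]
        module
      rw [e, p1, p2, ← Finset.sum_sub_distrib, Finset.smul_sum]
      refine Finset.sum_congr rfl fun i _ => ?_
      simp only [Cx.re_smul, c, w, Cx.re_mk, Cx.im_mk]
      module
    · apply h2
      rw [imS, im_cMap]
      have e : (2 : ℝ) • l.out q' (z q').im =
          -Φ₁ (l.proj q') (l.out q' (z q').re) -
            Φ₁ (l.proj q') (Φ₁ (l.proj q') (l.out q' (z q').im)) := by
        rw [b, a]
        module
      rw [e, p1, p2, ← Finset.sum_neg_distrib, ← Finset.sum_sub_distrib, Finset.smul_sum]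
      refine Finset.sum_congr rfl fun i _ => ?_
      simp only [Cx.im_smul, c, w, Cx.re_mk, Cx.im_mk]
      module
  rw [key, map_sum, Finset.sum_apply]
  exact Finset.sum_congr rfl fun i _ => map_smul _ _ _

end Frame

end Leg

end Leg

/-! ### The product endomorphism and linked factors. -/

section Pair

variable {E : Type*} [NormedAddCommGroup E] [NormedSpace ℝ E]
  {H : Type*} [TopologicalSpace H] {I : ModelWithCorners ℝ E H}
  {N : Type*} [TopologicalSpace N] [ChartedSpace H N] [IsManifold I ∞ N]
  {E₁ : Type*} [NormedAddCommGroup E₁] [NormedSpace ℝ E₁]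
  {H₁ : Type*} [TopologicalSpace H₁] {I₁ : ModelWithCorners ℝ E₁ H₁}
  {M₁ : Type*} [TopologicalSpace M₁] [ChartedSpace H₁ M₁] [IsManifold I₁ ∞ M₁]
  {E₂ : Type*} [NormedAddCommGroup E₂] [NormedSpace ℝ E₂]
  {H₂ : Type*} [TopologicalSpace H₂] {I₂ : ModelWithCorners ℝ E₂ H₂}
  {M₂ : Type*} [TopologicalSpace M₂] [ChartedSpace H₂ M₂] [IsManifold I₂ ∞ M₂]
  {l₁ : Leg I N I₁ M₁} {l₂ : Leg I N I₂ M₂}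

namespace Leg.IsComplement

theorem cDorfman_cPull [I.Boundaryless] [I₁.Boundaryless] [I₂.Boundaryless] [CompleteSpace E]
    (h : l₁.IsComplement l₂) {z : ∀ p : M₁, Cx (GT I₁ p)} {w : ∀ p : M₂, Cx (GT I₂ p)}
    (hz : IsCSmooth z) (hw : IsCSmooth w) (q : N) :
    cDorfman I (l₁.cPull z) (l₂.cPull w) q = 0 := by
  apply Cx.ext
  · exact (congrArg₂ (· - ·) (h.dorfman_pull hz.1 hw.1 q) (h.dorfman_pull hz.2 hw.2 q)).trans
      (sub_zero _)
  · exact (congrArg₂ (· + ·) (h.dorfman_pull hz.1 hw.2 q) (h.dorfman_pull hz.2 hw.1 q)).trans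
      (add_zero _)

theorem cMap_out_inc (h : l₁.IsComplement l₂) (q : N) (x : Cx (GT I₂ (l₂.proj q))) :
    cMap (l₁.out q) (cMap (l₂.inc q) x) = 0 :=
  Cx.ext (h.out_inc q _) (h.out_inc q _)

theorem cMap_inc_out_add (h : l₁.IsComplement l₂) (q : N) (x : Cx (GT I q)) :
    cMap (l₁.inc q) (cMap (l₁.out q) x) + cMap (l₂.inc q) (cMap (l₂.out q) x) = x :=
  Cx.ext (h.inc_out_add q _) (h.inc_out_add q _)

end Leg.IsComplement

/-- The sum `π₁^* Φ₁ ⊕ π₂^* Φ₂ ⊕ Ψ`. -/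
noncomputable def legProduct (l₁ : Leg I N I₁ M₁) (l₂ : Leg I N I₂ M₂)
    (Φ₁ : ∀ p : M₁, GT I₁ p →ₗ[ℝ] GT I₁ p) (Φ₂ : ∀ p : M₂, GT I₂ p →ₗ[ℝ] GT I₂ p)
    (Ψ : ∀ q : N, GT I q →ₗ[ℝ] GT I q) : ∀ q : N, GT I q →ₗ[ℝ] GT I q :=
  fun q => l₁.inc q ∘ₗ Φ₁ (l₁.proj q) ∘ₗ l₁.out q + l₂.inc q ∘ₗ Φ₂ (l₂.proj q) ∘ₗ l₂.out q + Ψ q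

theorem legProduct_apply (l₁ : Leg I N I₁ M₁) (l₂ : Leg I N I₂ M₂)
    (Φ₁ : ∀ p : M₁, GT I₁ p →ₗ[ℝ] GT I₁ p) (Φ₂ : ∀ p : M₂, GT I₂ p →ₗ[ℝ] GT I₂ p)
    (Ψ : ∀ q : N, GT I q →ₗ[ℝ] GT I q) (q : N) (x : GT I q) :
    legProduct l₁ l₂ Φ₁ Φ₂ Ψ q x = l₁.inc q (Φ₁ (l₁.proj q) (l₁.out q x)) +
      l₂.inc q (Φ₂ (l₂.proj q) (l₂.out q x)) + Ψ q x := rfl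

theorem legProduct_swap (l₁ : Leg I N I₁ M₁) (l₂ : Leg I N I₂ M₂)
    (Φ₁ : ∀ p : M₁, GT I₁ p →ₗ[ℝ] GT I₁ p) (Φ₂ : ∀ p : M₂, GT I₂ p →ₗ[ℝ] GT I₂ p)
    (Ψ : ∀ q : N, GT I q →ₗ[ℝ] GT I q) :
    legProduct l₂ l₁ Φ₂ Φ₁ Ψ = legProduct l₁ l₂ Φ₁ Φ₂ Ψ :=
  funext fun q => congrArg (· + Ψ q) (add_comm _ _)

/-- Two factors with adapted frames, and an endomorphism `Ψ` of the sum of the two plane bundles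
whose eigenbundle is the graph of a correspondence between the two framings. -/
structure IsLinked (l₁ : Leg I N I₁ M₁) (l₂ : Leg I N I₂ M₂)
    (F₁ : ∀ p : M₁, Submodule ℝ (GT I₁ p)) (F₂ : ∀ p : M₂, Submodule ℝ (GT I₂ p))
    (Φ₁ : ∀ p : M₁, GT I₁ p →ₗ[ℝ] GT I₁ p) (Φ₂ : ∀ p : M₂, GT I₂ p →ₗ[ℝ] GT I₂ p)
    (e₁ e₂ : ∀ p : M₁, GT I₁ p) (f₁ f₂ : ∀ p : M₂, GT I₂ p)
    (Ψ : ∀ q : N, GT I q →ₗ[ℝ] GT I q) : Prop where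
  complement : l₁.IsComplement l₂
  frame₁ : IsAdaptedFrame F₁ Φ₁ e₁ e₂
  frame₂ : IsAdaptedFrame F₂ Φ₂ f₁ f₂
  sgf : IsSGF I (fun q => (F₁ (l₁.proj q)).map (l₁.inc q) ⊔ (F₂ (l₂.proj q)).map (l₂.inc q)) Ψ
  left : ∀ v ∈ framingCx I₁ (Submodule.span ℝ {e₁, e₂}),
    ∃ w ∈ framingCx I₂ (Submodule.span ℝ {f₁, f₂}),
      ∀ q, l₁.cPull v q + l₂.cPull w q ∈ eigenbundle I Ψ q
  right : ∀ w ∈ framingCx I₂ (Submodule.span ℝ {f₁, f₂}),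
    ∃ v ∈ framingCx I₁ (Submodule.span ℝ {e₁, e₂}),
      ∀ q, l₁.cPull v q + l₂.cPull w q ∈ eigenbundle I Ψ q

end Pair
end GenGeom

/-! ### Brackets of complexified framings. -/

namespace GenGeom

section Framing

variable {E : Type*} [NormedAddCommGroup E] [NormedSpace ℝ E]
  {H : Type*} [TopologicalSpace H] {I : ModelWithCorners ℝ E H}
  {M : Type*} [TopologicalSpace M] [ChartedSpace H M] [IsManifold I ∞ M]
  {F' : ∀ p : M, Submodule ℝ (GT I p)}
  {Φ : ∀ p : M, GT I p →ₗ[ℝ] GT I p} {e₁ e₂ : ∀ p : M, GT I p}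

omit [IsManifold I ∞ M] in
theorem cPairing_add_right (p : M) (x y z : Cx (GT I p)) :
    cPairing p x (y + z) = cPairing p x y + cPairing p x z := by
  apply Complex.ext <;> simp [cPairing] <;> ring

omit [IsManifold I ∞ M] in
theorem cPairing_smul_right (p : M) (c : ℂ) (x y : Cx (GT I p)) :
    cPairing p x (c • y) = c * cPairing p x y := by
  apply Complex.ext <;> simp [cPairing] <;> ring

omit [IsManifold I ∞ M] in
theorem cPairing_add_left (p : M) (x y z : Cx (GT I p)) :
    cPairing p (x + y) z = cPairing p x z + cPairing p y z := by
  rw [cPairing_comm, cPairing_add_right, cPairing_comm p z, cPairing_comm p z]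

omit [IsManifold I ∞ M] in
theorem cPairing_smul_left (p : M) (c : ℂ) (x y : Cx (GT I p)) :
    cPairing p (c • x) y = c * cPairing p x y := by
  rw [cPairing_comm, cPairing_smul_right, cPairing_comm]

omit [IsManifold I ∞ M] in
theorem cPairing_toCx (p : M) (z : Cx (GT I p)) (e : ∀ p : M, GT I p) :
    cPairing p z (toCx I e p) = ⟨pairing I p z.re (e p), pairing I p z.im (e p)⟩ := by
  apply Complex.ext <;> simp [cPairing, toCx]

omit [IsManifold I ∞ M] in
theorem exists_eq_of_mem_framingCx {v : ∀ p : M, Cx (GT I p)}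
    (hv : v ∈ framingCx I (Submodule.span ℝ {e₁, e₂})) :
    ∃ a b : ℂ, ∀ p, v p = a • toCx I e₁ p + b • toCx I e₂ p := by
  obtain ⟨a, b, h⟩ := Submodule.mem_span_pair.1 hv.1
  obtain ⟨c, d, h'⟩ := Submodule.mem_span_pair.1 hv.2
  refine ⟨⟨a, c⟩, ⟨b, d⟩, fun p => Cx.ext ?_ ?_⟩
  · refine (congrFun h p).symm.trans ?_
    simp [toCx]
  · refine (congrFun h' p).symm.trans ?_
    simp [toCx]

omit [IsManifold I ∞ M] in
theorem toCx_mem_framingCx {V : Submodule ℝ (∀ p : M, GT I p)} {e : ∀ p : M, GT I p}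
    (he : e ∈ V) : toCx I e ∈ framingCx I V :=
  ⟨he, V.zero_mem⟩

namespace IsAdaptedFrame

variable (h : IsAdaptedFrame F' Φ e₁ e₂)
include h

theorem cPairing_eq_zero_of_mem {p : M} {z : Cx (GT I p)} (hz : z ∈ eigenbundle I Φ p) :
    cPairing p z (toCx I e₁ p) = 0 := by
  obtain ⟨a, b⟩ := h.pairing_eq_zero_of_mem hz
  rw [cPairing_toCx, a, b]
  rfl

theorem cPairing_toCx_self (p : M) : cPairing p (toCx I e₁ p) (toCx I e₁ p) = 0 := by
  rw [cPairing_toCx]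
  apply Complex.ext <;> simp [toCx, h.isotropic₁]

theorem cPairing_toCx_dual (p : M) : cPairing p (toCx I e₁ p) (toCx I e₂ p) = 1 / 2 := by
  rw [cPairing_toCx]
  apply Complex.ext <;> simp [toCx, h.dual]

theorem isSmooth_of_mem_span {x : ∀ p : M, GT I p} (hx : x ∈ Submodule.span ℝ {e₁, e₂}) :
    IsSmooth I x := by
  obtain ⟨a, b, rfl⟩ := Submodule.mem_span_pair.1 hx
  exact (h.smooth₁.const_smul a).add (h.smooth₂.const_smul b)

theorem isCSmooth_of_mem_framingCx {v : ∀ p : M, Cx (GT I p)}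
    (hv : v ∈ framingCx I (Submodule.span ℝ {e₁, e₂})) : IsCSmooth v :=
  ⟨h.isSmooth_of_mem_span hv.1, h.isSmooth_of_mem_span hv.2⟩

variable [I.Boundaryless] [FiniteDimensional ℝ E] (hn₁ : Normalizes I (toCx I e₁) (eigenbundle I Φ))
  (hn₂ : Normalizes I (toCx I e₂) (eigenbundle I Φ))
include hn₁ hn₂

theorem cDorfman_framing_left {v w : ∀ p : M, Cx (GT I p)}
    (hv : v ∈ framingCx I (Submodule.span ℝ {e₁, e₂})) (hw : w ∈ cSections I (eigenbundle I Φ))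
    (p : M) : cDorfman I v w p ∈ eigenbundle I Φ p := by
  have key : ∀ x ∈ Submodule.span ℝ {e₁, e₂}, cDorfman I (toCx I x) w p ∈ eigenbundle I Φ p := by
    intro x hx
    obtain ⟨a, b, rfl⟩ := Submodule.mem_span_pair.1 hx
    exact normalizes_combination h.smooth₁ h.smooth₂ a b hn₁ hn₂ w hw p
  have e : v = toCx I (fun p => (v p).re) +
      fun p => Complex.I • toCx I (fun p => (v p).im) p := by
    funext p
    change v p = toCx I (fun p => (v p).re) p + Complex.I • toCx I (fun p => (v p).im) p
    apply Cx.ext <;> simp [toCx]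
  have s1 : IsCSmooth (toCx I fun p => (v p).re) := .toCx (h.isSmooth_of_mem_span hv.1)
  have s2 : IsCSmooth (toCx I fun p => (v p).im) := .toCx (h.isSmooth_of_mem_span hv.2)
  rw [e, cDorfman_add_left s1 s2.I_smul ⟨hw.1, hw.2.1⟩,
    cDorfman_I_smul_left s2 ⟨hw.1, hw.2.1⟩]
  exact (eigenSubmodule Φ p).add_mem (key _ hv.1) ((eigenSubmodule Φ p).smul_mem _ (key _ hv.2))

theorem cDorfman_framing_right {v w : ∀ p : M, Cx (GT I p)}
    (hv : v ∈ framingCx I (Submodule.span ℝ {e₁, e₂})) (hw : w ∈ cSections I (eigenbundle I Φ))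
    (p : M) : cDorfman I w v p ∈ eigenbundle I Φ p := by
  rw [cDorfman_swap_of_eq_zero ⟨hw.1, hw.2.1⟩ (h.isCSmooth_of_mem_framingCx hv) fun q => ?_]
  · exact (eigenSubmodule Φ p).neg_mem (h.cDorfman_framing_left hn₁ hn₂ hv hw p)
  · obtain ⟨a, b, hab⟩ := exists_eq_of_mem_framingCx hv
    rw [hab, cPairing_add_right, cPairing_smul_right, cPairing_smul_right,
      h.cPairing_eq_zero_of_mem (hw.2.2 q), h.symm.cPairing_eq_zero_of_mem (hw.2.2 q)]
    simp

/-- By bilinearity over constants only the four brackets of `e₁` and `e₂` occur; they vanish by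
isotropy and by `dorfman_eq_zero`. -/
theorem cDorfman_framing_framing [T2Space M] {v w : ∀ p : M, Cx (GT I p)}
    (hv : v ∈ framingCx I (Submodule.span ℝ {e₁, e₂}))
    (hw : w ∈ framingCx I (Submodule.span ℝ {e₁, e₂})) (p : M) : cDorfman I v w p = 0 := by
  have h11 := dorfman_self_eq_zero h.smooth₁ h.isotropic₁ p
  have h22 := dorfman_self_eq_zero h.smooth₂ h.isotropic₂ p
  have h12 := h.dorfman_eq_zero hn₁ p
  have h21 := h.symm.dorfman_eq_zero hn₂ p
  have key : ∀ x ∈ Submodule.span ℝ {e₁, e₂}, ∀ y ∈ Submodule.span ℝ {e₁, e₂},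
      dorfman I x y p = 0 := by
    intro x hx y hy
    have hxs := h.isSmooth_of_mem_span hx
    have hl : ∀ e : ∀ p : M, GT I p, IsSmooth I e → dorfman I e₁ e p = 0 →
        dorfman I e₂ e p = 0 → dorfman I x e p = 0 := by
      intro e he h1 h2
      obtain ⟨a, b, rfl⟩ := Submodule.mem_span_pair.1 hx
      rw [dorfman_add_left ((h.smooth₁.const_smul a).at p) ((h.smooth₂.const_smul b).at p)
        (he.at p), dorfman_const_smul_left a h.smooth₁ he, dorfman_const_smul_left b h.smooth₂ he,
        h1, h2, smul_zero, smul_zero, add_zero]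
    obtain ⟨a, b, rfl⟩ := Submodule.mem_span_pair.1 hy
    rw [dorfman_add_right (hxs.at p) ((h.smooth₁.const_smul a).at p)
      ((h.smooth₂.const_smul b).at p), dorfman_const_smul_right a hxs h.smooth₁,
      dorfman_const_smul_right b hxs h.smooth₂, hl _ h.smooth₁ h11 h21, hl _ h.smooth₂ h12 h22,
      smul_zero, smul_zero, add_zero]
  apply Cx.ext
  · exact (congrArg₂ (· - ·) (key _ hv.1 _ hw.1) (key _ hv.2 _ hw.2)).trans (sub_zero _)
  · exact (congrArg₂ (· + ·) (key _ hv.1 _ hw.2) (key _ hv.2 _ hw.1)).trans (add_zero _)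

end IsAdaptedFrame

end Framing

/-! ### The eigenbundle of the product and descent to the factors. -/

section Pair

variable {E : Type*} [NormedAddCommGroup E] [NormedSpace ℝ E]
  {H : Type*} [TopologicalSpace H] {I : ModelWithCorners ℝ E H}
  {N : Type*} [TopologicalSpace N] [ChartedSpace H N] [IsManifold I ∞ N]
  {E₁ : Type*} [NormedAddCommGroup E₁] [NormedSpace ℝ E₁]
  {H₁ : Type*} [TopologicalSpace H₁] {I₁ : ModelWithCorners ℝ E₁ H₁}
  {M₁ : Type*} [TopologicalSpace M₁] [ChartedSpace H₁ M₁] [IsManifold I₁ ∞ M₁]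
  {E₂ : Type*} [NormedAddCommGroup E₂] [NormedSpace ℝ E₂]
  {H₂ : Type*} [TopologicalSpace H₂] {I₂ : ModelWithCorners ℝ E₂ H₂}
  {M₂ : Type*} [TopologicalSpace M₂] [ChartedSpace H₂ M₂] [IsManifold I₂ ∞ M₂]
  {l₁ : Leg I N I₁ M₁} {l₂ : Leg I N I₂ M₂}
  {F₁ : ∀ p : M₁, Submodule ℝ (GT I₁ p)} {F₂ : ∀ p : M₂, Submodule ℝ (GT I₂ p)}
  {Φ₁ : ∀ p : M₁, GT I₁ p →ₗ[ℝ] GT I₁ p} {Φ₂ : ∀ p : M₂, GT I₂ p →ₗ[ℝ] GT I₂ p}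
  {e₁ e₂ : ∀ p : M₁, GT I₁ p} {f₁ f₂ : ∀ p : M₂, GT I₂ p}
  {Ψ : ∀ q : N, GT I q →ₗ[ℝ] GT I q}

namespace IsLinked

variable (h : IsLinked l₁ l₂ F₁ F₂ Φ₁ Φ₂ e₁ e₂ f₁ f₂ Ψ)
include h

theorem symm : IsLinked l₂ l₁ F₂ F₁ Φ₂ Φ₁ f₁ f₂ e₁ e₂ Ψ where
  complement := h.complement.symm
  frame₁ := h.frame₂
  frame₂ := h.frame₁
  sgf := by
    have e : (fun q => (F₂ (l₂.proj q)).map (l₂.inc q) ⊔ (F₁ (l₁.proj q)).map (l₁.inc q)) =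
        fun q => (F₁ (l₁.proj q)).map (l₁.inc q) ⊔ (F₂ (l₂.proj q)).map (l₂.inc q) :=
      funext fun q => sup_comm _ _
    rw [e]
    exact h.sgf
  left v hv := by
    obtain ⟨w, hw, hvw⟩ := h.right v hv
    exact ⟨w, hw, fun q => by rw [add_comm]; exact hvw q⟩
  right v hv := by
    obtain ⟨w, hw, hvw⟩ := h.left v hv
    exact ⟨w, hw, fun q => by rw [add_comm]; exact hvw q⟩

theorem isOrthProj (q : N) :
    IsOrthProj (fun q => (F₁ (l₁.proj q)).map (l₁.inc q) ⊔ (F₂ (l₂.proj q)).map (l₂.inc q)) q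
      (fun x => l₁.inc q (planeProj (e₁ (l₁.proj q)) (e₂ (l₁.proj q)) (l₁.out q x)) +
        l₂.inc q (planeProj (f₁ (l₂.proj q)) (f₂ (l₂.proj q)) (l₂.out q x))) where
  mem x := add_mem
    (Submodule.mem_sup_left (Submodule.mem_map_of_mem ((h.frame₁.isOrthProj _).mem _)))
    (Submodule.mem_sup_right (Submodule.mem_map_of_mem ((h.frame₂.isOrthProj _).mem _)))
  sub_mem x := by
    intro y hy
    obtain ⟨_, ⟨a, ha, rfl⟩, _, ⟨b, hb, rfl⟩, rfl⟩ := Submodule.mem_sup.1 hy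
    have h1 := (h.frame₁.isOrthProj _).sub_mem (l₁.out q x) a ha
    have h2 := (h.frame₂.isOrthProj _).sub_mem (l₂.out q x) b hb
    rw [pairing_add_right, l₁.pairing_inc_right, l₂.pairing_inc_right, map_sub, map_sub, map_add,
      map_add, l₁.out_inc, l₂.out_inc, h.complement.out_inc, h.complement.symm.out_inc, add_zero,
      zero_add, h1, h2, add_zero]

theorem apply_eq_zero {q : N} {x : GT I q}
    (h1 : planeProj (e₁ (l₁.proj q)) (e₂ (l₁.proj q)) (l₁.out q x) = 0)
    (h2 : planeProj (f₁ (l₂.proj q)) (f₂ (l₂.proj q)) (l₂.out q x) = 0) : Ψ q x = 0 := by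
  rw [← h.sgf.apply_proj (h.isOrthProj q) x, h1, h2, map_zero, map_zero, add_zero, map_zero]

theorem apply_inc_eq_zero {q : N} {x : GT I₁ (l₁.proj q)}
    (h1 : pairing I₁ _ (e₁ (l₁.proj q)) x = 0) (h2 : pairing I₁ _ (e₂ (l₁.proj q)) x = 0) :
    Ψ q (l₁.inc q x) = 0 := by
  refine h.apply_eq_zero ?_ ?_
  · rw [l₁.out_inc]
    exact IsAdaptedFrame.planeProj_eq_zero h1 h2
  · rw [h.complement.symm.out_inc]
    exact IsAdaptedFrame.planeProj_eq_zero (pairing_zero_right _ _) (pairing_zero_right _ _)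

/-- `Ψ` takes values in the sum of the two plane bundles, and `Φ₁` kills the first plane. -/
theorem apply_out_apply (q : N) (x : GT I q) : Φ₁ (l₁.proj q) (l₁.out q (Ψ q x)) = 0 := by
  obtain ⟨_, ⟨a, ha, rfl⟩, _, ⟨b, hb, rfl⟩, hab⟩ :=
    Submodule.mem_sup.1 (h.sgf.apply_mem (h.isOrthProj q) x)
  rw [← hab, map_add, l₁.out_inc, h.complement.out_inc, add_zero]
  replace ha : a ∈ F₁ (l₁.proj q) := ha
  rw [h.frame₁.span] at ha
  obtain ⟨c, d, rfl⟩ := Submodule.mem_span_pair.1 ha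
  simp [h.frame₁.kill₁, h.frame₁.kill₂]

theorem out_legProduct (q : N) (x : GT I q) :
    l₁.out q (legProduct l₁ l₂ Φ₁ Φ₂ Ψ q x) =
      Φ₁ (l₁.proj q) (l₁.out q x) + l₁.out q (Ψ q x) := by
  rw [legProduct_apply, map_add, map_add, l₁.out_inc, h.complement.out_inc, add_zero]

theorem apply_out_legProduct (q : N) (x : GT I q) :
    Φ₁ (l₁.proj q) (l₁.out q (legProduct l₁ l₂ Φ₁ Φ₂ Ψ q x)) =
      Φ₁ (l₁.proj q) (Φ₁ (l₁.proj q) (l₁.out q x)) := by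
  rw [h.out_legProduct, map_add, h.apply_out_apply, add_zero]

theorem apply_inc_apply (q : N) (x : GT I₁ (l₁.proj q)) :
    Ψ q (l₁.inc q (Φ₁ (l₁.proj q) x)) = 0 :=
  h.apply_inc_eq_zero (by rw [pairing_comm, h.frame₁.pairing_apply_left])
    (by rw [pairing_comm, h.frame₁.symm.pairing_apply_left])

theorem legProduct_skew (q : N) (x y : GT I q) :
    pairing I q (legProduct l₁ l₂ Φ₁ Φ₂ Ψ q x) y =
      -pairing I q x (legProduct l₁ l₂ Φ₁ Φ₂ Ψ q y) := by
  simp only [legProduct_apply, pairing_add_left, pairing_add_right, l₁.pairing_inc_left,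
    l₂.pairing_inc_left, l₁.pairing_inc_right, l₂.pairing_inc_right, h.frame₁.skew,
    h.frame₂.skew, h.sgf.skew_all (h.isOrthProj q)]
  ring

/-- The three summands live on mutually orthogonal bundles, so cross terms vanish; the squares are
minus the three orthogonal projections, which add up to the identity. -/
theorem legProduct_legProduct (q : N) (x : GT I q) :
    legProduct l₁ l₂ Φ₁ Φ₂ Ψ q (legProduct l₁ l₂ Φ₁ Φ₂ Ψ q x) = -x := by
  have h2 := h.symm.apply_out_legProduct q x
  rw [legProduct_swap] at h2
  have h3 : Ψ q (legProduct l₁ l₂ Φ₁ Φ₂ Ψ q x) = Ψ q (Ψ q x) := by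
    rw [legProduct_apply, map_add, map_add, h.apply_inc_apply, h.symm.apply_inc_apply, add_zero,
      zero_add]
  rw [legProduct_apply, h.apply_out_legProduct, h2, h3, h.frame₁.square, h.frame₂.square,
    h.sgf.apply_apply (h.isOrthProj q)]
  conv_rhs => rw [← h.complement.inc_out_add q x]
  simp only [map_neg, map_sub]
  abel

theorem mem_of_mem_left {q : N} {z : Cx (GT I₁ (l₁.proj q))}
    (hz : z ∈ eigenbundle I₁ Φ₁ (l₁.proj q)) :
    cMap (l₁.inc q) z ∈ eigenbundle I (legProduct l₁ l₂ Φ₁ Φ₂ Ψ) q := by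
  have a := h.frame₁.pairing_eq_zero_of_mem hz
  have b := h.frame₁.symm.pairing_eq_zero_of_mem hz
  rw [pairing_comm, pairing_comm _ z.im] at a b
  rw [mem_eigenbundle] at hz ⊢
  simp only [legProduct_apply, re_cMap, im_cMap, l₁.out_inc, h.complement.symm.out_inc,
    h.apply_inc_eq_zero a.1 b.1, h.apply_inc_eq_zero a.2 b.2, hz.1, hz.2, map_zero, map_neg,
    add_zero, and_self]

theorem mem_of_mem {q : N} {z : Cx (GT I q)} (hz : z ∈ eigenbundle I Ψ q) :
    z ∈ eigenbundle I (legProduct l₁ l₂ Φ₁ Φ₂ Ψ) q := by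
  rw [mem_eigenbundle] at hz ⊢
  have a1 := h.apply_out_apply q z.im
  have a2 := h.apply_out_apply q z.re
  have b1 := h.symm.apply_out_apply q z.im
  have b2 := h.symm.apply_out_apply q z.re
  rw [hz.2] at a1 b1
  rw [hz.1, map_neg, map_neg, neg_eq_zero] at a2 b2
  simp only [legProduct_apply, a1, a2, b1, b2, hz.1, hz.2, map_zero, add_zero, zero_add,
    and_self]

/-- An element of the eigenbundle of the product that is orthogonal to both frames. -/
theorem out_mem {q : N} {z : Cx (GT I q)} (hz : z ∈ eigenbundle I (legProduct l₁ l₂ Φ₁ Φ₂ Ψ) q)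
    (h1 : cPairing _ (cMap (l₁.out q) z) (toCx I₁ e₁ (l₁.proj q)) = 0)
    (h2 : cPairing _ (cMap (l₁.out q) z) (toCx I₁ e₂ (l₁.proj q)) = 0)
    (h3 : cPairing _ (cMap (l₂.out q) z) (toCx I₂ f₁ (l₂.proj q)) = 0)
    (h4 : cPairing _ (cMap (l₂.out q) z) (toCx I₂ f₂ (l₂.proj q)) = 0) :
    cMap (l₁.out q) z ∈ eigenbundle I₁ Φ₁ (l₁.proj q) := by
  rw [mem_eigenbundle] at hz ⊢
  rw [cPairing_toCx, Complex.ext_iff] at h1 h2 h3 h4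
  simp only [re_cMap, im_cMap, Complex.zero_re, Complex.zero_im, pairing_comm _ (l₁.out q _),
    pairing_comm _ (l₂.out q _)] at h1 h2 h3 h4
  have a := h.out_legProduct q z.re
  have b := h.out_legProduct q z.im
  rw [h.apply_eq_zero (IsAdaptedFrame.planeProj_eq_zero h1.1 h2.1)
    (IsAdaptedFrame.planeProj_eq_zero h3.1 h4.1), hz.1, map_zero, add_zero] at a
  rw [h.apply_eq_zero (IsAdaptedFrame.planeProj_eq_zero h1.2 h2.2)
    (IsAdaptedFrame.planeProj_eq_zero h3.2 h4.2), hz.2, map_zero, add_zero] at b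
  exact ⟨a.symm.trans (map_neg _ _), b.symm⟩

/-- Isotropy against the graph sections. -/
theorem cPairing_out_add {q : N} {z : Cx (GT I q)}
    (hz : z ∈ eigenbundle I (legProduct l₁ l₂ Φ₁ Φ₂ Ψ) q) {v : ∀ p : M₁, Cx (GT I₁ p)}
    {w : ∀ p : M₂, Cx (GT I₂ p)} (hvw : l₁.cPull v q + l₂.cPull w q ∈ eigenbundle I Ψ q) :
    cPairing _ (cMap (l₁.out q) z) (v (l₁.proj q)) +
      cPairing _ (cMap (l₂.out q) z) (w (l₂.proj q)) = 0 := by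
  have := cPairing_eq_zero_of_mem_eigenbundle (h.legProduct_skew q) hz (h.mem_of_mem hvw)
  rw [cPairing_add_right] at this
  -- The adjointness of `inc` and `out` is definitional.
  exact this

/-- The way back from the product to a factor. By isotropy `π₁^*z` is orthogonal to the graph
section over each `e` of the framing; its second component is zero, so `⟨z, e⟩ = 0`, and
orthogonality to both frames puts `z` in `L₁`. -/
theorem mem_left_of_mem {q : N} {z : Cx (GT I₁ (l₁.proj q))}
    (hz : cMap (l₁.inc q) z ∈ eigenbundle I (legProduct l₁ l₂ Φ₁ Φ₂ Ψ) q) :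
    z ∈ eigenbundle I₁ Φ₁ (l₁.proj q) := by
  have key : ∀ e : ∀ p : M₁, GT I₁ p, e ∈ Submodule.span ℝ {e₁, e₂} →
      cPairing _ (cMap (l₁.out q) (cMap (l₁.inc q) z)) (toCx I₁ e (l₁.proj q)) = 0 := by
    intro e he
    obtain ⟨w, -, hw⟩ := h.left _ (toCx_mem_framingCx he)
    have := h.cPairing_out_add hz (hw q)
    rw [h.complement.symm.cMap_out_inc] at this
    have h0 : cPairing (l₂.proj q) (0 : Cx (GT I₂ (l₂.proj q))) (w (l₂.proj q)) = 0 := by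
      apply Complex.ext <;> simp [cPairing]
    rwa [h0, add_zero] at this
  have h0 : ∀ f : ∀ p : M₂, GT I₂ p,
      cPairing _ (cMap (l₂.out q) (cMap (l₁.inc q) z)) (toCx I₂ f (l₂.proj q)) = 0 := by
    intro f
    rw [h.complement.symm.cMap_out_inc]
    apply Complex.ext <;> simp [cPairing]
  have := h.out_mem hz (key _ (Submodule.subset_span (by simp)))
    (key _ (Submodule.subset_span (by simp))) (h0 _) (h0 _)
  rwa [l₁.cMap_out_inc] at this

theorem isSGF [FiniteDimensional ℝ E₁]
    [FiniteDimensional ℝ E₂] [T2Space M₁] [T2Space M₂] :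
    IsSGF I (fun _ => ⊤) (legProduct l₁ l₂ Φ₁ Φ₂ Ψ) where
  smooth x hx := ((l₁.isSmooth_inc_out h.frame₁.smooth hx).add
    (l₂.isSmooth_inc_out h.frame₂.smooth hx)).add (h.sgf.smooth x hx)
  mapsTo _ _ _ := Submodule.mem_top
  zero_on_orth q x hx := by
    rw [eq_zero_of_pairing_eq_zero fun y => hx y Submodule.mem_top, map_zero]
  skew q x _ y _ := h.legProduct_skew q x y
  orthogonal q x _ y _ := by
    rw [h.legProduct_skew, h.legProduct_legProduct, pairing_neg_right, neg_neg]

theorem cPull_mem {z : ∀ p : M₁, Cx (GT I₁ p)} (hz : z ∈ cSections I₁ (eigenbundle I₁ Φ₁)) :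
    l₁.cPull z ∈ cSections I (eigenbundle I (legProduct l₁ l₂ Φ₁ Φ₂ Ψ)) :=
  ⟨(l₁.isCSmooth_cPull ⟨hz.1, hz.2.1⟩).1, (l₁.isCSmooth_cPull ⟨hz.1, hz.2.1⟩).2,
    fun _ => h.mem_of_mem_left (hz.2.2 _)⟩

/-- Integrability of the product implies normality of the first factor. -/
theorem isInvolutive_left [I.Boundaryless] [I₁.Boundaryless] [I₂.Boundaryless] [CompleteSpace E]
    [CompleteSpace E₁] [CompleteSpace E₂]
    (hJ : IsInvolutive I (eigenbundle I (legProduct l₁ l₂ Φ₁ Φ₂ Ψ))) :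
    IsInvolutive I₁ (eigenbundle I₁ Φ₁) := by
  intro z hz w hw p
  obtain ⟨q, rfl⟩ := h.complement.surjective p
  have := hJ _ (h.cPull_mem hz) _ (h.cPull_mem hw) q
  rw [l₁.cDorfman_cPull ⟨hz.1, hz.2.1⟩ ⟨hw.1, hw.2.1⟩] at this
  exact h.mem_left_of_mem this

/-- Complete `e` to a graph section `π₁^*e + π₂^*w`. Its bracket with `π₁^*z` is `π₁^*[e, z]`,
because the second term comes from the other factor; membership then descends. -/
theorem normalizes_left [I.Boundaryless] [I₁.Boundaryless] [I₂.Boundaryless] [CompleteSpace E]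
    [CompleteSpace E₁] [CompleteSpace E₂]
    (hJ : IsInvolutive I (eigenbundle I (legProduct l₁ l₂ Φ₁ Φ₂ Ψ))) {e : ∀ p : M₁, GT I₁ p}
    (he : e ∈ Submodule.span ℝ {e₁, e₂}) :
    Normalizes I₁ (toCx I₁ e) (eigenbundle I₁ Φ₁) := by
  intro z hz p
  obtain ⟨q, rfl⟩ := h.complement.surjective p
  obtain ⟨w, hw, hvw⟩ := h.left _ (toCx_mem_framingCx he)
  have vs := h.frame₁.isCSmooth_of_mem_framingCx (toCx_mem_framingCx he)
  have ws := h.frame₂.isCSmooth_of_mem_framingCx hw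
  have us := (l₁.isCSmooth_cPull vs).add (l₂.isCSmooth_cPull ws)
  have := hJ (l₁.cPull (toCx I₁ e) + l₂.cPull w) ⟨us.1, us.2, fun _ => h.mem_of_mem (hvw _)⟩
    _ (h.cPull_mem hz) q
  rw [cDorfman_add_left (l₁.isCSmooth_cPull vs) (l₂.isCSmooth_cPull ws)
    (l₁.isCSmooth_cPull ⟨hz.1, hz.2.1⟩), h.complement.symm.cDorfman_cPull ws ⟨hz.1, hz.2.1⟩,
    add_zero, l₁.cDorfman_cPull vs ⟨hz.1, hz.2.1⟩] at this
  exact h.mem_left_of_mem this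

end IsLinked

end Pair
end GenGeom

/-! ### Generators of the eigenbundle and integrability of the product. -/

namespace GenGeom

section Pair

variable {E : Type*} [NormedAddCommGroup E] [NormedSpace ℝ E]
  {H : Type*} [TopologicalSpace H] {I : ModelWithCorners ℝ E H}
  {N : Type*} [TopologicalSpace N] [ChartedSpace H N] [IsManifold I ∞ N]
  {E₁ : Type*} [NormedAddCommGroup E₁] [NormedSpace ℝ E₁]
  {H₁ : Type*} [TopologicalSpace H₁] {I₁ : ModelWithCorners ℝ E₁ H₁}
  {M₁ : Type*} [TopologicalSpace M₁] [ChartedSpace H₁ M₁] [IsManifold I₁ ∞ M₁]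
  {E₂ : Type*} [NormedAddCommGroup E₂] [NormedSpace ℝ E₂]
  {H₂ : Type*} [TopologicalSpace H₂] {I₂ : ModelWithCorners ℝ E₂ H₂}
  {M₂ : Type*} [TopologicalSpace M₂] [ChartedSpace H₂ M₂] [IsManifold I₂ ∞ M₂]
  {l₁ : Leg I N I₁ M₁} {l₂ : Leg I N I₂ M₂}
  {F₁ : ∀ p : M₁, Submodule ℝ (GT I₁ p)} {F₂ : ∀ p : M₂, Submodule ℝ (GT I₂ p)}
  {Φ₁ : ∀ p : M₁, GT I₁ p →ₗ[ℝ] GT I₁ p} {Φ₂ : ∀ p : M₂, GT I₂ p →ₗ[ℝ] GT I₂ p}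
  {e₁ e₂ : ∀ p : M₁, GT I₁ p} {f₁ f₂ : ∀ p : M₂, GT I₂ p}
  {Ψ : ∀ q : N, GT I q →ₗ[ℝ] GT I q}

/-- The sections `π₁^* v + π₂^* w` of the eigenbundle of `Ψ`, for `v` and `w` in the complexified
framings. -/
def graphSections (l₁ : Leg I N I₁ M₁) (l₂ : Leg I N I₂ M₂) (e₁ e₂ : ∀ p : M₁, GT I₁ p)
    (f₁ f₂ : ∀ p : M₂, GT I₂ p) (Ψ : ∀ q : N, GT I q →ₗ[ℝ] GT I q) :
    Set (∀ q : N, Cx (GT I q)) :=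
  {u | ∃ v ∈ framingCx I₁ (Submodule.span ℝ {e₁, e₂}),
    ∃ w ∈ framingCx I₂ (Submodule.span ℝ {f₁, f₂}),
      u = l₁.cPull v + l₂.cPull w ∧ ∀ q, u q ∈ eigenbundle I Ψ q}

theorem graphSections_swap :
    graphSections l₂ l₁ f₁ f₂ e₁ e₂ Ψ = graphSections l₁ l₂ e₁ e₂ f₁ f₂ Ψ := by
  ext u
  constructor
  · rintro ⟨v, hv, w, hw, rfl, hu⟩
    exact ⟨w, hw, v, hv, add_comm _ _, hu⟩
  · rintro ⟨v, hv, w, hw, rfl, hu⟩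
    exact ⟨w, hw, v, hv, add_comm _ _, hu⟩

/-- Sections which generate the eigenbundle of the product locally. -/
def productGenerators (l₁ : Leg I N I₁ M₁) (l₂ : Leg I N I₂ M₂)
    (Φ₁ : ∀ p : M₁, GT I₁ p →ₗ[ℝ] GT I₁ p) (Φ₂ : ∀ p : M₂, GT I₂ p →ₗ[ℝ] GT I₂ p)
    (e₁ e₂ : ∀ p : M₁, GT I₁ p)
    (f₁ f₂ : ∀ p : M₂, GT I₂ p) (Ψ : ∀ q : N, GT I q →ₗ[ℝ] GT I q) :
    Set (∀ q : N, Cx (GT I q)) :=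
  (l₁.cPull '' cSections I₁ (eigenbundle I₁ Φ₁) ∪ l₂.cPull '' cSections I₂ (eigenbundle I₂ Φ₂)) ∪
    graphSections l₁ l₂ e₁ e₂ f₁ f₂ Ψ

namespace IsLinked

variable (h : IsLinked l₁ l₂ F₁ F₂ Φ₁ Φ₂ e₁ e₂ f₁ f₂ Ψ)
include h

theorem isCSmooth_of_mem_graphSections {u : ∀ q : N, Cx (GT I q)}
    (hu : u ∈ graphSections l₁ l₂ e₁ e₂ f₁ f₂ Ψ) : IsCSmooth u := by
  obtain ⟨v, hv, w, hw, rfl, -⟩ := hu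
  exact (l₁.isCSmooth_cPull (h.frame₁.isCSmooth_of_mem_framingCx hv)).add
    (l₂.isCSmooth_cPull (h.frame₂.isCSmooth_of_mem_framingCx hw))

theorem out_add (q : N) (v : ∀ p : M₁, Cx (GT I₁ p)) (w : ∀ p : M₂, Cx (GT I₂ p)) :
    cMap (l₁.out q) ((l₁.cPull v + l₂.cPull w) q) = v (l₁.proj q) := by
  change cMap (l₁.out q) (cMap (l₁.inc q) _ + cMap (l₂.inc q) _) = _
  rw [map_add, l₁.cMap_out_inc, h.complement.cMap_out_inc, add_zero]

/-- Subtracting suitable multiples of the graph sections over `e₁` and `e₂` makes `z` orthogonal to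
the first frame; isotropy against graph sections then forces orthogonality to the second frame. What
remains has its components in `L₁` and `L₂`, where `locGen_inc_out` applies. -/
theorem locGen [FiniteDimensional ℝ E₁]
    [FiniteDimensional ℝ E₂] [T2Space M₁] [T2Space M₂] {z : ∀ q : N, Cx (GT I q)}
    (hz : z ∈ cSections I (eigenbundle I (legProduct l₁ l₂ Φ₁ Φ₂ Ψ))) (q : N) :
    LocGen (productGenerators l₁ l₂ Φ₁ Φ₂ e₁ e₂ f₁ f₂ Ψ) q z := by
  obtain ⟨w₁, hw₁, hu₁⟩ := h.left _ (toCx_mem_framingCx (Submodule.subset_span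
    (show e₁ ∈ {e₁, e₂} by simp)))
  obtain ⟨w₂, hw₂, hu₂⟩ := h.left _ (toCx_mem_framingCx (Submodule.subset_span
    (show e₂ ∈ {e₁, e₂} by simp)))
  have g₁ : l₁.cPull (toCx I₁ e₁) + l₂.cPull w₁ ∈ graphSections l₁ l₂ e₁ e₂ f₁ f₂ Ψ :=
    ⟨_, toCx_mem_framingCx (Submodule.subset_span (by simp)), w₁, hw₁, rfl, hu₁⟩
  have g₂ : l₁.cPull (toCx I₁ e₂) + l₂.cPull w₂ ∈ graphSections l₁ l₂ e₁ e₂ f₁ f₂ Ψ :=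
    ⟨_, toCx_mem_framingCx (Submodule.subset_span (by simp)), w₂, hw₂, rfl, hu₂⟩
  have o₁ := fun q => h.out_add q (toCx I₁ e₁) w₁
  have o₂ := fun q => h.out_add q (toCx I₁ e₂) w₂
  generalize l₁.cPull (toCx I₁ e₁) + l₂.cPull w₁ = u₁ at *
  generalize l₁.cPull (toCx I₁ e₂) + l₂.cPull w₂ = u₂ at *
  have u₁L : ∀ q, u₁ q ∈ eigenbundle I Ψ q := by
    obtain ⟨_, _, _, _, _, hu⟩ := g₁; exact hu
  have u₂L : ∀ q, u₂ q ∈ eigenbundle I Ψ q := by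
    obtain ⟨_, _, _, _, _, hu⟩ := g₂; exact hu
  -- The factor `k` is `-2` for the correction that defines `z₀` and `2` for undoing it at the end.
  -- The coefficient of `u₁` pairs with `e₂` and that of `u₂` with `e₁`, since `2⟨e₁, e₂⟩ = 1`.
  let c : ℝ → (∀ p : M₁, GT I₁ p) → N → ℂ := fun k e q =>
    ⟨k * pairing I q (z q).re (l₁.pull e q), k * pairing I q (z q).im (l₁.pull e q)⟩
  have hc : ∀ k e q, c k e q = k * cPairing _ (cMap (l₁.out q) (z q)) (toCx I₁ e (l₁.proj q)) := by
    intro k e q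
    rw [cPairing_toCx]
    apply Complex.ext <;> simp [c] <;> exact Or.inl rfl
  have gen : ∀ k e u, IsSmooth I₁ e → u ∈ graphSections l₁ l₂ e₁ e₂ f₁ f₂ Ψ →
      LocGen (graphSections l₁ l₂ e₁ e₂ f₁ f₂ Ψ) q (fun q => c k e q • u q) :=
    fun k e u he hu => LocGen.csmul (contMDiff_const_mul_pairing hz.1 (l₁.isSmooth_pull he) k)
      (contMDiff_const_mul_pairing hz.2.1 (l₁.isSmooth_pull he) k) (.base hu)
  have smooth : ∀ {u}, LocGen (graphSections l₁ l₂ e₁ e₂ f₁ f₂ Ψ) q u → IsCSmooth u :=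
    fun hu => hu.isCSmooth fun _ => h.isCSmooth_of_mem_graphSections
  let z₀ : ∀ q : N, Cx (GT I q) :=
    z + ((fun q => c (-2) e₂ q • u₁ q) + fun q => c (-2) e₁ q • u₂ q)
  have z₀_apply : ∀ q, z₀ q = z q + (c (-2) e₂ q • u₁ q + c (-2) e₁ q • u₂ q) := fun _ => rfl
  have hz₀ : IsCSmooth z₀ := IsCSmooth.add ⟨hz.1, hz.2.1⟩
    ((smooth (gen (-2) e₂ u₁ h.frame₁.smooth₂ g₁)).add (smooth (gen (-2) e₁ u₂ h.frame₁.smooth₁ g₂)))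
  have hz₀L : ∀ q, z₀ q ∈ eigenbundle I (legProduct l₁ l₂ Φ₁ Φ₂ Ψ) q := fun q =>
    (eigenSubmodule (legProduct l₁ l₂ Φ₁ Φ₂ Ψ) q).add_mem (hz.2.2 q)
      ((eigenSubmodule (legProduct l₁ l₂ Φ₁ Φ₂ Ψ) q).add_mem
        ((eigenSubmodule (legProduct l₁ l₂ Φ₁ Φ₂ Ψ) q).smul_mem _ (h.mem_of_mem (u₁L q)))
        ((eigenSubmodule (legProduct l₁ l₂ Φ₁ Φ₂ Ψ) q).smul_mem _ (h.mem_of_mem (u₂L q))))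
  have out₀ : ∀ q, cMap (l₁.out q) (z₀ q) = cMap (l₁.out q) (z q) +
      (c (-2) e₂ q • toCx I₁ e₁ (l₁.proj q) + c (-2) e₁ q • toCx I₁ e₂ (l₁.proj q)) := by
    intro q
    rw [z₀_apply, map_add, map_add, map_smul, map_smul, o₁, o₂]
  have a1 : ∀ q, cPairing _ (cMap (l₁.out q) (z₀ q)) (toCx I₁ e₁ (l₁.proj q)) = 0 := by
    intro q
    rw [out₀, cPairing_add_left, cPairing_add_left, cPairing_smul_left, cPairing_smul_left,
      h.frame₁.cPairing_toCx_self, h.frame₁.symm.cPairing_toCx_dual, hc, hc]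
    push_cast
    ring
  have a2 : ∀ q, cPairing _ (cMap (l₁.out q) (z₀ q)) (toCx I₁ e₂ (l₁.proj q)) = 0 := by
    intro q
    rw [out₀, cPairing_add_left, cPairing_add_left, cPairing_smul_left, cPairing_smul_left,
      h.frame₁.symm.cPairing_toCx_self, h.frame₁.cPairing_toCx_dual, hc, hc]
    push_cast
    ring
  -- Each `f` is the second component of a graph section whose first component is a combination of
  -- `e₁` and `e₂`. By `a1` and `a2` that first component contributes nothing to the isotropy
  -- relation.
  have b : ∀ f ∈ Submodule.span ℝ {f₁, f₂}, ∀ q,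
      cPairing _ (cMap (l₂.out q) (z₀ q)) (toCx I₂ f (l₂.proj q)) = 0 := by
    intro f hf q
    obtain ⟨v, hv, hvw⟩ := h.right _ (toCx_mem_framingCx hf)
    obtain ⟨α, β, hαβ⟩ := exists_eq_of_mem_framingCx hv
    have := h.cPairing_out_add (hz₀L q) (hvw q)
    rwa [hαβ, cPairing_add_right, cPairing_smul_right, cPairing_smul_right, a1, a2, mul_zero,
      mul_zero, add_zero, zero_add] at this
  have b1 := b f₁ (Submodule.subset_span (by simp))
  have b2 := b f₂ (Submodule.subset_span (by simp))
  have k1 := l₁.locGen_inc_out h.frame₁ hz₀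
    (fun q => h.out_mem (hz₀L q) (a1 q) (a2 q) (b1 q) (b2 q)) q
  have k2 := l₂.locGen_inc_out h.frame₂ hz₀
    (fun q => h.symm.out_mem (by rw [legProduct_swap]; exact hz₀L q) (b1 q) (b2 q) (a1 q) (a2 q)) q
  have sub₁ : l₁.cPull '' cSections I₁ (eigenbundle I₁ Φ₁) ⊆
      productGenerators l₁ l₂ Φ₁ Φ₂ e₁ e₂ f₁ f₂ Ψ := fun _ hx => Or.inl (Or.inl hx)
  have sub₂ : l₂.cPull '' cSections I₂ (eigenbundle I₂ Φ₂) ⊆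
      productGenerators l₁ l₂ Φ₁ Φ₂ e₁ e₂ f₁ f₂ Ψ := fun _ hx => Or.inl (Or.inr hx)
  have sub₃ : graphSections l₁ l₂ e₁ e₂ f₁ f₂ Ψ ⊆
      productGenerators l₁ l₂ Φ₁ Φ₂ e₁ e₂ f₁ f₂ Ψ := fun _ hx => Or.inr hx
  have all := ((k1.mono sub₁).add (k2.mono sub₂)).add
    (((gen 2 e₂ u₁ h.frame₁.smooth₂ g₁).mono sub₃).add ((gen 2 e₁ u₂ h.frame₁.smooth₁ g₂).mono sub₃))
  refine all.congr ⟨hz.1, hz.2.1⟩ (Filter.Eventually.of_forall fun q => ?_)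
  change z q = (cMap (l₁.inc q) (cMap (l₁.out q) (z₀ q)) +
    cMap (l₂.inc q) (cMap (l₂.out q) (z₀ q))) + (c 2 e₂ q • u₁ q + c 2 e₁ q • u₂ q)
  have neg : ∀ e, c (-2) e q = -c 2 e q := fun e => by
    rw [hc, hc]; push_cast; ring
  rw [h.complement.cMap_inc_out_add, z₀_apply, neg, neg]
  module

section Bracket

variable [I.Boundaryless] [I₁.Boundaryless] [I₂.Boundaryless] [FiniteDimensional ℝ E]
  [FiniteDimensional ℝ E₁] [FiniteDimensional ℝ E₂]

omit [FiniteDimensional ℝ E₂] in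
theorem cDorfman_cPull_graphSections
    (hn₁ : Normalizes I₁ (toCx I₁ e₁) (eigenbundle I₁ Φ₁))
    (hn₂ : Normalizes I₁ (toCx I₁ e₂) (eigenbundle I₁ Φ₁))
    {l : ∀ p : M₁, Cx (GT I₁ p)} (hl : l ∈ cSections I₁ (eigenbundle I₁ Φ₁))
    {u : ∀ q : N, Cx (GT I q)} (hu : u ∈ graphSections l₁ l₂ e₁ e₂ f₁ f₂ Ψ) (q : N) :
    cDorfman I (l₁.cPull l) u q ∈ eigenbundle I (legProduct l₁ l₂ Φ₁ Φ₂ Ψ) q ∧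
    cDorfman I u (l₁.cPull l) q ∈ eigenbundle I (legProduct l₁ l₂ Φ₁ Φ₂ Ψ) q := by
  obtain ⟨v, hv, w, hw, rfl, -⟩ := hu
  have vs := h.frame₁.isCSmooth_of_mem_framingCx hv
  have ws := h.frame₂.isCSmooth_of_mem_framingCx hw
  have ls : IsCSmooth l := ⟨hl.1, hl.2.1⟩
  constructor
  · rw [cDorfman_add_right (l₁.isCSmooth_cPull ls) (l₁.isCSmooth_cPull vs)
      (l₂.isCSmooth_cPull ws), h.complement.cDorfman_cPull ls ws, add_zero,
      l₁.cDorfman_cPull ls vs]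
    exact h.mem_of_mem_left (h.frame₁.cDorfman_framing_right hn₁ hn₂ hv hl _)
  · rw [cDorfman_add_left (l₁.isCSmooth_cPull vs) (l₂.isCSmooth_cPull ws)
      (l₁.isCSmooth_cPull ls), h.complement.symm.cDorfman_cPull ws ls, add_zero,
      l₁.cDorfman_cPull vs ls]
    exact h.mem_of_mem_left (h.frame₁.cDorfman_framing_left hn₁ hn₂ hv hl _)

/-- Mixed terms vanish because the factors differ, and the two pure terms because normalized
framings commute. -/
theorem cDorfman_graphSections [T2Space M₁] [T2Space M₂]
    (hn₁ : Normalizes I₁ (toCx I₁ e₁) (eigenbundle I₁ Φ₁))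
    (hn₂ : Normalizes I₁ (toCx I₁ e₂) (eigenbundle I₁ Φ₁))
    (hm₁ : Normalizes I₂ (toCx I₂ f₁) (eigenbundle I₂ Φ₂))
    (hm₂ : Normalizes I₂ (toCx I₂ f₂) (eigenbundle I₂ Φ₂))
    {u u' : ∀ q : N, Cx (GT I q)} (hu : u ∈ graphSections l₁ l₂ e₁ e₂ f₁ f₂ Ψ)
    (hu' : u' ∈ graphSections l₁ l₂ e₁ e₂ f₁ f₂ Ψ) (q : N) : cDorfman I u u' q = 0 := by
  have us' := h.isCSmooth_of_mem_graphSections hu'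
  obtain ⟨v, hv, w, hw, rfl, -⟩ := hu
  obtain ⟨v', hv', w', hw', rfl, -⟩ := hu'
  have vs := h.frame₁.isCSmooth_of_mem_framingCx hv
  have ws := h.frame₂.isCSmooth_of_mem_framingCx hw
  have vs' := h.frame₁.isCSmooth_of_mem_framingCx hv'
  have ws' := h.frame₂.isCSmooth_of_mem_framingCx hw'
  have cs := l₁.isCSmooth_cPull vs
  have cs' := l₁.isCSmooth_cPull vs'
  have ds := l₂.isCSmooth_cPull ws
  have ds' := l₂.isCSmooth_cPull ws'
  rw [cDorfman_add_left cs ds us', cDorfman_add_right cs cs' ds', cDorfman_add_right ds cs' ds',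
    h.complement.cDorfman_cPull vs ws', h.complement.symm.cDorfman_cPull ws vs',
    l₁.cDorfman_cPull vs vs', l₂.cDorfman_cPull ws ws',
    h.frame₁.cDorfman_framing_framing hn₁ hn₂ hv hv',
    h.frame₂.cDorfman_framing_framing hm₁ hm₂ hw hw', map_zero, map_zero, add_zero, add_zero]

/-- Normality of the factors implies integrability of the product. -/
theorem isInvolutive [T2Space M₁] [T2Space M₂] (hL₁ : IsInvolutive I₁ (eigenbundle I₁ Φ₁))
    (hn₁ : Normalizes I₁ (toCx I₁ e₁) (eigenbundle I₁ Φ₁))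
    (hn₂ : Normalizes I₁ (toCx I₁ e₂) (eigenbundle I₁ Φ₁))
    (hL₂ : IsInvolutive I₂ (eigenbundle I₂ Φ₂))
    (hm₁ : Normalizes I₂ (toCx I₂ f₁) (eigenbundle I₂ Φ₂))
    (hm₂ : Normalizes I₂ (toCx I₂ f₂) (eigenbundle I₂ Φ₂)) :
    IsInvolutive I (eigenbundle I (legProduct l₁ l₂ Φ₁ Φ₂ Ψ)) := by
  intro z hz w hw q
  have swap := legProduct_swap l₁ l₂ Φ₁ Φ₂ Ψ
  have mem₂ : ∀ l ∈ cSections I₂ (eigenbundle I₂ Φ₂),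
      l₂.cPull l ∈ cSections I (eigenbundle I (legProduct l₁ l₂ Φ₁ Φ₂ Ψ)) := fun l hl =>
    swap ▸ h.symm.cPull_mem hl
  refine LocGen.cDorfman_mem (G := productGenerators l₁ l₂ Φ₁ Φ₂ e₁ e₂ f₁ f₂ Ψ)
    (L := eigenSubmodule (legProduct l₁ l₂ Φ₁ Φ₂ Ψ))
    (fun z hz w hw => cPairing_eq_zero_of_mem_eigenbundle (h.legProduct_skew q) hz hw) ?_ ?_
    (h.locGen hz q) (h.locGen hw q)
  · rintro z ((⟨l, hl, rfl⟩ | ⟨l, hl, rfl⟩) | hu)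
    · exact ⟨l₁.isCSmooth_cPull ⟨hl.1, hl.2.1⟩, (h.cPull_mem hl).2.2 q⟩
    · exact ⟨l₂.isCSmooth_cPull ⟨hl.1, hl.2.1⟩, (mem₂ l hl).2.2 q⟩
    · refine ⟨h.isCSmooth_of_mem_graphSections hu, ?_⟩
      obtain ⟨_, _, _, _, _, hu⟩ := hu
      exact h.mem_of_mem (hu q)
  · have zero : (0 : Cx (GT I q)) ∈ eigenSubmodule (legProduct l₁ l₂ Φ₁ Φ₂ Ψ) q :=
      Submodule.zero_mem _
    have mixed₂ : ∀ {l : ∀ p : M₂, Cx (GT I₂ p)}, l ∈ cSections I₂ (eigenbundle I₂ Φ₂) →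
        ∀ {u : ∀ q : N, Cx (GT I q)}, u ∈ graphSections l₁ l₂ e₁ e₂ f₁ f₂ Ψ →
        cDorfman I (l₂.cPull l) u q ∈ eigenbundle I (legProduct l₁ l₂ Φ₁ Φ₂ Ψ) q ∧
        cDorfman I u (l₂.cPull l) q ∈ eigenbundle I (legProduct l₁ l₂ Φ₁ Φ₂ Ψ) q :=
      fun hl _ hu => swap ▸ h.symm.cDorfman_cPull_graphSections hm₁ hm₂ hl
        (by rw [graphSections_swap]; exact hu) q
    rintro z ((⟨l, hl, rfl⟩ | ⟨l, hl, rfl⟩) | hu) w ((⟨m, hm, rfl⟩ | ⟨m, hm, rfl⟩) | hv)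
    · rw [l₁.cDorfman_cPull ⟨hl.1, hl.2.1⟩ ⟨hm.1, hm.2.1⟩]
      exact h.mem_of_mem_left (hL₁ l hl m hm _)
    · rw [h.complement.cDorfman_cPull ⟨hl.1, hl.2.1⟩ ⟨hm.1, hm.2.1⟩]
      exact zero
    · exact (h.cDorfman_cPull_graphSections hn₁ hn₂ hl hv q).1
    · rw [h.complement.symm.cDorfman_cPull ⟨hl.1, hl.2.1⟩ ⟨hm.1, hm.2.1⟩]
      exact zero
    · rw [l₂.cDorfman_cPull ⟨hl.1, hl.2.1⟩ ⟨hm.1, hm.2.1⟩, ← swap]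
      exact h.symm.mem_of_mem_left (hL₂ l hl m hm _)
    · exact (mixed₂ hl hv).1
    · exact (h.cDorfman_cPull_graphSections hn₁ hn₂ hm hu q).2
    · exact (mixed₂ hm hu).2
    · rw [h.cDorfman_graphSections hn₁ hn₂ hm₁ hm₂ hu hv]
      exact zero

theorem isGeneralizedComplex_iff [T2Space M₁] [T2Space M₂] :
    IsGeneralizedComplex I (legProduct l₁ l₂ Φ₁ Φ₂ Ψ) ↔
      (IsInvolutive I₁ (eigenbundle I₁ Φ₁) ∧
        Normalizes I₁ (toCx I₁ e₁) (eigenbundle I₁ Φ₁) ∧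
        Normalizes I₁ (toCx I₁ e₂) (eigenbundle I₁ Φ₁)) ∧
      IsInvolutive I₂ (eigenbundle I₂ Φ₂) ∧
        Normalizes I₂ (toCx I₂ f₁) (eigenbundle I₂ Φ₂) ∧
        Normalizes I₂ (toCx I₂ f₂) (eigenbundle I₂ Φ₂) := by
  constructor
  · rintro ⟨-, hJ⟩
    have hJ' := hJ
    rw [← legProduct_swap] at hJ'
    exact ⟨⟨h.isInvolutive_left hJ, h.normalizes_left hJ (Submodule.subset_span (by simp)),
      h.normalizes_left hJ (Submodule.subset_span (by simp))⟩,
      h.symm.isInvolutive_left hJ', h.symm.normalizes_left hJ' (Submodule.subset_span (by simp)),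
      h.symm.normalizes_left hJ' (Submodule.subset_span (by simp))⟩
  · rintro ⟨⟨hL₁, hn₁, hn₂⟩, hL₂, hm₁, hm₂⟩
    exact ⟨h.isSGF, h.isInvolutive hL₁ hn₁ hn₂ hL₂ hm₁ hm₂⟩

end Bracket

end IsLinked

end Pair
end GenGeom

/-! ### Constancy of the pairing on corresponding framings. -/

namespace GenGeom

section Correspondence

variable {E : Type*} [NormedAddCommGroup E] [NormedSpace ℝ E]
  {H : Type*} [TopologicalSpace H] {I : ModelWithCorners ℝ E H}
  {N : Type*} [TopologicalSpace N] [ChartedSpace H N] [IsManifold I ∞ N]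
  {E₁ : Type*} [NormedAddCommGroup E₁] [NormedSpace ℝ E₁]
  {H₁ : Type*} [TopologicalSpace H₁] {I₁ : ModelWithCorners ℝ E₁ H₁}
  {M₁ : Type*} [TopologicalSpace M₁] [ChartedSpace H₁ M₁] [IsManifold I₁ ∞ M₁]
  {E₂ : Type*} [NormedAddCommGroup E₂] [NormedSpace ℝ E₂]
  {H₂ : Type*} [TopologicalSpace H₂] {I₂ : ModelWithCorners ℝ E₂ H₂}
  {M₂ : Type*} [TopologicalSpace M₂] [ChartedSpace H₂ M₂] [IsManifold I₂ ∞ M₂]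

/-- The eigenbundle of `Ψ` contains the graph of a correspondence between the complexified
framings `V₁` and `V₂`. -/
structure IsCorrespondence (l₁ : Leg I N I₁ M₁) (l₂ : Leg I N I₂ M₂)
    (V₁ : Submodule ℝ (∀ p : M₁, GT I₁ p)) (V₂ : Submodule ℝ (∀ p : M₂, GT I₂ p))
    (Ψ : ∀ q : N, GT I q →ₗ[ℝ] GT I q) : Prop where
  left : ∀ v ∈ framingCx I₁ V₁, ∃ w ∈ framingCx I₂ V₂,
    ∀ q, l₁.cPull v q + l₂.cPull w q ∈ eigenbundle I Ψ q
  right : ∀ w ∈ framingCx I₂ V₂, ∃ v ∈ framingCx I₁ V₁,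
    ∀ q, l₁.cPull v q + l₂.cPull w q ∈ eigenbundle I Ψ q

variable {l₁ : Leg I N I₁ M₁} {l₂ : Leg I N I₂ M₂}
  {F₁ : ∀ p : M₁, Submodule ℝ (GT I₁ p)} {F₂ : ∀ p : M₂, Submodule ℝ (GT I₂ p)}
  {V₁ : Submodule ℝ (∀ p : M₁, GT I₁ p)} {V₂ : Submodule ℝ (∀ p : M₂, GT I₂ p)}
  {Ψ : ∀ q : N, GT I q →ₗ[ℝ] GT I q}

theorem IsCorrespondence.symm (h : IsCorrespondence l₁ l₂ V₁ V₂ Ψ) :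
    IsCorrespondence l₂ l₁ V₂ V₁ Ψ where
  left v hv := by
    obtain ⟨w, hw, hvw⟩ := h.right v hv
    exact ⟨w, hw, fun q => by rw [add_comm]; exact hvw q⟩
  right v hv := by
    obtain ⟨w, hw, hvw⟩ := h.left v hv
    exact ⟨w, hw, fun q => by rw [add_comm]; exact hvw q⟩

/-- The pairing is constant on a framing that corresponds to another one. -/
theorem IsCorrespondence.pairing_const (h : IsCorrespondence l₁ l₂ V₁ V₂ Ψ)
    (hc : l₁.IsComplement l₂) (hj : ∀ p₁ p₂, ∃ q, l₁.proj q = p₁ ∧ l₂.proj q = p₂)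
    (hV₁ : ∀ v ∈ V₁, ∀ p, v p ∈ F₁ p) (hV₂ : ∀ v ∈ V₂, ∀ p, v p ∈ F₂ p)
    (hΨ : ∀ q, ∀ x ∈ (F₁ (l₁.proj q)).map (l₁.inc q) ⊔ (F₂ (l₂.proj q)).map (l₂.inc q),
      ∀ y ∈ (F₁ (l₁.proj q)).map (l₁.inc q) ⊔ (F₂ (l₂.proj q)).map (l₂.inc q),
      pairing I q (Ψ q x) y = -pairing I q x (Ψ q y)) [Nonempty M₂] {v w : ∀ p : M₁, GT I₁ p}
    (hv : v ∈ V₁) (hw : w ∈ V₁) (p p' : M₁) :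
    pairing I₁ p (v p) (w p) = pairing I₁ p' (v p') (w p') := by
  obtain ⟨v', hv', hvv⟩ := h.left _ (toCx_mem_framingCx hv)
  obtain ⟨w', hw', hww⟩ := h.left _ (toCx_mem_framingCx hw)
  have mem : ∀ v ∈ framingCx I₁ V₁, ∀ v' ∈ framingCx I₂ V₂, ∀ q,
      (l₁.cPull v q + l₂.cPull v' q).re ∈
        (F₁ (l₁.proj q)).map (l₁.inc q) ⊔ (F₂ (l₂.proj q)).map (l₂.inc q) ∧
      (l₁.cPull v q + l₂.cPull v' q).im ∈
        (F₁ (l₁.proj q)).map (l₁.inc q) ⊔ (F₂ (l₂.proj q)).map (l₂.inc q) :=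
    fun v hv v' hv' q =>
      ⟨Submodule.add_mem_sup (Submodule.mem_map_of_mem (hV₁ _ hv.1 _))
        (Submodule.mem_map_of_mem (hV₂ _ hv'.1 _)),
      Submodule.add_mem_sup (Submodule.mem_map_of_mem (hV₁ _ hv.2 _))
        (Submodule.mem_map_of_mem (hV₂ _ hv'.2 _))⟩
  -- The real part of the isotropy of two graph sections, split over the factors; the first
  -- components `v`, `w` are real.
  have key : ∀ q, pairing I₁ (l₁.proj q) (v (l₁.proj q)) (w (l₁.proj q)) +
      (cPairing (l₂.proj q) (v' (l₂.proj q)) (w' (l₂.proj q))).re = 0 := by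
    intro q
    have a := mem _ (toCx_mem_framingCx hv) _ hv' q
    have b := mem _ (toCx_mem_framingCx hw) _ hw' q
    have h2 := hΨ q _ a.2 _ b.1
    have hz := mem_eigenbundle.1 (hvv q)
    have hw := mem_eigenbundle.1 (hww q)
    rw [hz.2, hw.1, pairing_neg_right, neg_neg] at h2
    have e1 : pairing I q (l₁.cPull (toCx I₁ v) q + l₂.cPull v' q).re
          (l₁.cPull (toCx I₁ w) q + l₂.cPull w' q).re =
        pairing I₁ (l₁.proj q) (v (l₁.proj q)) (w (l₁.proj q)) +
          pairing I₂ (l₂.proj q) (v' (l₂.proj q)).re (w' (l₂.proj q)).re := by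
      rw [Cx.re_add, Cx.re_add]
      change pairing I q (l₁.inc q _ + l₂.inc q _) (l₁.inc q _ + l₂.inc q _) = _
      rw [pairing_add_left, pairing_add_right, pairing_add_right, l₁.pairing_inc_inc,
        l₂.pairing_inc_inc, hc.pairing_inc_inc, hc.symm.pairing_inc_inc, add_zero, zero_add]
      rfl
    have e2 : pairing I q (l₁.cPull (toCx I₁ v) q + l₂.cPull v' q).im
          (l₁.cPull (toCx I₁ w) q + l₂.cPull w' q).im =
          pairing I₂ (l₂.proj q) (v' (l₂.proj q)).im (w' (l₂.proj q)).im := by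
      rw [Cx.im_add, Cx.im_add]
      change pairing I q (l₁.inc q 0 + l₂.inc q _) (l₁.inc q 0 + l₂.inc q _) = _
      rw [map_zero, zero_add, zero_add, l₂.pairing_inc_inc]
    rw [e1, e2] at h2
    simp only [cPairing]
    linarith
  obtain ⟨p₂⟩ := ‹Nonempty M₂›
  -- With the point of the second factor fixed, the second term no longer depends on `p`, so neither
  -- does the first.
  have key' : ∀ p, pairing I₁ p (v p) (w p) + (cPairing p₂ (v' p₂) (w' p₂)).re = 0 := by
    intro p
    obtain ⟨q, rfl, rfl⟩ := hj p p₂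
    exact key q
  linarith [key' p, key' p']

end Correspondence

/-! ### Admissible triples on the product manifold. -/

section Product

variable {E₁ : Type*} [NormedAddCommGroup E₁] [NormedSpace ℝ E₁]
  {H₁ : Type*} [TopologicalSpace H₁] (I₁ : ModelWithCorners ℝ E₁ H₁)
  {M₁ : Type*} [TopologicalSpace M₁] [ChartedSpace H₁ M₁] [IsManifold I₁ ∞ M₁]
  {E₂ : Type*} [NormedAddCommGroup E₂] [NormedSpace ℝ E₂]
  {H₂ : Type*} [TopologicalSpace H₂] (I₂ : ModelWithCorners ℝ E₂ H₂)
  {M₂ : Type*} [TopologicalSpace M₂] [ChartedSpace H₂ M₂] [IsManifold I₂ ∞ M₂]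
  {F₁ : ∀ p : M₁, Submodule ℝ (GT I₁ p)} {F₂ : ∀ p : M₂, Submodule ℝ (GT I₂ p)}
  {Φ₁ : ∀ p : M₁, GT I₁ p →ₗ[ℝ] GT I₁ p} {Φ₂ : ∀ p : M₂, GT I₂ p →ₗ[ℝ] GT I₂ p}
  {V₁ : Submodule ℝ (∀ p : M₁, GT I₁ p)} {V₂ : Submodule ℝ (∀ p : M₂, GT I₂ p)}
  {Ψ : ∀ q : M₁ × M₂, GT (I₁.prod I₂) q →ₗ[ℝ] GT (I₁.prod I₂) q}

theorem legProduct_eq_morimotoProduct :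
    legProduct (fstLeg I₁ M₁ I₂ M₂) (sndLeg I₁ M₁ I₂ M₂) Φ₁ Φ₂ Ψ =
      morimotoProduct I₁ I₂ Φ₁ Φ₂ Ψ := by
  funext q
  unfold legProduct morimotoProduct
  rw [fstLeg_inc, sndLeg_inc, fstLeg_out, sndLeg_out]
  rfl

/-- Over an empty manifold the space of sections is zero and has no subspace of positive dimension.
-/
theorem IsFraming.nonempty {E : Type*} [NormedAddCommGroup E] [NormedSpace ℝ E]
    {H : Type*} [TopologicalSpace H] {I : ModelWithCorners ℝ E H}
    {M : Type*} [TopologicalSpace M] [ChartedSpace H M] [IsManifold I ∞ M] {r : ℕ}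
    {F : ∀ p : M, Submodule ℝ (GT I p)} {V : Submodule ℝ (∀ p : M, GT I p)}
    (hV : IsFraming I (r + 1) F V) : Nonempty M := by
  by_contra hM
  rw [not_nonempty_iff] at hM
  have := hV.dim
  rw [Module.finrank_zero_of_subsingleton] at this
  omega

theorem mem_framingCx_map_pullSecFst {u : ∀ q : M₁ × M₂, Cx (GT (I₁.prod I₂) q)} :
    u ∈ framingCx (I₁.prod I₂) (V₁.map (pullSecFst (M₂ := M₂) I₁ I₂)) ↔
      ∃ v ∈ framingCx I₁ V₁, (fstLeg I₁ M₁ I₂ M₂).cPull v = u := by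
  constructor
  · rintro ⟨⟨a, ha, ha'⟩, b, hb, hb'⟩
    rw [pullSecFst_eq] at ha' hb'
    exact ⟨fun p => Cx.mk (a p) (b p), ⟨ha, hb⟩,
      funext fun q => Cx.ext (congrFun ha' q) (congrFun hb' q)⟩
  · rintro ⟨v, hv, rfl⟩
    exact ⟨⟨_, hv.1, pullSecFst_eq I₁ I₂ _⟩, ⟨_, hv.2, pullSecFst_eq I₁ I₂ _⟩⟩

theorem mem_framingCx_map_pullSecSnd {u : ∀ q : M₁ × M₂, Cx (GT (I₁.prod I₂) q)} :
    u ∈ framingCx (I₁.prod I₂) (V₂.map (pullSecSnd (M₁ := M₁) I₁ I₂)) ↔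
      ∃ v ∈ framingCx I₂ V₂, (sndLeg I₁ M₁ I₂ M₂).cPull v = u := by
  constructor
  · rintro ⟨⟨a, ha, ha'⟩, b, hb, hb'⟩
    rw [pullSecSnd_eq] at ha' hb'
    exact ⟨fun p => Cx.mk (a p) (b p), ⟨ha, hb⟩,
      funext fun q => Cx.ext (congrFun ha' q) (congrFun hb' q)⟩
  · rintro ⟨v, hv, rfl⟩
    exact ⟨⟨_, hv.1, pullSecSnd_eq I₁ I₂ _⟩, ⟨_, hv.2, pullSecSnd_eq I₁ I₂ _⟩⟩

/-- Pull-backs of `V₁ ⊗ ℂ` belong to the domain of `φ`, so `v + φ(v)` is a section of the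
eigenbundle; the framing condition identifies `φ(v)` with the pull-back of an element of `V₂ ⊗ ℂ`,
and surjectivity onto `V₂ ⊗ ℂ` gives the other direction. -/
theorem IsProductAdmissible.isCorrespondence (hV₁ : ∀ v ∈ V₁, v ∈ sections I₁ F₁)
    (h : IsProductAdmissible I₁ I₂ F₁ F₂ V₁ V₂ Ψ) :
    IsCorrespondence (fstLeg I₁ M₁ I₂ M₂) (sndLeg I₁ M₁ I₂ M₂) V₁ V₂ Ψ := by
  obtain ⟨-, φ, hφ⟩ := h
  have key : ∀ v ∈ framingCx I₁ V₁, ∀ q, (fstLeg I₁ M₁ I₂ M₂).cPull v q +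
      φ ((fstLeg I₁ M₁ I₂ M₂).cPull v) q ∈ eigenbundle (I₁.prod I₂) Ψ q := by
    intro v hv q
    have hs : (fstLeg I₁ M₁ I₂ M₂).cPull v ∈
        cSections (I₁.prod I₂) (complexify (I₁.prod I₂) (pullFst I₁ I₂ F₁)) := by
      have s := (fstLeg I₁ M₁ I₂ M₂).isCSmooth_cPull (z := v)
        ⟨(hV₁ _ hv.1).1, (hV₁ _ hv.2).1⟩
      refine ⟨s.1, s.2, fun q => ?_⟩
      have e := fstLeg_inc (M₁ := M₁) (M₂ := M₂) I₁ I₂ q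
      have m1 := Submodule.mem_map_of_mem (f := inFst I₁ I₂ q) ((hV₁ _ hv.1).2 q.1)
      have m2 := Submodule.mem_map_of_mem (f := inFst I₁ I₂ q) ((hV₁ _ hv.2).2 q.1)
      rw [← e] at m1 m2
      unfold complexify pullFst
      rw [← e]
      exact ⟨m1, m2⟩
    have : (fstLeg I₁ M₁ I₂ M₂).cPull v + φ ((fstLeg I₁ M₁ I₂ M₂).cPull v) ∈
        cSections (I₁.prod I₂) (eigenbundle (I₁.prod I₂) Ψ) := by
      rw [hφ.graph]
      exact ⟨_, hs, rfl⟩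
    exact this.2.2 q
  constructor
  · intro v hv
    have : φ ((fstLeg I₁ M₁ I₂ M₂).cPull v) ∈ _ :=
      hφ.framing ▸ Set.mem_image_of_mem φ ((mem_framingCx_map_pullSecFst I₁ I₂).2 ⟨v, hv, rfl⟩)
    obtain ⟨w, hw, hvw⟩ := (mem_framingCx_map_pullSecSnd I₁ I₂).1 this
    exact ⟨w, hw, fun q => by rw [hvw]; exact key v hv q⟩
  · intro w hw
    have := (mem_framingCx_map_pullSecSnd (M₁ := M₁) I₁ I₂).2 ⟨w, hw, rfl⟩
    rw [← hφ.framing] at this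
    obtain ⟨u, hu, huw⟩ := this
    obtain ⟨v, hv, rfl⟩ := (mem_framingCx_map_pullSecFst I₁ I₂).1 hu
    exact ⟨v, hv, fun q => by rw [← huw]; exact key v hv q⟩


/-- Admissibility is what makes the pairing constant on both framings, and hence provides isotropic
bases; the second factor is handled by the reversed correspondence. -/
theorem exists_isLinked [I₁.Boundaryless] [I₂.Boundaryless] [FiniteDimensional ℝ E₁]
    [FiniteDimensional ℝ E₂] [T2Space M₁] [T2Space M₂] (hJ₁ : IsGenAlmostContact I₁ F₁ Φ₁)
    (hJ₂ : IsGenAlmostContact I₂ F₂ Φ₂) (hV₁ : IsFraming I₁ 2 F₁ V₁) (hV₂ : IsFraming I₂ 2 F₂ V₂)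
    (h : IsProductAdmissible I₁ I₂ F₁ F₂ V₁ V₂ Ψ) :
    ∃ e₁ e₂ f₁ f₂, IsIsotropicBasis I₁ V₁ e₁ e₂ ∧ IsIsotropicBasis I₂ V₂ f₁ f₂ ∧
      IsLinked (fstLeg I₁ M₁ I₂ M₂) (sndLeg I₁ M₁ I₂ M₂) F₁ F₂ Φ₁ Φ₂ e₁ e₂ f₁ f₂ Ψ := by
  have := hV₁.nonempty
  have := hV₂.nonempty
  have hcorr := h.isCorrespondence I₁ I₂ hV₁.subset
  have hc := fstLeg_isComplement I₁ M₁ I₂ M₂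
  have sgf : IsSGF (I₁.prod I₂) (fun q => (F₁ ((fstLeg I₁ M₁ I₂ M₂).proj q)).map
      ((fstLeg I₁ M₁ I₂ M₂).inc q) ⊔ (F₂ ((sndLeg I₁ M₁ I₂ M₂).proj q)).map
      ((sndLeg I₁ M₁ I₂ M₂).inc q)) Ψ := by
    have e : (fun q => (F₁ ((fstLeg I₁ M₁ I₂ M₂).proj q)).map
        ((fstLeg I₁ M₁ I₂ M₂).inc q) ⊔ (F₂ ((sndLeg I₁ M₁ I₂ M₂).proj q)).map
        ((sndLeg I₁ M₁ I₂ M₂).inc q)) = fun q => pullFst I₁ I₂ F₁ q ⊔ pullSnd I₁ I₂ F₂ q := by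
      funext q
      rw [fstLeg_inc, sndLeg_inc]
      rfl
    rw [e]
    exact h.1
  obtain ⟨e₁, e₂, he⟩ := hV₁.exists_isotropicBasis hJ₁.split fun v hv w hw p p' =>
    hcorr.pairing_const hc (fun p₁ p₂ => ⟨(p₁, p₂), rfl, rfl⟩) (fun v hv => (hV₁.subset v hv).2)
      (fun v hv => (hV₂.subset v hv).2) sgf.skew hv hw p p'
  obtain ⟨f₁, f₂, hf⟩ := hV₂.exists_isotropicBasis hJ₂.split fun v hv w hw p p' =>
    hcorr.symm.pairing_const hc.symm (fun p₁ p₂ => ⟨(p₂, p₁), rfl, rfl⟩)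
      (fun v hv => (hV₂.subset v hv).2) (fun v hv => (hV₁.subset v hv).2)
      (fun q x hx y hy => sgf.skew q x (by rw [sup_comm]; exact hx) y (by rw [sup_comm]; exact hy))
      hv hw p p'
  exact ⟨e₁, e₂, f₁, f₂, he, hf,
    { complement := hc
      frame₁ := hJ₁.isAdaptedFrame hV₁ he
      frame₂ := hJ₂.isAdaptedFrame hV₂ hf
      sgf := sgf
      left := by rw [he.span_eq, hf.span_eq]; exact hcorr.left
      right := by rw [he.span_eq, hf.span_eq]; exact hcorr.right }⟩

end Product
end GenGeom

/-! ### The Morimoto product theorem. -/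

theorem mainTheorem6
    {E₁ : Type*} [NormedAddCommGroup E₁] [NormedSpace ℝ E₁] [FiniteDimensional ℝ E₁]
    {M₁ : Type*} [TopologicalSpace M₁] [T2Space M₁] [SecondCountableTopology M₁]
    [ChartedSpace E₁ M₁] [IsManifold 𝓘(ℝ, E₁) ∞ M₁]
    {E₂ : Type*} [NormedAddCommGroup E₂] [NormedSpace ℝ E₂] [FiniteDimensional ℝ E₂]
    {M₂ : Type*} [TopologicalSpace M₂] [T2Space M₂] [SecondCountableTopology M₂]
    [ChartedSpace E₂ M₂] [IsManifold 𝓘(ℝ, E₂) ∞ M₂]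
    -- the trivial split structures `E_i'` of rank two; `E_i` is the orthogonal complement
    (F₁' : ∀ p : M₁, Submodule ℝ (GenGeom.GT 𝓘(ℝ, E₁) p))
    (F₂' : ∀ p : M₂, Submodule ℝ (GenGeom.GT 𝓘(ℝ, E₂) p))
    (J₁ : ∀ p : M₁, GenGeom.GT 𝓘(ℝ, E₁) p →ₗ[ℝ] GenGeom.GT 𝓘(ℝ, E₁) p)
    (J₂ : ∀ p : M₂, GenGeom.GT 𝓘(ℝ, E₂) p →ₗ[ℝ] GenGeom.GT 𝓘(ℝ, E₂) p)
    (hJ₁ : GenGeom.IsGenAlmostContact 𝓘(ℝ, E₁) F₁' J₁)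
    (hJ₂ : GenGeom.IsGenAlmostContact 𝓘(ℝ, E₂) F₂' J₂)
    (V₁ : Submodule ℝ (∀ p : M₁, GenGeom.GT 𝓘(ℝ, E₁) p))
    (V₂ : Submodule ℝ (∀ p : M₂, GenGeom.GT 𝓘(ℝ, E₂) p))
    (hV₁ : GenGeom.IsFraming 𝓘(ℝ, E₁) 2 F₁' V₁)
    (hV₂ : GenGeom.IsFraming 𝓘(ℝ, E₂) 2 F₂' V₂) :
    (∀ Ψ : ∀ q : M₁ × M₂, GenGeom.GT (𝓘(ℝ, E₁).prod 𝓘(ℝ, E₂)) q →ₗ[ℝ]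
        GenGeom.GT (𝓘(ℝ, E₁).prod 𝓘(ℝ, E₂)) q,
      GenGeom.IsProductAdmissible 𝓘(ℝ, E₁) 𝓘(ℝ, E₂) F₁' F₂' V₁ V₂ Ψ →
        -- integrability of the Morimoto product is normality of both pairs
        (GenGeom.IsGeneralizedComplex (𝓘(ℝ, E₁).prod 𝓘(ℝ, E₂))
            (GenGeom.morimotoProduct 𝓘(ℝ, E₁) 𝓘(ℝ, E₂) J₁ J₂ Ψ) ↔
          GenGeom.IsNormalPair 𝓘(ℝ, E₁) (GenGeom.orth 𝓘(ℝ, E₁) F₁') F₁' J₁ V₁ ∧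
          GenGeom.IsNormalPair 𝓘(ℝ, E₂) (GenGeom.orth 𝓘(ℝ, E₂) F₂') F₂' J₂ V₂) ∧
        -- each `(J_i, V_i)` has associated triples, and normality may be tested on any of them
        (∃ e₁ e₂, GenGeom.IsIsotropicBasis 𝓘(ℝ, E₁) V₁ e₁ e₂) ∧
        (∀ e₁ e₂, GenGeom.IsIsotropicBasis 𝓘(ℝ, E₁) V₁ e₁ e₂ →
          GenGeom.IsGenAlmostContactTriple 𝓘(ℝ, E₁) J₁ e₁ e₂ ∧
          (GenGeom.IsNormalPair 𝓘(ℝ, E₁) (GenGeom.orth 𝓘(ℝ, E₁) F₁') F₁' J₁ V₁ ↔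
            GenGeom.IsNormalTriple 𝓘(ℝ, E₁) J₁ e₁ e₂)) ∧
        (∃ e₁ e₂, GenGeom.IsIsotropicBasis 𝓘(ℝ, E₂) V₂ e₁ e₂) ∧
        (∀ e₁ e₂, GenGeom.IsIsotropicBasis 𝓘(ℝ, E₂) V₂ e₁ e₂ →
          GenGeom.IsGenAlmostContactTriple 𝓘(ℝ, E₂) J₂ e₁ e₂ ∧
          (GenGeom.IsNormalPair 𝓘(ℝ, E₂) (GenGeom.orth 𝓘(ℝ, E₂) F₂') F₂' J₂ V₂ ↔
            GenGeom.IsNormalTriple 𝓘(ℝ, E₂) J₂ e₁ e₂))) ∧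
    -- integrability does not depend on the choice of `Ψ`
    (∀ Ψ Ψ' : ∀ q : M₁ × M₂, GenGeom.GT (𝓘(ℝ, E₁).prod 𝓘(ℝ, E₂)) q →ₗ[ℝ]
        GenGeom.GT (𝓘(ℝ, E₁).prod 𝓘(ℝ, E₂)) q,
      GenGeom.IsProductAdmissible 𝓘(ℝ, E₁) 𝓘(ℝ, E₂) F₁' F₂' V₁ V₂ Ψ →
      GenGeom.IsProductAdmissible 𝓘(ℝ, E₁) 𝓘(ℝ, E₂) F₁' F₂' V₁ V₂ Ψ' →
        (GenGeom.IsGeneralizedComplex (𝓘(ℝ, E₁).prod 𝓘(ℝ, E₂))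
            (GenGeom.morimotoProduct 𝓘(ℝ, E₁) 𝓘(ℝ, E₂) J₁ J₂ Ψ) ↔
          GenGeom.IsGeneralizedComplex (𝓘(ℝ, E₁).prod 𝓘(ℝ, E₂))
            (GenGeom.morimotoProduct 𝓘(ℝ, E₁) 𝓘(ℝ, E₂) J₁ J₂ Ψ'))) := by
  have main := fun Ψ hadm =>
    GenGeom.exists_isLinked 𝓘(ℝ, E₁) 𝓘(ℝ, E₂) hJ₁ hJ₂ hV₁ hV₂ (Ψ := Ψ) hadm
  have iff : ∀ Ψ, GenGeom.IsProductAdmissible 𝓘(ℝ, E₁) 𝓘(ℝ, E₂) F₁' F₂' V₁ V₂ Ψ →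
      (GenGeom.IsGeneralizedComplex (𝓘(ℝ, E₁).prod 𝓘(ℝ, E₂))
          (GenGeom.morimotoProduct 𝓘(ℝ, E₁) 𝓘(ℝ, E₂) J₁ J₂ Ψ) ↔
        GenGeom.IsNormalPair 𝓘(ℝ, E₁) (GenGeom.orth 𝓘(ℝ, E₁) F₁') F₁' J₁ V₁ ∧
        GenGeom.IsNormalPair 𝓘(ℝ, E₂) (GenGeom.orth 𝓘(ℝ, E₂) F₂') F₂' J₂ V₂) := by
    intro Ψ hadm
    obtain ⟨e₁, e₂, f₁, f₂, he, hf, h⟩ := main Ψ hadm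
    rw [← GenGeom.legProduct_eq_morimotoProduct, h.isGeneralizedComplex_iff,
      h.frame₁.isNormalPair_iff hJ₁.sgf he.span_eq, h.frame₂.isNormalPair_iff hJ₂.sgf hf.span_eq]
  -- Normality of the two pairs does not involve `Ψ`, so chaining the equivalences for `Ψ` and `Ψ'`
  -- gives independence.
  refine ⟨fun Ψ hadm => ⟨iff Ψ hadm, ?_⟩, fun Ψ Ψ' hadm hadm' =>
    (iff Ψ hadm).trans (iff Ψ' hadm').symm⟩
  obtain ⟨e₁, e₂, f₁, f₂, he, hf, -⟩ := main Ψ hadm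
  refine ⟨⟨e₁, e₂, he⟩, fun e₁ e₂ he => ?_, ⟨f₁, f₂, hf⟩, fun f₁ f₂ hf => ?_⟩
  · have h := hJ₁.isAdaptedFrame hV₁ he
    exact ⟨h.isGenAlmostContactTriple,
      (h.isNormalPair_iff hJ₁.sgf he.span_eq).trans h.isNormalTriple_iff.symm⟩
  · have h := hJ₂.isAdaptedFrame hV₂ hf
    exact ⟨h.isGenAlmostContactTriple,
      (h.isNormalPair_iff hJ₂.sgf hf.span_eq).trans h.isNormalTriple_iff.symm⟩
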